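/- **Theorem 8.3 (Hyperbolicity criterion).** Let $\mathcal U$ be a complex analytic Banach manifold, $\mathcal A\subset\mathcal U$ a compact set, $\mathcal V\subset \mathcal U$ an open neighborhood of $\mathcal A$, and $L:\mathcal V\to\mathcal U$ a complex analytic map with $L(\mathcal A)\subset\mathcal A$. Let $\mathcal U$ be endowed with a distance inducing its topology and let the tangent spaces be endowed with norms which, near every point of $\mathcal A$, are respectively bi-Lipschitz equivalent to the norm distance in a chart and (over points of $\mathcal A$) uniformly equivalent to the norm of the model space read in a chart (for example, the distance and the norms of a Finsler metric). Assume: (i) $L|_{\mathcal A}$ is topologically transitive and has the specification property: for every $\varepsilon>0$ there is $l=l(\varepsilon)$ such that for every $N\ge 1$ and $f\in\mathcal A$ there is a periodic point $g\in\mathcal A$ of period at most $N+l$ with $\operatorname{dist}(L^kf,L^kg)\le\varepsilon$ for $0\le k\le N-1$. (ii) There is an invariant continuous complex codimension-one subbundle $\mathcal E^s=\{E^s_f\}_{f\in\mathcal A}$ of $T_{\mathcal A}\mathcal U$ on which $DL$ is uniformly exponentially contracting: $DL(E^s_f)\subset E^s_{Lf}$, and there are $C>0$, $q\in(0,1)$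 with $\|DL^n_f v\|\le Cq^n\|v\|$ for all $f\in\mathcal A$, $v\in E^s_f$, $n\ge0$. (iii) $L$ is transversally nonsingular: for every $f\in\mathcal A$ the quotient map $T_f\mathcal U/E^s_f\to T_{Lf}\mathcal U/E^s_{Lf}$ induced by $DL_f$ is invertible. (iv) There is $\varepsilon>0$ such that there are no slowly $\varepsilon$-shadowing orbits: whenever $g\in\mathcal A$ and $f\in\mathcal V$ has all its iterates $L^kf$, $k\ge 0$, in $\mathcal V$ and $\operatorname{dist}(L^kf,L^kg)\le\varepsilon$ for all $k\ge0$, there are $C>0$, $q\in(0,1)$ with $\operatorname{dist}(L^kf,L^kg)\le Cq^k$ for all $k\ge0$. Then $L$ is uniformly hyperbolic over $\mathcal A$, in the following sense. Let $\hat{\mathcal A}$ be the natural extension, i.e. the set of two-sided orbits $\mathbf f=(f_n)_{n\in\mathbb Z}$, $f_n\in\mathcal A$, $Lf_n=f_{n+1}$, let $\hat L\mathbf f=(Lf_n)_{n\in\mathbb Z}$, and write $f=f_0$. There are an invariant continuous subbundle $\mathcal E^{s}\subset T_{\mathcal A}\mathcal U$ (not required to be the one in (ii)) on which $DL$ is uniformly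 exponentially contracting, and a family of closed complex subspaces $E^u_{\mathbf f}\subset T_f\mathcal U$, $\mathbf f\in\hat{\mathcal A}$, such that $E^s_f\oplus E^u_{\mathbf f}=T_f\mathcal U$, $DL_f(E^u_{\mathbf f})=E^u_{\hat L\mathbf f}$, and, for some $c>0$ and $\rho>1$, $$\|DL^n_f v\|\ge c\rho^n\|v\|,\qquad \mathbf f\in\hat{\mathcal A},\ v\in E^u_{\mathbf f},\ n\ge0.$$ -/

import Mathlib

open Set Filter Topology
open scoped Manifold ContDiff

noncomputable section

namespace LyubichHyp

section Dynamics

variable {X : Type*}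

/-- `L|A` is topologically transitive: any two nonempty relatively open subsets of `A` are
connected by an orbit segment. -/
def IsTransitiveOn [TopologicalSpace X] (L : X → X) (A : Set X) : Prop :=
  ∀ O₁ O₂ : Set X, IsOpen O₁ → IsOpen O₂ → (O₁ ∩ A).Nonempty → (O₂ ∩ A).Nonempty →
    ∃ n : ℕ, ∃ x ∈ O₁ ∩ A, L^[n] x ∈ O₂ ∩ A

/-- The specification property of `L|A`: for every `ε > 0` there is `l` such that every orbit
segment `x, L x, …, L^(N-1) x` in `A` is `ε`-shadowed by a periodic orbit in `A` of period at
most `N + l`. -/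
def SpecificationOn [PseudoMetricSpace X] (L : X → X) (A : Set X) : Prop :=
  ∀ ε : ℝ, 0 < ε → ∃ l : ℕ, ∀ N : ℕ, 1 ≤ N → ∀ x ∈ A,
    ∃ y ∈ A, ∃ p : ℕ, 1 ≤ p ∧ p ≤ N + l ∧ Function.IsPeriodicPt L p y ∧
      ∀ k < N, dist (L^[k] x) (L^[k] y) ≤ ε

/-- The forward orbits of `x` and `y` are exponentially asymptotic. -/
def ExpAsymptotic [PseudoMetricSpace X] (L : X → X) (x y : X) : Prop :=
  ∃ C q : ℝ, 0 < C ∧ 0 < q ∧ q < 1 ∧ ∀ n : ℕ, dist (L^[n] x) (L^[n] y) ≤ C * q ^ n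

/-- The map `L`, defined on `V`, has no slowly `ε`-shadowing orbits over `A`: whenever the whole
forward orbit of `x` is defined (stays in `V`) and `ε`-shadows the orbit of a point `y ∈ A`, it is
exponentially asymptotic to it. -/
def NoSlowShadowing [PseudoMetricSpace X] (L : X → X) (V A : Set X) (ε : ℝ) : Prop :=
  ¬ ∃ x y : X, y ∈ A ∧ (∀ n : ℕ, L^[n] x ∈ V) ∧
    (∀ n : ℕ, dist (L^[n] x) (L^[n] y) ≤ ε) ∧ ¬ ExpAsymptotic L x y

/-- The natural extension of `L|A`: the space of two-sided orbits contained in `A`. -/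
structure NatExt (L : X → X) (A : Set X) where
  /-- The coordinates of the two-sided orbit. -/
  pt : ℤ → X
  mem : ∀ n, pt n ∈ A
  orbit : ∀ n, L (pt n) = pt (n + 1)

/-- The lift of `L` to the natural extension, acting coordinatewise. -/
def NatExt.lift {L : X → X} {A : Set X} (f : NatExt L A) : NatExt L A where
  pt := fun n => L (f.pt n)
  mem := fun n => (f.orbit n).symm ▸ f.mem (n + 1)
  orbit := fun n => congrArg L (f.orbit n)

end Dynamics

section Manifold

variable {E : Type*} [NormedAddCommGroup E] [NormedSpace ℂ E]
variable {U : Type*}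

/-- The tangent space at `x` of the complex Banach manifold `U` modelled on `E`. -/
abbrev Tan (E : Type*) [NormedAddCommGroup E] [NormedSpace ℂ E] {U : Type*} [TopologicalSpace U]
    [ChartedSpace E U] (x : U) : Type _ :=
  TangentSpace 𝓘(ℂ, E) x

/-- The differential at `x` of the preferred chart of `U` around `x₀`. -/
def chartDeriv [TopologicalSpace U] [ChartedSpace E U] (x₀ x : U) : Tan E x →L[ℂ] E :=
  mfderiv 𝓘(ℂ, E) 𝓘(ℂ, E) (chartAt E x₀) x

/-- The differential of the `n`-th iterate of `L` at `x`. -/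
def iterDeriv (E : Type*) [NormedAddCommGroup E] [NormedSpace ℂ E] {U : Type*}
    [TopologicalSpace U] [ChartedSpace E U] (L : U → U) (n : ℕ) (x : U) :
    Tan E x →L[ℂ] Tan E (L^[n] x) :=
  mfderiv 𝓘(ℂ, E) 𝓘(ℂ, E) (L^[n]) x

/-- The distance of `U` is compatible with the manifold structure near `A`: around every point of
`A` it is bi-Lipschitz equivalent to the norm distance in a chart (for instance, the distance
induced by a Finsler metric). -/
def CompatibleDist (E : Type*) [NormedAddCommGroup E] {U : Type*} [MetricSpace U]
    [ChartedSpace E U] (A : Set U) : Prop :=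
  ∀ x₀ ∈ A, ∃ K : ℝ, 0 < K ∧ ∃ W ∈ 𝓝 x₀, ∀ x ∈ W, ∀ y ∈ W,
    dist x y ≤ K * ‖chartAt E x₀ x - chartAt E x₀ y‖ ∧
    ‖chartAt E x₀ x - chartAt E x₀ y‖ ≤ K * dist x y

/-- A family of (semi)norms on the tangent spaces is compatible with the bundle structure of the
restriction of the tangent bundle to `A`: around every point of `A` it is uniformly equivalent to
the norm of the model space read in a chart (for instance, a continuous Finsler metric). -/
def CompatibleNorm [TopologicalSpace U] [ChartedSpace E U]
    (N : ∀ x : U, Seminorm ℂ (Tan E x)) (A : Set U) : Prop :=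
  ∀ x₀ ∈ A, ∃ K : ℝ, 0 < K ∧ ∃ W ∈ 𝓝 x₀, ∀ x ∈ W ∩ A, ∀ v : Tan E x,
    N x v ≤ K * ‖chartDeriv x₀ x v‖ ∧ ‖chartDeriv x₀ x v‖ ≤ K * N x v

/-- The subspaces `S x`, `x ∈ A`, form a continuous complex vector subbundle of the restriction of
the tangent bundle to `A`: near every `x₀ ∈ A` it is straightened, in a chart, to a fixed closed
complemented subspace `F` of the model space by a norm-continuous family `Φ x` of linear
automorphisms. -/
def IsSubbundle [TopologicalSpace U] [ChartedSpace E U] (A : Set U)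
    (S : ∀ x : U, Submodule ℂ (Tan E x)) : Prop :=
  ∀ x₀ ∈ A, ∃ F : Submodule ℂ E, IsClosed (F : Set E) ∧ F.ClosedComplemented ∧
    ∃ W ∈ 𝓝 x₀, ∃ Φ : U → (E ≃L[ℂ] E),
      ContinuousOn (fun x => (Φ x : E →L[ℂ] E)) (W ∩ A) ∧
      ∀ x ∈ W ∩ A, ∀ v : Tan E x, v ∈ S x ↔ Φ x (chartDeriv x₀ x v) ∈ F

/-- Invariance of the subspaces `S x`, `x ∈ A`, under the differential of `L`. -/
def IsInvariantFamily [TopologicalSpace U] [ChartedSpace E U] (L : U → U) (A : Set U)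
    (S : ∀ x : U, Submodule ℂ (Tan E x)) : Prop :=
  ∀ x ∈ A, S x ≤ (S (L x)).comap
    (mfderiv 𝓘(ℂ, E) 𝓘(ℂ, E) L x : Tan E x →L[ℂ] Tan E (L x)).toLinearMap

/-- `DL` is uniformly exponentially contracting on the family `S x`, `x ∈ A`. -/
def UniformlyContracting [TopologicalSpace U] [ChartedSpace E U]
    (N : ∀ x : U, Seminorm ℂ (Tan E x)) (L : U → U) (A : Set U)
    (S : ∀ x : U, Submodule ℂ (Tan E x)) : Prop :=
  ∃ C q : ℝ, 0 < C ∧ 0 < q ∧ q < 1 ∧ ∀ x ∈ A, ∀ v ∈ S x, ∀ n : ℕ,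
    N (L^[n] x) (iterDeriv E L n x v) ≤ C * q ^ n * N x v

/-- `L` is uniformly hyperbolic over `A`; the unstable spaces are labelled by the points of the
natural extension. -/
def UniformlyHyperbolic [TopologicalSpace U] [ChartedSpace E U]
    (N : ∀ x : U, Seminorm ℂ (Tan E x)) (L : U → U) (A : Set U) : Prop :=
  ∃ (Es : ∀ x : U, Submodule ℂ (Tan E x))
    (Eu : ∀ f : NatExt L A, Submodule ℂ (Tan E (f.pt 0))),
    IsSubbundle A Es ∧ IsInvariantFamily L A Es ∧ UniformlyContracting N L A Es ∧
    (∀ f : NatExt L A, IsClosed (Eu f : Set (Tan E (f.pt 0)))) ∧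
    (∀ f : NatExt L A, IsCompl (Es (f.pt 0)) (Eu f)) ∧
    (∀ f : NatExt L A, Eu f.lift =
      (Eu f).map (mfderiv 𝓘(ℂ, E) 𝓘(ℂ, E) L (f.pt 0) :
        Tan E (f.pt 0) →L[ℂ] Tan E (L (f.pt 0))).toLinearMap) ∧
    ∃ c ρ : ℝ, 0 < c ∧ 1 < ρ ∧ ∀ f : NatExt L A, ∀ v ∈ Eu f, ∀ n : ℕ,
      c * ρ ^ n * N (f.pt 0) v ≤ N (L^[n] (f.pt 0)) (iterDeriv E L n (f.pt 0) v)

end Manifold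

end LyubichHyp

end

/-! Since `Es` has codimension one, `DL^n` acts on the quotient by `Es` as multiplication by a
scalar cocycle `lam L n x`, and everything depends on how this cocycle grows.

If some periodic point has a multiplier of modulus less than one, it attracts in all directions,
because `Es` is contracted anyway. Transitivity then forces `A` to be that periodic orbit, and the
whole tangent bundle is contracted: the stable bundle becomes `⊤` and the unstable spaces vanish
(`contracts_top_of_attracting`).

Otherwise all periodic multipliers have modulus at least one. Specification compares an arbitrary
orbit segment with a periodic one, so the cocycle decays at most subexponentially
(`exists_lam_lower`). By compactness it either expands uniformly or stays bounded along the orbit of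
some `g` (`uniform_expansion_or_bounded`). In the expanding case, transverse vectors pushed forward
along a backward orbit and normalised in the quotient form a Cauchy sequence, because consecutive
terms differ by contracted vectors of `Es`; the limit spans the unstable line
(`exists_unstable_family`).

The bounded case is excluded by holomorphy (`exists_slow_shadow`). For a suitable iterate, `Es` is
contracted much more than the quotient, and displacements between nearby orbits have forward
invariant horizontal cones. Take a holomorphic disc through `g` transverse to `Es`, and keep the
parameters whose orbits have stayed in a thin tube around the orbit of `g` up to time `n`. Once an
orbit is a definite distance away it leaves the tube in bounded time: otherwise a limit of long
stays would shadow forever without being exponentially asymptotic, since the cocycle contracts too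
slowly (`not_expAsymptotic_of_slowPair`). The limit exists in infinite dimension because
non-horizontal displacements shrink, so late images of the disc are almost one-dimensional
(`totallyBounded_images`). Thus the transverse displacement is bounded below on the frontier of the
parameter region, while its derivative at the centre is a bounded value of the cocycle. A Schwarz
lemma keeps the regions from shrinking to the centre, and a nonzero parameter common to all their
closures is a slowly shadowing orbit. -/

noncomputable section

namespace LyubichHyp

/-! ### Invariant cones, distortion and slow pairs -/

/-- A map `G` near an invariant set `A`, read in uniformly bi-Lipschitz coordinates `ψ x` around
the points `x ∈ A`, together with functionals `ℓ x` whose kernels are dominated: the linear part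
`T x` multiplies `ℓ` by `lam x` and contracts the kernel of `ℓ x` at a smaller rate. -/
structure ConeSystem (E : Type*) [NormedAddCommGroup E] [NormedSpace ℂ E] {U : Type*}
    [MetricSpace U] (G : U → U) (A : Set U) where
  ψ : U → U → E
  ℓ : U → E →L[ℂ] ℂ
  T : U → E →L[ℂ] E
  lam : U → ℂ
  r : ℝ
  K : ℝ
  q : ℝ
  B : ℝ
  l0 : ℝ
  r_pos : 0 < r
  one_le_K : 1 ≤ K
  q_nonneg : 0 ≤ q
  B_nonneg : 0 ≤ B
  l0_pos : 0 < l0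
  l0_le_one : l0 ≤ 1
  q_le : q ≤ l0 / 4
  bilip : ∀ x ∈ A, ∀ y ∈ Metric.ball x r, ∀ y' ∈ Metric.ball x r,
    dist y y' ≤ K * ‖ψ x y - ψ x y'‖ ∧ ‖ψ x y - ψ x y'‖ ≤ K * dist y y'
  strict : ∀ x ∈ A, ∀ y ∈ Metric.ball x r, ∀ y' ∈ Metric.ball x r,
    ‖ψ (G x) (G y) - ψ (G x) (G y') - T x (ψ x y - ψ x y')‖ ≤
      K * (dist y x + dist y' x) * ‖ψ x y - ψ x y'‖
  T_le : ∀ x ∈ A, ∀ v, ‖T x v‖ ≤ q * ‖v‖ + B * ‖ℓ x v‖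
  equivar : ∀ x ∈ A, ∀ v, ℓ (G x) (T x v) = lam x * ℓ x v
  l0_le : ∀ x ∈ A, l0 ≤ ‖lam x‖
  norm_ℓ_le : ∀ x ∈ A, ‖ℓ x‖ ≤ K
  maps : MapsTo G A A
  cont : ∀ x ∈ A, ∀ y ∈ Metric.ball x r, ContinuousAt G y

namespace ConeSystem

variable {E : Type*} [NormedAddCommGroup E] [NormedSpace ℂ E] {U : Type*} [MetricSpace U]
  {G : U → U} {A : Set U} (S : ConeSystem E G A)

/-- The opening of the invariant horizontal cones. -/
def M : ℝ := 8 * S.B / S.l0 + S.K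

lemma K_pos : 0 < S.K := zero_lt_one.trans_le S.one_le_K

lemma K_le_M : S.K ≤ S.M := by
  have : 0 ≤ 8 * S.B / S.l0 := div_nonneg (mul_nonneg (by norm_num) S.B_nonneg) S.l0_pos.le
  unfold M; linarith

lemma M_pos : 0 < S.M := S.K_pos.trans_le S.K_le_M

lemma B_le : 8 * S.B ≤ S.l0 * S.M := by
  have h := S.l0_pos
  have : S.l0 * S.M = 8 * S.B + S.l0 * S.K := by unfold M; field_simp
  have := mul_pos h S.K_pos
  linarith

/-- Radii of tubes on which the nonlinear terms do not destroy the cones. -/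
structure Small (ρ : ℝ) : Prop where
  pos : 0 < ρ
  lt : ρ < S.r
  le : 2 * S.K ^ 2 * S.M * ρ ≤ S.l0 / 8

lemma exists_small {ε : ℝ} (hε : 0 < ε) : ∃ ρ, S.Small ρ ∧ ρ ≤ ε := by
  have hc : 0 < 2 * S.K ^ 2 * S.M := by have := S.K_pos; have := S.M_pos; positivity
  refine ⟨min ε (min (S.r / 2) (S.l0 / 8 / (2 * S.K ^ 2 * S.M))), ⟨?_, ?_, ?_⟩, min_le_left _ _⟩
  · exact lt_min hε (lt_min (half_pos S.r_pos) (div_pos (by linarith [S.l0_pos]) hc))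
  · exact ((min_le_right _ _).trans (min_le_left _ _)).trans_lt (half_lt_self S.r_pos)
  · calc _ ≤ 2 * S.K ^ 2 * S.M * (S.l0 / 8 / (2 * S.K ^ 2 * S.M)) := by
          gcongr; exact (min_le_right _ _).trans (min_le_right _ _)
      _ = _ := mul_div_cancel₀ _ hc.ne'

variable {S}

lemma Small.mono {ρ ρ' : ℝ} (h : S.Small ρ) (h0 : 0 < ρ') (hle : ρ' ≤ ρ) : S.Small ρ' where
  pos := h0
  lt := hle.trans_lt h.lt
  le := le_trans (by have := S.M_pos; gcongr) h.le

lemma Small.two_K_le {ρ : ℝ} (h : S.Small ρ) : 2 * S.K * ρ ≤ S.l0 / 8 := by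
  refine le_trans ?_ h.le
  have h1 : 1 ≤ S.K * S.M := by nlinarith [S.one_le_K, S.K_le_M]
  have h2 : 0 ≤ 2 * S.K * ρ := by have := S.K_pos; have := h.pos; positivity
  nlinarith

lemma Small.mem_ball {ρ : ℝ} (h : S.Small ρ) {x y : U} (hy : dist y x ≤ ρ) :
    y ∈ Metric.ball x S.r := Metric.mem_ball.2 (hy.trans_lt h.lt)

/-- Forward invariance of the horizontal cones. -/
lemma cone_step {ρ : ℝ} (h : S.Small ρ) {x y y' : U} (hx : x ∈ A) (hy : dist y x ≤ ρ)
    (hy' : dist y' x ≤ ρ)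
    (hd : ‖S.ψ x y - S.ψ x y'‖ ≤ S.M * ‖S.ℓ x (S.ψ x y - S.ψ x y')‖) :
    ‖S.ψ (G x) (G y) - S.ψ (G x) (G y')‖ ≤
        S.M * ‖S.ℓ (G x) (S.ψ (G x) (G y) - S.ψ (G x) (G y'))‖ ∧
      ‖S.lam x‖ * Real.exp (-(2 * (S.K ^ 2 * S.M / S.l0) * (dist y x + dist y' x))) *
          ‖S.ℓ x (S.ψ x y - S.ψ x y')‖ ≤
        ‖S.ℓ (G x) (S.ψ (G x) (G y) - S.ψ (G x) (G y'))‖ := by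
  set d := S.ψ x y - S.ψ x y'
  set d' := S.ψ (G x) (G y) - S.ψ (G x) (G y')
  set s := dist y x + dist y' x
  have hs0 : 0 ≤ s := by positivity
  have hs : s ≤ 2 * ρ := by simp only [s]; linarith
  have hK := S.K_pos
  have hM := S.M_pos
  have hl := S.l0_pos
  have herr : ‖d' - S.T x d‖ ≤ S.K * s * ‖d‖ :=
    S.strict x hx y (h.mem_ball hy) y' (h.mem_ball hy')
  have hT := S.T_le x hx d
  set t := ‖S.ℓ x d‖
  have ht : 0 ≤ t := norm_nonneg _
  have hlam := S.l0_le x hx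
  set Λ := ‖S.lam x‖
  have hΛ : 0 < Λ := hl.trans_le hlam
  have h1 : ‖d'‖ ≤ ‖S.T x d‖ + S.K * s * ‖d‖ := by
    have := norm_add_le (S.T x d) (d' - S.T x d)
    rw [add_sub_cancel] at this
    linarith
  have h2 : Λ * t - S.K * (S.K * s * (S.M * t)) ≤ ‖S.ℓ (G x) d'‖ := by
    have e : S.ℓ (G x) d' = S.lam x * S.ℓ x d + S.ℓ (G x) (d' - S.T x d) := by
      rw [(S.ℓ (G x)).map_sub d' (S.T x d), S.equivar x hx]; ring
    have h3 : ‖S.ℓ (G x) (d' - S.T x d)‖ ≤ S.K * (S.K * s * (S.M * t)) := by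
      refine (S.ℓ (G x)).le_opNorm _ |>.trans ?_
      gcongr
      · exact S.norm_ℓ_le _ (S.maps hx)
      · exact herr.trans (by gcongr)
    have h4 := norm_sub_le (S.lam x * S.ℓ x d + S.ℓ (G x) (d' - S.T x d))
      (S.ℓ (G x) (d' - S.T x d))
    rw [add_sub_cancel_right, norm_mul, ← e] at h4
    linarith
  -- Here `u` is the relative error in the transverse component: the nonlinear term is at most `u *
  -- l0 * t`, and `Small.le` makes `u` at most 1/8.
  set u := S.K ^ 2 * S.M / S.l0 * s with hu
  have hu0 : 0 ≤ u := by positivity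
  have hu1 : u ≤ 1 / 8 := by
    rw [hu, div_mul_eq_mul_div, div_le_iff₀ hl]
    have := h.le
    have : S.K ^ 2 * S.M * s ≤ S.K ^ 2 * S.M * (2 * ρ) := by gcongr
    linarith
  have h5 : Λ * (1 - u) * t ≤ ‖S.ℓ (G x) d'‖ := by
    refine le_trans ?_ h2
    have : S.K ^ 2 * S.M * s = u * S.l0 := by rw [hu]; field_simp
    have h6 : u * S.l0 * t ≤ u * Λ * t := by gcongr
    nlinarith
  constructor
  -- The three contributions to `d'` are at most 1/4, 1/8 and 1/8 of `l0 * M * t`, while the new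
  -- transverse component is at least 7/8 of `l0 * t`; the value 3/4 lies in between.
  · have h7 : ‖d'‖ ≤ S.M * (3 / 4 * S.l0 * t) := by
      have hq := S.q_le
      have a1 : S.q * ‖d‖ ≤ S.l0 / 4 * (S.M * t) := by gcongr
      have a2 : S.K * s * ‖d‖ ≤ S.l0 / 8 * (S.M * t) := by
        gcongr
        have := h.two_K_le
        nlinarith
      have a3 : S.B * t ≤ S.l0 * S.M / 8 * t := by
        gcongr; linarith [S.B_le]
      have : 0 ≤ S.l0 * S.M * t := by positivity
      nlinarith
    refine h7.trans ?_
    gcongr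
    refine le_trans (mul_le_mul_of_nonneg_right ?_ ht) h5
    nlinarith
  · refine le_trans ?_ h5
    gcongr
    -- The loss `1 - u` is at least `exp (-2u)` for small `u`. In this form the losses along an
    -- orbit multiply to the exponential of a sum of distances.
    have e : -(2 * (S.K ^ 2 * S.M / S.l0) * s) = -(2 * u) := by rw [hu]; ring
    rw [e, Real.exp_neg, inv_le_comm₀ (Real.exp_pos _) (by linarith)]
    have h8 : 1 + 2 * u ≤ Real.exp (2 * u) := by linarith [Real.add_one_le_exp (2 * u)]
    refine le_trans ?_ h8
    rw [inv_le_iff_one_le_mul₀ (by linarith)]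
    nlinarith

/-- Vectors outside the horizontal cone are contracted. -/
lemma vertical_step {ρ : ℝ} (h : S.Small ρ) {x y y' : U} (hx : x ∈ A) (hy : dist y x ≤ ρ)
    (hy' : dist y' x ≤ ρ)
    (hd : S.M * ‖S.ℓ x (S.ψ x y - S.ψ x y')‖ < ‖S.ψ x y - S.ψ x y'‖) :
    ‖S.ψ (G x) (G y) - S.ψ (G x) (G y')‖ ≤ 1 / 2 * ‖S.ψ x y - S.ψ x y'‖ := by
  set d := S.ψ x y - S.ψ x y'
  set d' := S.ψ (G x) (G y) - S.ψ (G x) (G y')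
  set s := dist y x + dist y' x
  have hs : s ≤ 2 * ρ := by simp only [s]; linarith
  have hK := S.K_pos
  have hM := S.M_pos
  have hl := S.l0_pos
  have hl1 := S.l0_le_one
  have herr : ‖d' - S.T x d‖ ≤ S.K * s * ‖d‖ :=
    S.strict x hx y (h.mem_ball hy) y' (h.mem_ball hy')
  have hT := S.T_le x hx d
  have h1 : ‖d'‖ ≤ ‖S.T x d‖ + S.K * s * ‖d‖ := by
    have := norm_add_le (S.T x d) (d' - S.T x d)
    rw [add_sub_cancel] at this
    linarith
  have hd0 := norm_nonneg d
  have a1 : S.q * ‖d‖ ≤ 1 / 4 * ‖d‖ := by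
    gcongr; linarith [S.q_le]
  have a2 : S.K * s * ‖d‖ ≤ 1 / 8 * ‖d‖ := by
    gcongr
    have := h.two_K_le
    nlinarith
  have a3 : S.B * ‖S.ℓ x d‖ ≤ 1 / 8 * ‖d‖ := by
    have a : S.B * ‖S.ℓ x d‖ ≤ S.l0 * S.M / 8 * ‖S.ℓ x d‖ := by
      gcongr; linarith [S.B_le]
    nlinarith
  linarith

lemma iterate_mem {x : U} (S : ConeSystem E G A) (hx : x ∈ A) (n : ℕ) : G^[n] x ∈ A :=
  S.maps.iterate n hx

/-- The displacement between the `n`-th iterates of `y` and `y'`, in the coordinates at the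
`n`-th iterate of `x`. -/
def disp (S : ConeSystem E G A) (x y y' : U) (n : ℕ) : E :=
  S.ψ (G^[n] x) (G^[n] y) - S.ψ (G^[n] x) (G^[n] y')

lemma disp_shift (x y y' : U) (n k : ℕ) :
    S.disp (G^[k] x) (G^[k] y) (G^[k] y') n = S.disp x y y' (n + k) := by
  simp only [disp, Function.iterate_add_apply]

/-- The displacement is horizontal. -/
def Hor (S : ConeSystem E G A) (x y y' : U) (n : ℕ) : Prop :=
  ‖S.disp x y y' n‖ ≤ S.M * ‖S.ℓ (G^[n] x) (S.disp x y y' n)‖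

lemma hor_shift {x y y' : U} {n k : ℕ} :
    S.Hor (G^[k] x) (G^[k] y) (G^[k] y') n ↔ S.Hor x y y' (n + k) := by
  rw [Hor, Hor, disp_shift, Function.iterate_add_apply]

lemma hor_succ {ρ : ℝ} (h : S.Small ρ) {x y y' : U} (hx : x ∈ A) {n : ℕ}
    (hy : dist (G^[n] y) (G^[n] x) ≤ ρ) (hy' : dist (G^[n] y') (G^[n] x) ≤ ρ)
    (hd : S.Hor x y y' n) : S.Hor x y y' (n + 1) := by
  have := (cone_step h (S.iterate_mem hx n) hy hy' hd).1
  simpa only [Hor, disp, Function.iterate_succ_apply'] using this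

/-- Cones are forward invariant, so a displacement outside the cone at time `n` was outside it at
every earlier time, and each step halved it. -/
lemma norm_disp_le_of_not_hor {ρ : ℝ} (h : S.Small ρ) {x y y' : U} (hx : x ∈ A) {n : ℕ}
    (hy : ∀ k < n, dist (G^[k] y) (G^[k] x) ≤ ρ) (hy' : ∀ k < n, dist (G^[k] y') (G^[k] x) ≤ ρ)
    (hd : ¬ S.Hor x y y' n) : ‖S.disp x y y' n‖ ≤ (1 / 2) ^ n * ‖S.disp x y y' 0‖ := by
  induction n with
  | zero => simp
  | succ n ih =>
    have hn : ¬ S.Hor x y y' n := fun h' =>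
      hd (hor_succ h hx (hy n n.lt_succ_self) (hy' n n.lt_succ_self) h')
    have h1 := vertical_step h (S.iterate_mem hx n) (hy n n.lt_succ_self) (hy' n n.lt_succ_self)
      (not_le.1 hn)
    have h2 := ih (fun k hk => hy k (hk.trans n.lt_succ_self))
      (fun k hk => hy' k (hk.trans n.lt_succ_self)) hn
    have h3 : ‖S.disp x y y' (n + 1)‖ ≤ 1 / 2 * ‖S.disp x y y' n‖ := by
      simpa only [disp, Function.iterate_succ_apply'] using h1
    rw [pow_succ]
    linarith

/-- The constant controlling the nonlinear distortion along horizontal orbits. -/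
def dst (S : ConeSystem E G A) : ℝ := 2 * (S.K ^ 2 * S.M / S.l0)

lemma dst_nonneg : 0 ≤ S.dst := by
  have := S.K_pos; have := S.M_pos; have := S.l0_pos
  unfold dst; positivity

/-- The one-step expansions multiply. With the orbit of `x` itself as second orbit, only the
distances from `y` to `x` enter the exponent, so the distortion is bounded whenever they are
summable. -/
lemma hor_of_shadow {ρ : ℝ} (h : S.Small ρ) {x y : U} (hx : x ∈ A) {n : ℕ}
    (hy : ∀ k < n, dist (G^[k] y) (G^[k] x) ≤ ρ) (hd : S.Hor x y x 0) :
    S.Hor x y x n ∧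
      (∏ k ∈ Finset.range n, ‖S.lam (G^[k] x)‖) *
          Real.exp (-(S.dst * ∑ k ∈ Finset.range n, dist (G^[k] y) (G^[k] x))) *
          ‖S.ℓ x (S.disp x y x 0)‖ ≤ ‖S.ℓ (G^[n] x) (S.disp x y x n)‖ := by
  induction n with
  | zero => exact ⟨hd, by simp⟩
  | succ n ih =>
    obtain ⟨h1, h2⟩ := ih (fun k hk => hy k (hk.trans n.lt_succ_self))
    have hself : dist (G^[n] x) (G^[n] x) ≤ ρ := by rw [dist_self]; exact h.pos.le
    obtain ⟨h3, h4⟩ := cone_step h (S.iterate_mem hx n) (hy n n.lt_succ_self) hself h1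
    refine ⟨by simpa only [Hor, disp, Function.iterate_succ_apply'] using h3, ?_⟩
    have h5 : ‖S.lam (G^[n] x)‖ * Real.exp (-(S.dst * dist (G^[n] y) (G^[n] x))) *
        ‖S.ℓ (G^[n] x) (S.disp x y x n)‖ ≤ ‖S.ℓ (G^[n + 1] x) (S.disp x y x (n + 1))‖ := by
      simpa only [disp, dst, Function.iterate_succ_apply', dist_self, add_zero] using h4
    refine le_trans ?_ h5
    rw [Finset.prod_range_succ, Finset.sum_range_succ, mul_add, neg_add, Real.exp_add]
    calc _ = ‖S.lam (G^[n] x)‖ * Real.exp (-(S.dst * dist (G^[n] y) (G^[n] x))) *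
          ((∏ k ∈ Finset.range n, ‖S.lam (G^[k] x)‖) *
          Real.exp (-(S.dst * ∑ k ∈ Finset.range n, dist (G^[k] y) (G^[k] x))) *
          ‖S.ℓ x (S.disp x y x 0)‖) := by ring
      _ ≤ _ := by gcongr

lemma norm_ℓ_disp_le {x y : U} (hx : x ∈ A) {n : ℕ} (hy : dist (G^[n] y) (G^[n] x) < S.r) :
    ‖S.ℓ (G^[n] x) (S.disp x y x n)‖ ≤ S.K ^ 2 * dist (G^[n] y) (G^[n] x) := by
  have hK := S.K_pos
  calc _ ≤ ‖S.ℓ (G^[n] x)‖ * ‖S.disp x y x n‖ := (S.ℓ _).le_opNorm _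
    _ ≤ S.K * (S.K * dist (G^[n] y) (G^[n] x)) := by
        gcongr
        · exact S.norm_ℓ_le _ (S.iterate_mem hx n)
        · exact (S.bilip _ (S.iterate_mem hx n) _ hy _ (Metric.mem_ball_self S.r_pos)).2
    _ = _ := by ring

lemma dist_le_of_hor {x y : U} (hx : x ∈ A) {n : ℕ} (hy : dist (G^[n] y) (G^[n] x) < S.r)
    (hd : S.Hor x y x n) :
    dist (G^[n] y) (G^[n] x) ≤ S.K * S.M * ‖S.ℓ (G^[n] x) (S.disp x y x n)‖ := by
  have hK := S.K_pos
  calc _ ≤ S.K * ‖S.disp x y x n‖ :=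
        (S.bilip _ (S.iterate_mem hx n) _ hy _ (Metric.mem_ball_self S.r_pos)).1
    _ ≤ S.K * (S.M * ‖S.ℓ (G^[n] x) (S.disp x y x n)‖) := by gcongr; exact hd
    _ = _ := by ring

/-- A lower bound on the distance between the orbits of `y` and `x`; it survives passage to
limits. -/
def SlowPair (S : ConeSystem E G A) (x y : U) (n : ℕ) : Prop :=
  ∀ δ c : ℝ, 0 < c → (∀ z ∈ A, ∀ n : ℕ, c * Real.exp (-(δ * n)) ≤
      ∏ k ∈ Finset.range n, ‖S.lam (G^[k] z)‖) →
    c * Real.exp (-(δ * n)) * Real.exp (-(S.dst * ∑ k ∈ Finset.range n, dist (G^[k] y) (G^[k] x))) *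
      dist y x ≤ S.K ^ 3 * S.M * dist (G^[n] y) (G^[n] x)

/-- For horizontal displacements the transverse component is comparable to the distance. The factor
`K ^ 3 * M` combines `K * M` at time zero with `K ^ 2` at time `n`. -/
lemma slowPair_of_hor {ρ : ℝ} (h : S.Small ρ) {x y : U} (hx : x ∈ A) {n : ℕ}
    (hy : ∀ k ≤ n, dist (G^[k] y) (G^[k] x) ≤ ρ) (hd : S.Hor x y x 0) : S.SlowPair x y n := by
  intro δ c hc hlow
  have hK := S.K_pos
  have hM := S.M_pos
  obtain ⟨-, h2⟩ := hor_of_shadow h hx (fun k hk => hy k hk.le) hd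
  have h3 := norm_ℓ_disp_le (S := S) hx ((hy n le_rfl).trans_lt h.lt)
  have h4 := dist_le_of_hor (S := S) (n := 0) hx ((hy 0 (Nat.zero_le n)).trans_lt h.lt) hd
  simp only [Function.iterate_zero, id_eq] at h4
  calc _ ≤ (∏ k ∈ Finset.range n, ‖S.lam (G^[k] x)‖) *
          Real.exp (-(S.dst * ∑ k ∈ Finset.range n, dist (G^[k] y) (G^[k] x))) *
          (S.K * S.M * ‖S.ℓ x (S.disp x y x 0)‖) := by
        gcongr
        exact hlow x hx n
    _ = S.K * S.M * ((∏ k ∈ Finset.range n, ‖S.lam (G^[k] x)‖) *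
          Real.exp (-(S.dst * ∑ k ∈ Finset.range n, dist (G^[k] y) (G^[k] x))) *
          ‖S.ℓ x (S.disp x y x 0)‖) := by ring
    _ ≤ S.K * S.M * (S.K ^ 2 * dist (G^[n] y) (G^[n] x)) :=
        mul_le_mul_of_nonneg_left (h2.trans h3) (by positivity)
    _ = _ := by ring

/-- A rate `q` would make the distances summable and hence the distortion bounded. With `δ = -log q
/ 2` the lower bound for the distance then decays only like `q ^ (n / 2)`, which eventually exceeds
`C * q ^ n`. -/
lemma not_expAsymptotic_of_slowPair
    (hlow : ∀ δ : ℝ, 0 < δ → ∃ c : ℝ, 0 < c ∧ ∀ z ∈ A, ∀ n : ℕ, c * Real.exp (-(δ * n)) ≤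
      ∏ k ∈ Finset.range n, ‖S.lam (G^[k] z)‖) {x y : U}
    (hxy : y ≠ x) (hs : ∀ n, S.SlowPair x y n) : ¬ ExpAsymptotic G y x := by
  rintro ⟨C, q, hC, hq0, hq1, hCq⟩
  have hK := S.K_pos
  have hM := S.M_pos
  obtain ⟨c, hc, hcl⟩ := hlow (-Real.log q / 2) (by linarith [Real.log_neg hq0 hq1])
  have hsum : ∀ n : ℕ, ∑ k ∈ Finset.range n, dist (G^[k] y) (G^[k] x) ≤ C * (1 - q)⁻¹ := by
    intro n
    calc _ ≤ ∑ k ∈ Finset.range n, C * q ^ k := Finset.sum_le_sum fun k _ => hCq k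
      _ = C * ∑ k ∈ Finset.range n, q ^ k := by rw [Finset.mul_sum]
      _ ≤ C * (1 - q)⁻¹ := by
        gcongr
        rw [← tsum_geometric_of_lt_one hq0.le hq1]
        exact (summable_geometric_of_lt_one hq0.le hq1).sum_le_tsum _ (fun i _ => by positivity)
  have hpos : 0 < c * Real.exp (-(S.dst * (C * (1 - q)⁻¹))) * dist y x := by
    have := dist_pos.2 hxy
    positivity
  have hbound : ∀ n : ℕ, c * Real.exp (-(S.dst * (C * (1 - q)⁻¹))) * dist y x ≤
      S.K ^ 3 * S.M * C * (Real.exp (Real.log q / 2)) ^ n := by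
    intro n
    have h1 := hs n _ c hc hcl
    have h2 : Real.exp (-(S.dst * (C * (1 - q)⁻¹))) ≤
        Real.exp (-(S.dst * ∑ k ∈ Finset.range n, dist (G^[k] y) (G^[k] x))) := by
      have := S.dst_nonneg
      have := hsum n
      gcongr
    have h3 : Real.exp (-(-Real.log q / 2 * n)) = Real.exp (Real.log q / 2) ^ n := by
      rw [← Real.exp_nat_mul]; congr 1; ring
    have h4 : q ^ n = Real.exp (Real.log q / 2) ^ n * Real.exp (Real.log q / 2) ^ n := by
      rw [← mul_pow, ← Real.exp_add, add_halves, Real.exp_log hq0]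
    rw [h3] at h1
    set w := Real.exp (Real.log q / 2) ^ n
    have hw : 0 < w := by positivity
    have h5 : c * w * Real.exp (-(S.dst * (C * (1 - q)⁻¹))) * dist y x ≤
        S.K ^ 3 * S.M * (C * (w * w)) := by
      refine le_trans (by gcongr) (h1.trans ?_)
      rw [← h4]
      gcongr
      exact hCq n
    have h6 : (c * Real.exp (-(S.dst * (C * (1 - q)⁻¹))) * dist y x) * w ≤
        (S.K ^ 3 * S.M * C * w) * w := by linarith
    exact le_of_mul_le_mul_right h6 hw
  have hlim : Tendsto (fun n : ℕ => S.K ^ 3 * S.M * C * (Real.exp (Real.log q / 2)) ^ n) atTop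
      (𝓝 (S.K ^ 3 * S.M * C * 0)) := by
    refine Tendsto.const_mul _ (tendsto_pow_atTop_nhds_zero_of_lt_one (Real.exp_pos _).le ?_)
    rw [Real.exp_lt_one_iff]
    linarith [Real.log_neg hq0 hq1]
  rw [mul_zero] at hlim
  exact absurd (ge_of_tendsto' hlim hbound) (not_le.2 hpos)

end ConeSystem

/-! ### Compactness of shadowing points and limits of slow pairs -/

lemma isComplete_inter_of_isClosed {X : Type*} [UniformSpace X] {s t : Set X} (hs : IsComplete s)
    (ht : IsClosed t) : IsComplete (s ∩ t) := by
  intro f hf hle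
  obtain ⟨x, hx, hfx⟩ := hs f hf (hle.trans (principal_mono.2 inter_subset_left))
  have := hf.1
  exact ⟨x, ⟨hx, isClosed_iff_clusterPt.1 ht x ((ClusterPt.of_le_nhds hfx).mono
    (hle.trans (principal_mono.2 inter_subset_right)))⟩, hfx⟩

namespace ConeSystem

variable {E : Type*} [NormedAddCommGroup E] [NormedSpace ℂ E] {U : Type*} [MetricSpace U]
  {G : U → U} {A : Set U} {S : ConeSystem E G A}

lemma continuousAt_iterate (S : ConeSystem E G A) {x y : U} (hx : x ∈ A) {n : ℕ}
    (hy : ∀ k < n, dist (G^[k] y) (G^[k] x) < S.r) : ContinuousAt G^[n] y := by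
  induction n with
  | zero => exact continuousAt_id
  | succ n ih =>
    rw [Function.iterate_succ']
    exact (S.cont _ (S.iterate_mem hx n) _ (hy n n.lt_succ_self)).comp
      (ih fun k hk => hy k (hk.trans n.lt_succ_self))

lemma continuousAt_iterate_of_mem (S : ConeSystem E G A) {x : U} (hx : x ∈ A) (n : ℕ) :
    ContinuousAt G^[n] x :=
  S.continuousAt_iterate hx fun k _ => by rw [dist_self]; exact S.r_pos

/-- Points whose past of length `i` shadows a given orbit segment lie, up to a small error, on a
horizontal disc; in particular they are covered by finitely many small balls. -/
lemma exists_net_of_history {ρ : ℝ} (h : S.Small ρ) {x : U} (hx : x ∈ A) (i : ℕ) {η : ℝ}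
    (hη : S.K * ((1 / 2) ^ i * (S.K * (2 * ρ))) < η) :
    ∃ t : Set U, t.Finite ∧ {p | ∃ w, (∀ k ≤ i, dist (G^[k] w) (G^[k] x) ≤ ρ) ∧ G^[i] w = p} ⊆
      ⋃ y ∈ t, Metric.ball y η := by
  have hK := S.K_pos
  have hM := S.M_pos
  have hη0 : 0 < η := lt_of_le_of_lt (by have := h.pos; positivity) hη
  set F := {p | ∃ w, (∀ k ≤ i, dist (G^[k] w) (G^[k] x) ≤ ρ) ∧ G^[i] w = p}
  set φ : U → ℂ := fun p => S.ℓ (G^[i] x) (S.ψ (G^[i] x) p - S.ψ (G^[i] x) (G^[i] x))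
  have hbdd : φ '' F ⊆ Metric.closedBall 0 (S.K ^ 2 * ρ) := by
    rintro _ ⟨_, ⟨w, hw, rfl⟩, rfl⟩
    rw [mem_closedBall_zero_iff]
    refine (norm_ℓ_disp_le (S := S) hx ((hw i le_rfl).trans_lt h.lt)).trans ?_
    gcongr
    exact hw i le_rfl
  have htb : TotallyBounded (φ '' F) :=
    (isCompact_closedBall (0 : ℂ) (S.K ^ 2 * ρ)).totallyBounded.subset hbdd
  obtain ⟨t', ht', hfin, hcov⟩ := Metric.finite_approx_of_totallyBounded htb
    (η / (S.K * S.M)) (by positivity)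
  obtain ⟨t, htF, htfin, hcov⟩ := exists_subset_image_finite_and
    (p := fun t' => φ '' F ⊆ ⋃ y ∈ t', Metric.ball y (η / (S.K * S.M))).1 ⟨t', ht', hfin, hcov⟩
  refine ⟨t, htfin, ?_⟩
  rintro p hp
  obtain ⟨_, hy', hyp⟩ := mem_iUnion₂.1 (hcov (mem_image_of_mem φ hp))
  obtain ⟨y, hyt, rfl⟩ := hy'
  refine mem_iUnion₂.2 ⟨y, hyt, ?_⟩
  obtain ⟨w, hw, rfl⟩ := hp
  obtain ⟨w', hw', rfl⟩ := htF hyt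
  have hdist : dist (G^[i] w) (G^[i] w') ≤ S.K * ‖S.disp x w w' i‖ :=
    (S.bilip _ (S.iterate_mem hx i) _ (h.mem_ball (hw i le_rfl)) _
      (h.mem_ball (hw' i le_rfl))).1
  rw [Metric.mem_ball]
  -- A horizontal displacement is controlled by its transverse component, hence by closeness in `ℂ`;
  -- any other displacement has been halved `i` times since two points at distance at most `2 * ρ`.
  by_cases hd : S.Hor x w w' i
  · refine hdist.trans_lt ?_
    have h1 : ‖S.ℓ (G^[i] x) (S.disp x w w' i)‖ < η / (S.K * S.M) := by
      rw [Metric.mem_ball, dist_eq_norm] at hyp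
      have : φ (G^[i] w) - φ (G^[i] w') = S.ℓ (G^[i] x) (S.disp x w w' i) := by
        simp only [φ, disp, map_sub]; ring
      rwa [this] at hyp
    calc S.K * ‖S.disp x w w' i‖ ≤ S.K * (S.M * ‖S.ℓ (G^[i] x) (S.disp x w w' i)‖) := by
          gcongr; exact hd
      _ < S.K * (S.M * (η / (S.K * S.M))) := by gcongr
      _ = η := by field_simp
  · refine lt_of_le_of_lt (hdist.trans ?_) hη
    gcongr
    refine (norm_disp_le_of_not_hor h hx (fun k hk => hw k hk.le) (fun k hk => hw' k hk.le)
      hd).trans ?_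
    gcongr
    have h0 := hw 0 (Nat.zero_le i)
    have h0' := hw' 0 (Nat.zero_le i)
    simp only [Function.iterate_zero, id_eq] at h0 h0'
    refine ((S.bilip x hx w (h.mem_ball h0) w' (h.mem_ball h0')).2).trans ?_
    gcongr
    linarith [dist_triangle_right w w' x]

/-- Finitely many segments of length `i` represent all reference orbits in `A`, so the nets of
`exists_net_of_history` need only finitely many centres. -/
lemma exists_bowen_cover (S : ConeSystem E G A) (hA : IsCompact A) (i : ℕ) {ρ : ℝ} (hρ : 0 < ρ) :
    ∃ t : Finset U, (∀ c ∈ t, c ∈ A) ∧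
      ∀ x ∈ A, ∃ c ∈ t, ∀ k ≤ i, dist (G^[k] x) (G^[k] c) < ρ := by
  obtain ⟨t, htA, ht⟩ := hA.elim_nhds_subcover
    (fun c => {x | ∀ k ∈ Finset.range (i + 1), dist (G^[k] x) (G^[k] c) < ρ}) (by
      intro c hc
      refine (Filter.eventually_all_finset _).2 fun k _ => ?_
      exact (S.continuousAt_iterate_of_mem hc k).eventually (Metric.ball_mem_nhds _ hρ))
  refine ⟨t, htA, fun x hx => ?_⟩
  obtain ⟨c, hc, hxc⟩ := mem_iUnion₂.1 (ht hx)
  exact ⟨c, hc, fun k hk => hxc k (Finset.mem_range.2 (Nat.lt_succ_of_le hk))⟩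

/-- The iterate `G^[k]` is known to be continuous only at points that have shadowed up to time `k`,
so closedness is obtained one time step after another. -/
lemma isCompact_shadowing (S : ConeSystem E G A) {ρ : ℝ} (h : ρ < S.r) {g : U} (hg : g ∈ A)
    {Q : Set U} (hQ : IsCompact Q) (k : ℕ) :
    IsCompact {w | w ∈ Q ∧ ∀ j ≤ k, dist (G^[j] w) (G^[j] g) ≤ ρ} := by
  have key : ∀ k : ℕ, IsCompact {w | w ∈ Q ∧ ∀ j < k, dist (G^[j] w) (G^[j] g) ≤ ρ} := by
    intro k
    induction k with
    | zero => simpa using hQ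
    | succ k ih =>
      have hc : ContinuousOn G^[k] {w | w ∈ Q ∧ ∀ j < k, dist (G^[j] w) (G^[j] g) ≤ ρ} :=
        fun w hw => (S.continuousAt_iterate hg
          fun j hj => (hw.2 j hj).trans_lt h).continuousWithinAt
      have := hc.preimage_isClosed_of_isClosed ih.isClosed
        (Metric.isClosed_closedBall (x := G^[k] g) (ε := ρ))
      refine ih.of_isClosed_subset ?_ (t := {w | w ∈ Q ∧ ∀ j < k + 1, dist (G^[j] w) (G^[j] g) ≤ ρ})
        fun w hw => ⟨hw.1, fun j hj => hw.2 j (hj.trans k.lt_succ_self)⟩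
      convert this using 1
      ext w
      simp only [mem_ofPred_eq, mem_inter_iff, mem_preimage, Metric.mem_closedBall,
        Nat.lt_succ_iff_lt_or_eq]
      constructor
      · rintro ⟨h1, h2⟩
        exact ⟨⟨h1, fun j hj => h2 j (Or.inl hj)⟩, h2 k (Or.inr rfl)⟩
      · rintro ⟨⟨h1, h2⟩, h3⟩
        exact ⟨h1, fun j hj => hj.elim (h2 j) (fun e => e ▸ h3)⟩
  simpa only [Nat.lt_succ_iff] using key (k + 1)

/-- The forward images of a compact set, as long as they shadow a given orbit, form a totally
bounded set. -/
lemma totallyBounded_images {ρ : ℝ} (h : S.Small (2 * ρ)) (hA : IsCompact A) {g : U} (hg : g ∈ A)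
    {Q : Set U} (hQ : IsCompact Q) :
    TotallyBounded {p | ∃ w ∈ Q, ∃ k, (∀ j ≤ k, dist (G^[j] w) (G^[j] g) ≤ ρ) ∧ G^[k] w = p} := by
  have hρ : 0 < ρ := by linarith [h.pos]
  rw [Metric.totallyBounded_iff]
  intro η hη
  have hlim : Tendsto (fun i : ℕ => S.K * ((1 / 2 : ℝ) ^ i * (S.K * (2 * (2 * ρ))))) atTop
      (𝓝 (S.K * (0 * (S.K * (2 * (2 * ρ)))))) :=
    ((tendsto_pow_atTop_nhds_zero_of_lt_one (by norm_num) (by norm_num)).mul_const _).const_mul _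
  rw [zero_mul, mul_zero] at hlim
  obtain ⟨i, hi⟩ := (hlim.eventually (gt_mem_nhds hη)).exists
  obtain ⟨t, htA, ht⟩ := S.exists_bowen_cover hA i hρ
  have h1 : ∀ k, ∃ s : Set U, s.Finite ∧
      G^[k] '' {w | w ∈ Q ∧ ∀ j ≤ k, dist (G^[j] w) (G^[j] g) ≤ ρ} ⊆ ⋃ y ∈ s, Metric.ball y η := by
    intro k
    have hc : ContinuousOn G^[k] {w | w ∈ Q ∧ ∀ j ≤ k, dist (G^[j] w) (G^[j] g) ≤ ρ} :=
      fun w hw => (S.continuousAt_iterate hg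
        fun j hj => (hw.2 j hj.le).trans_lt (by linarith [h.lt])).continuousWithinAt
    exact Metric.totallyBounded_iff.1
      ((S.isCompact_shadowing (by linarith [h.lt]) hg hQ k).image_of_continuousOn hc).totallyBounded
      η hη
  choose s1 hs1 hs1' using h1
  have h2 : ∀ c : U, ∃ s : Set U, s.Finite ∧ (c ∈ t →
      {p | ∃ w, (∀ k ≤ i, dist (G^[k] w) (G^[k] c) ≤ 2 * ρ) ∧ G^[i] w = p} ⊆
        ⋃ y ∈ s, Metric.ball y η) := by
    intro c
    by_cases hc : c ∈ t
    · obtain ⟨s, hs, hs'⟩ := exists_net_of_history h (htA c hc) i hi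
      exact ⟨s, hs, fun _ => hs'⟩
    · exact ⟨∅, finite_empty, fun h => absurd h hc⟩
  choose s2 hs2 hs2' using h2
  refine ⟨(⋃ k ∈ Finset.range i, s1 k) ∪ ⋃ c ∈ t, s2 c,
    ((Finset.finite_toSet _).biUnion fun k _ => hs1 k).union
      (t.finite_toSet.biUnion fun c _ => hs2 c), ?_⟩
  rintro p ⟨w, hwQ, k, hk, rfl⟩
  -- The times before `i` give finitely many compact images. At later times only the last `i` steps
  -- are used, with the reference segment replaced by a Bowen centre; this doubles the tube radius,
  -- whence `S.Small (2 * ρ)`.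
  rcases lt_or_ge k i with hki | hki
  · obtain ⟨y, hy, hp⟩ := mem_iUnion₂.1 (hs1' k (mem_image_of_mem _ ⟨hwQ, hk⟩))
    exact mem_iUnion₂.2 ⟨y, Or.inl (mem_iUnion₂.2 ⟨k, Finset.mem_range.2 hki, hy⟩), hp⟩
  · obtain ⟨c, hct, hc⟩ := ht (G^[k - i] g) (S.iterate_mem hg _)
    have hmem : G^[k] w ∈ {p | ∃ w, (∀ k ≤ i, dist (G^[k] w) (G^[k] c) ≤ 2 * ρ) ∧ G^[i] w = p} := by
      refine ⟨G^[k - i] w, fun j hj => ?_, ?_⟩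
      · have e1 := hk (j + (k - i)) (by omega)
        have e2 := hc j hj
        rw [Function.iterate_add_apply, Function.iterate_add_apply] at e1
        linarith [dist_triangle (G^[j] (G^[k - i] w)) (G^[j] (G^[k - i] g)) (G^[j] c)]
      · rw [← Function.iterate_add_apply, Nat.add_sub_cancel' hki]
    obtain ⟨y, hy, hp⟩ := mem_iUnion₂.1 (hs2' c hct hmem)
    exact mem_iUnion₂.2 ⟨y, Or.inr (mem_iUnion₂.2 ⟨c, hct, hy⟩), hp⟩

/-- Horizontality cannot be passed to the limit directly, since `ψ x` and `ℓ x` need not vary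
continuously with `x`. `SlowPair` involves only distances between iterates, which do converge. -/
lemma slowPair_of_tendsto {ρ : ℝ} (hρ : ρ < S.r) {x f : ℕ → U} {x₀ f₀ : U} {n : ℕ}
    (hx₀ : x₀ ∈ A) (hx : Tendsto x atTop (𝓝 x₀))
    (hf : Tendsto f atTop (𝓝 f₀)) (hsh : ∀ k ≤ n, dist (G^[k] f₀) (G^[k] x₀) ≤ ρ)
    (hs : ∀ᶠ m in atTop, S.SlowPair (x m) (f m) n) : S.SlowPair x₀ f₀ n := by
  intro δ c hc hlow
  have hd : ∀ k ≤ n, Tendsto (fun m => dist (G^[k] (f m)) (G^[k] (x m))) atTop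
      (𝓝 (dist (G^[k] f₀) (G^[k] x₀))) := fun k hk =>
    ((S.continuousAt_iterate hx₀ fun j hj =>
      (hsh j (hj.le.trans hk)).trans_lt hρ).tendsto.comp hf).dist
      ((S.continuousAt_iterate_of_mem hx₀ k).tendsto.comp hx)
  have hsum : Tendsto (fun m => ∑ k ∈ Finset.range n, dist (G^[k] (f m)) (G^[k] (x m))) atTop
      (𝓝 (∑ k ∈ Finset.range n, dist (G^[k] f₀) (G^[k] x₀))) :=
    tendsto_finsetSum _ fun k hk => hd k (Finset.mem_range.1 hk).le
  refine le_of_tendsto_of_tendsto ?_ ((hd n le_rfl).const_mul (S.K ^ 3 * S.M))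
    (hs.mono fun m hm => hm δ c hc hlow)
  exact (((Real.continuous_exp.tendsto _).comp (hsum.const_mul S.dst).neg).const_mul _).mul
    (hd 0 (Nat.zero_le n))

/-- Extraction of an infinite slowly shadowing pair out of longer and longer finite ones. -/
lemma exists_limit_slowPair {ρ ρc r₁ : ℝ} (h : S.Small (2 * ρ)) (hA : IsCompact A)
    (hcompl : ∀ x ∈ A, IsComplete (Metric.closedBall x ρc)) (hρc : 2 * ρ ≤ ρc)
    {P : Set U} (hP : TotallyBounded P) {x f : ℕ → U} (hx : ∀ m, x m ∈ A) (hf : ∀ m, f m ∈ P)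
    (hsh : ∀ m, ∀ k ≤ m, dist (G^[k] (f m)) (G^[k] (x m)) ≤ ρ)
    (hr₁ : ∀ m, r₁ ≤ dist (f m) (x m)) (hs : ∀ m, ∀ n ≤ m, S.SlowPair (x m) (f m) n) :
    ∃ x₀ ∈ A, ∃ f₀, (∀ k, dist (G^[k] f₀) (G^[k] x₀) ≤ ρ) ∧ r₁ ≤ dist f₀ x₀ ∧
      ∀ n, S.SlowPair x₀ f₀ n := by
  have hρ : 0 < ρ := by linarith [h.pos]
  have hρr : ρ < S.r := by linarith [h.lt]
  obtain ⟨x₀, hx₀, φ, hφ, hφx⟩ := hA.tendsto_subseq hx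
  -- The space `U` is not assumed complete; completeness of balls around `A` upgrades total
  -- boundedness to compactness.
  have hcomp : IsCompact (closure P ∩ Metric.closedBall x₀ (2 * ρ)) := by
    rw [isCompact_iff_totallyBounded_isComplete]
    refine ⟨hP.closure.subset inter_subset_left, ?_⟩
    have h1 : closure P ∩ Metric.closedBall x₀ (2 * ρ) =
        Metric.closedBall x₀ ρc ∩ (closure P ∩ Metric.closedBall x₀ (2 * ρ)) := by
      rw [eq_comm, inter_eq_right]
      exact fun y hy => Metric.closedBall_subset_closedBall hρc hy.2
    rw [h1]
    exact isComplete_inter_of_isClosed (hcompl x₀ hx₀) (isClosed_closure.inter Metric.isClosed_closedBall)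
  have hev : ∀ᶠ m in atTop, f (φ m) ∈ closure P ∩ Metric.closedBall x₀ (2 * ρ) := by
    filter_upwards [hφx (Metric.ball_mem_nhds x₀ hρ)] with m hm
    refine ⟨subset_closure (hf _), ?_⟩
    have h1 := hsh (φ m) 0 (Nat.zero_le _)
    simp only [Function.iterate_zero, id_eq] at h1
    have h2 : dist (x (φ m)) x₀ < ρ := hm
    rw [Metric.mem_closedBall]
    linarith [dist_triangle (f (φ m)) (x (φ m)) x₀]
  obtain ⟨f₀, -, χ, hχ, hχf⟩ := hcomp.tendsto_subseq' hev.frequently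
  have hx' : Tendsto (fun m => x (φ (χ m))) atTop (𝓝 x₀) := hφx.comp hχ.tendsto_atTop
  have hf' : Tendsto (fun m => f (φ (χ m))) atTop (𝓝 f₀) := hχf
  have hge : ∀ m, m ≤ φ (χ m) := fun m => (hφ.comp hχ).id_le m
  have hsh₀ : ∀ k, dist (G^[k] f₀) (G^[k] x₀) ≤ ρ := by
    intro k
    -- Continuity of `G^[k]` at `f₀` is available only once `f₀` is known to shadow `x₀` at all
    -- times before `k`.
    induction k using Nat.strong_induction_on with
    | _ k ih =>
      have h1 : Tendsto (fun m => dist (G^[k] (f (φ (χ m)))) (G^[k] (x (φ (χ m))))) atTop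
          (𝓝 (dist (G^[k] f₀) (G^[k] x₀))) :=
        ((S.continuousAt_iterate hx₀ fun j hj => (ih j hj).trans_lt hρr).tendsto.comp hf').dist
          ((S.continuousAt_iterate_of_mem hx₀ k).tendsto.comp hx')
      refine le_of_tendsto h1 ?_
      filter_upwards [eventually_ge_atTop k] with m hm
      exact hsh _ k (hm.trans (hge m))
  refine ⟨x₀, hx₀, f₀, hsh₀, ge_of_tendsto' (hf'.dist hx') fun m => hr₁ _, fun n => ?_⟩
  refine slowPair_of_tendsto hρr hx₀ hx' hf' (fun k _ => hsh₀ k) ?_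
  filter_upwards [eventually_ge_atTop n] with m hm
  exact hs _ n (hm.trans (hge m))

end ConeSystem

/-! ### Holomorphic discs and the construction of slowly shadowing orbits -/

/-- A Schwarz lemma: if a holomorphic function whose only zero is at the origin is comparable to
`z` on the frontier, then its derivative at the origin is not too small. -/
lemma one_le_mul_norm_deriv_of_frontier {O : Set ℂ} (hO : IsOpen O) (hb : Bornology.IsBounded O)
    (h0 : (0 : ℂ) ∈ O) {h : ℂ → ℂ} (hd : ∀ z ∈ closure O, DifferentiableAt ℂ h z) (hh0 : h 0 = 0)
    (hne : ∀ z ∈ closure O, z ≠ 0 → h z ≠ 0) (hd0 : deriv h 0 ≠ 0) {s : ℝ}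
    (hs : ∀ z ∈ frontier O, ‖z‖ ≤ s * ‖h z‖) : 1 ≤ s * ‖deriv h 0‖ := by
  -- The maximum principle is applied to `z / h z`, the inverse of this slope, whose value at the
  -- origin is the inverse of the derivative.
  have hdiff : DifferentiableOn ℂ (dslope h 0) O :=
    (Complex.differentiableOn_dslope (hO.mem_nhds h0)).2 fun z hz =>
      (hd z (subset_closure hz)).differentiableWithinAt
  have hk : ∀ z, z ≠ 0 → dslope h 0 z = h z / z := fun z hz => by
    rw [dslope_of_ne _ hz, slope_def_field, hh0, sub_zero, sub_zero]
  have hcl : DiffContOnCl ℂ (dslope h 0) O := by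
    refine ⟨hdiff, fun z hz => ?_⟩
    by_cases hz0 : z = 0
    · subst hz0
      exact (hdiff.differentiableAt (hO.mem_nhds h0)).continuousAt.continuousWithinAt
    · exact ((continuousAt_dslope_of_ne hz0).2 (hd z hz).continuousAt).continuousWithinAt
  have hk0 : ∀ z ∈ closure O, dslope h 0 z ≠ 0 := by
    intro z hz
    by_cases hz0 : z = 0
    · rwa [hz0, dslope_same]
    · rw [hk z hz0]; exact div_ne_zero (hne z hz hz0) hz0
  have hfr : ∀ z ∈ frontier O, ‖(dslope h 0)⁻¹ z‖ ≤ s := by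
    intro z hz
    have hz0 : z ≠ 0 := by
      rintro rfl
      rw [hO.frontier_eq] at hz
      exact hz.2 h0
    have hzc : z ∈ closure O := frontier_subset_closure hz
    rw [Pi.inv_apply, hk z hz0, inv_div, norm_div, div_le_iff₀ (norm_pos_iff.2 (hne z hzc hz0))]
    exact hs z hz
  have := Complex.norm_le_of_forall_mem_frontier_norm_le hb (hcl.inv hk0) hfr (subset_closure h0)
  rw [Pi.inv_apply, dslope_same, norm_inv] at this
  exact (inv_le_iff_one_le_mul₀ (norm_pos_iff.2 hd0)).1 this

namespace ConeSystem

variable {E : Type*} [NormedAddCommGroup E] [NormedSpace ℂ E] {U : Type*} [MetricSpace U]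
  {G : U → U} {A : Set U} {S : ConeSystem E G A}

/-- A flat holomorphic disc through a point `g`, transverse to the kernel of `ℓ g`. -/
structure FlatDisc (S : ConeSystem E G A) (g : U) where
  e : E
  σ : ℂ → U
  R : ℝ
  R_pos : 0 < R
  norm_e : ‖e‖ ≤ S.K
  ℓ_e : S.ℓ g e = 1
  σ_zero : σ 0 = g
  mem : ∀ z ∈ Metric.ball (0 : ℂ) R, σ z ∈ Metric.ball g S.r
  coord : ∀ z ∈ Metric.ball (0 : ℂ) R, S.ψ g (σ z) = S.ψ g g + z • e
  cont : ContinuousOn σ (Metric.ball 0 R)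
  holo : ∀ n, ∀ z ∈ Metric.ball (0 : ℂ) R,
    (∀ k ≤ n, dist (G^[k] (σ z)) (G^[k] g) < S.r) →
      DifferentiableAt ℂ (fun w => S.ψ (G^[n] g) (G^[n] (σ w))) z

variable {g : U} (D : S.FlatDisc g)

namespace FlatDisc

lemma disp_zero {z : ℂ} (hz : z ∈ Metric.ball (0 : ℂ) D.R) : S.disp g (D.σ z) g 0 = z • D.e := by
  simp [disp, D.coord z hz]

lemma hor {z : ℂ} (hz : z ∈ Metric.ball (0 : ℂ) D.R) : S.Hor g (D.σ z) g 0 := by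
  rw [Hor, D.disp_zero hz, Function.iterate_zero, id, map_smul, norm_smul, norm_smul, D.ℓ_e,
    norm_one, mul_one, mul_comm]
  gcongr
  exact D.norm_e.trans S.K_le_M

lemma norm_le_dist (hg : g ∈ A) {z : ℂ} (hz : z ∈ Metric.ball (0 : ℂ) D.R) :
    ‖z‖ ≤ S.K ^ 2 * dist (D.σ z) g := by
  have h := norm_ℓ_disp_le (S := S) (n := 0) (y := D.σ z) hg (D.mem z hz)
  rw [D.disp_zero hz, Function.iterate_zero, id, map_smul, norm_smul, D.ℓ_e, norm_one,
    mul_one] at h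
  exact h

lemma continuousAt {n : ℕ} (hg : g ∈ A) {z : ℂ} (hz : z ∈ Metric.ball (0 : ℂ) D.R)
    (h : ∀ k < n, dist (G^[k] (D.σ z)) (G^[k] g) < S.r) :
    ContinuousAt (fun w => G^[n] (D.σ w)) z :=
  (S.continuousAt_iterate hg h).comp (f := D.σ)
    (D.cont.continuousAt (Metric.isOpen_ball.mem_nhds hz))

/-- The field `strict`, with the reference orbit as second point, says that `T` is the derivative of
`G` in coordinates; the chain rule and `equivar` then turn the transverse derivative into the
cocycle product. -/
lemma hasDerivAt (hg : g ∈ A) (n : ℕ) : ∃ v : E,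
    HasDerivAt (fun w => S.ψ (G^[n] g) (G^[n] (D.σ w))) v 0 ∧
      S.ℓ (G^[n] g) v = ∏ k ∈ Finset.range n, S.lam (G^[k] g) := by
  have h0 : (0 : ℂ) ∈ Metric.ball (0 : ℂ) D.R := Metric.mem_ball_self D.R_pos
  induction n with
  | zero =>
    refine ⟨D.e, ?_, by simpa using D.ℓ_e⟩
    have h1 : HasDerivAt (fun w : ℂ => S.ψ g g + w • D.e) D.e 0 := by
      simpa using ((hasDerivAt_id (0 : ℂ)).smul_const D.e).const_add (S.ψ g g)
    refine h1.congr_of_eventuallyEq ?_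
    filter_upwards [Metric.isOpen_ball.mem_nhds h0] with w hw
    exact D.coord w hw
  | succ n ih =>
    obtain ⟨v, hv, hℓ⟩ := ih
    have hgn := S.iterate_mem hg n
    refine ⟨S.T (G^[n] g) v, ?_, ?_⟩
    swap
    · rw [Function.iterate_succ_apply', S.equivar _ hgn, hℓ, Finset.prod_range_succ, mul_comm]
    have hcont : ContinuousAt (fun w => G^[n] (D.σ w)) 0 :=
      D.continuousAt hg h0 fun k _ => by rw [D.σ_zero, dist_self]; exact S.r_pos
    have hdist : Tendsto (fun w => dist (G^[n] (D.σ w)) (G^[n] g)) (𝓝 0) (𝓝 0) := by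
      have := hcont.tendsto.dist (tendsto_const_nhds (x := G^[n] g))
      simpa [D.σ_zero] using this
    have hO := hv.isBigO_sub
    have hlin : HasDerivAt (fun w => S.T (G^[n] g) (S.ψ (G^[n] g) (G^[n] (D.σ w))))
        (S.T (G^[n] g) v) 0 := (S.T (G^[n] g)).hasFDerivAt.comp_hasDerivAt 0 hv
    rw [hasDerivAt_iff_isLittleO] at hlin ⊢
    have herr : (fun w => S.ψ (G^[n + 1] g) (G^[n + 1] (D.σ w)) -
        S.ψ (G^[n + 1] g) (G^[n + 1] (D.σ 0)) - S.T (G^[n] g) (S.ψ (G^[n] g) (G^[n] (D.σ w)) -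
          S.ψ (G^[n] g) (G^[n] (D.σ 0)))) =o[𝓝 0] (fun w : ℂ => w - 0) := by
      have h1 : (fun w => S.K * dist (G^[n] (D.σ w)) (G^[n] g) *
          ‖S.ψ (G^[n] g) (G^[n] (D.σ w)) - S.ψ (G^[n] g) (G^[n] (D.σ 0))‖) =o[𝓝 0]
          (fun w : ℂ => (1 : ℝ) * ‖w - 0‖) := by
        refine Asymptotics.IsLittleO.mul_isBigO ?_ hO.norm_norm
        rw [Asymptotics.isLittleO_one_iff]
        simpa using hdist.const_mul S.K
      simp only [one_mul] at h1
      refine (Asymptotics.IsBigO.of_bound 1 ?_).trans_isLittleO h1.of_norm_right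
      filter_upwards [hdist.eventually (gt_mem_nhds S.r_pos)] with w hw
      have := S.strict _ hgn _ (Metric.mem_ball.2 hw) _ (Metric.mem_ball_self S.r_pos)
      rw [dist_self, add_zero] at this
      simp only [Function.iterate_succ_apply', D.σ_zero, norm_mul, one_mul,
        Real.norm_eq_abs, abs_of_pos S.K_pos, abs_dist, abs_norm]
      exact this
    refine (herr.add hlin).congr_left fun w => ?_
    simp only [map_sub]
    abel

end FlatDisc

/-- A dominated cone system which is slowly contracting at worst, and does not expand along the
orbit of `g`, has slowly shadowing orbits. -/
theorem exists_slow_shadow (hA : IsCompact A) {ρc : ℝ} (hρc : 0 < ρc)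
    (hcompl : ∀ x ∈ A, IsComplete (Metric.closedBall x ρc))
    (hlow : ∀ δ : ℝ, 0 < δ → ∃ c : ℝ, 0 < c ∧ ∀ z ∈ A, ∀ n : ℕ, c * Real.exp (-(δ * n)) ≤
      ∏ k ∈ Finset.range n, ‖S.lam (G^[k] z)‖) (hg : g ∈ A) {M₀ : ℝ}
    (hM₀ : ∀ n, ∏ k ∈ Finset.range n, ‖S.lam (G^[k] g)‖ ≤ M₀) (D : S.FlatDisc g) {ε : ℝ}
    (hε : 0 < ε) :
    ∃ x ∈ A, ∃ f, (∀ k, dist (G^[k] f) (G^[k] x) ≤ ε) ∧ ¬ ExpAsymptotic G f x := by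
  obtain ⟨ρ', hρ', hle⟩ := S.exists_small (lt_min hε hρc)
  obtain ⟨ρ, rfl⟩ : ∃ ρ, ρ' = 2 * ρ := ⟨ρ' / 2, by ring⟩
  have hρ0 : 0 < ρ := by linarith [hρ'.pos]
  have hρ : S.Small ρ := hρ'.mono hρ0 (by linarith)
  have hρε : ρ ≤ ε := by linarith [hle.trans (min_le_left _ _)]
  have hρc' : 2 * ρ ≤ ρc := hle.trans (min_le_right _ _)
  by_contra hno
  have hno' : ∀ x ∈ A, ∀ f, f ≠ x → (∀ k, dist (G^[k] f) (G^[k] x) ≤ ρ) →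
      ¬ ∀ n, S.SlowPair x f n := fun x hx f hfx hsh hs =>
    hno ⟨x, hx, f, fun k => (hsh k).trans hρε, not_expAsymptotic_of_slowPair hlow hfx hs⟩
  have hK := S.K_pos
  have hM := S.M_pos
  have hl := S.l0_pos
  set R := D.R / 2 with hRdef
  have hR : 0 < R := half_pos D.R_pos
  have hRlt : R < D.R := half_lt_self D.R_pos
  have hball : ∀ {z : ℂ}, ‖z‖ ≤ R → z ∈ Metric.ball (0 : ℂ) D.R := fun {z} hz => by
    rw [mem_ball_zero_iff]; exact hz.trans_lt hRlt
  -- A frontier parameter has either left the open tube, at distance `ρ`, or reached modulus `R`,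
  -- which puts the initial point at distance at least `R / K ^ 2`.
  set r₁ := min ρ (R / S.K ^ 2) with hr₁def
  have hr₁ : 0 < r₁ := lt_min hρ0 (by positivity)
  set O : ℕ → Set ℂ := fun n => {z | ‖z‖ < R ∧ ∀ k ∈ Finset.range (n + 1),
    dist (G^[k] (D.σ z)) (G^[k] g) < ρ} with hOdef
  have hcont : ∀ {z : ℂ} {n : ℕ}, ‖z‖ ≤ R → (∀ k < n, dist (G^[k] (D.σ z)) (G^[k] g) ≤ ρ) →
      ContinuousAt (fun w => G^[n] (D.σ w)) z := fun hz h =>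
    D.continuousAt hg (hball hz) fun k hk => (h k hk).trans_lt hρ.lt
  have hOopen : ∀ n, IsOpen (O n) := by
    intro n
    rw [isOpen_iff_mem_nhds]
    rintro z ⟨hz, hzk⟩
    refine Filter.inter_mem (continuous_norm.continuousAt.eventually (gt_mem_nhds hz)) ?_
    refine (Filter.eventually_all_finset _).2 fun k hk => ?_
    refine ((hcont hz.le fun j hj => (hzk j ?_).le).dist continuousAt_const).eventually
      (gt_mem_nhds (hzk k hk))
    simp only [Finset.mem_range] at hk ⊢
    omega
  have hOcl : ∀ n, ∀ z ∈ closure (O n), ‖z‖ ≤ R ∧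
      ∀ k ≤ n, dist (G^[k] (D.σ z)) (G^[k] g) ≤ ρ := by
    intro n z hz
    have hzR : ‖z‖ ≤ R :=
      closure_minimal (fun w hw => hw.1.le) (isClosed_le continuous_norm continuous_const) hz
    refine ⟨hzR, fun k => ?_⟩
    induction k using Nat.strong_induction_on with
    | _ k ih =>
      intro hk
      have hc : ContinuousAt (fun w => dist (G^[k] (D.σ w)) (G^[k] g)) z :=
        (hcont hzR fun j hj => ih j hj (hj.le.trans hk)).dist continuousAt_const
      have := mem_closure_iff_nhdsWithin_neBot.1 hz
      refine le_of_tendsto (hc.tendsto.mono_left (nhdsWithin_le_nhds (s := O n))) ?_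
      filter_upwards [self_mem_nhdsWithin] with w hw
      exact (hw.2 k (Finset.mem_range.2 (Nat.lt_succ_of_le hk))).le
  have hOfr : ∀ n, ∀ z ∈ frontier (O n), ∃ k ≤ n, r₁ ≤ dist (G^[k] (D.σ z)) (G^[k] g) := by
    intro n z hz
    rw [(hOopen n).frontier_eq] at hz
    obtain ⟨h1, h2⟩ := hOcl n z hz.1
    by_contra hcon
    push Not at hcon
    refine hz.2 ⟨lt_of_le_of_ne h1 fun hzR => ?_, fun k hk =>
      (hcon k (Nat.lt_succ_iff.1 (Finset.mem_range.1 hk))).trans_le (min_le_left _ _)⟩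
    have h3 := hcon 0 (Nat.zero_le _)
    have h4 := D.norm_le_dist hg (hball h1)
    have h5 : dist (D.σ z) g < R / S.K ^ 2 := h3.trans_le (min_le_right _ _)
    rw [lt_div_iff₀ (by positivity)] at h5
    linarith
  have hhor : ∀ {z : ℂ} {n : ℕ}, ‖z‖ ≤ R → (∀ k < n, dist (G^[k] (D.σ z)) (G^[k] g) ≤ ρ) →
      S.Hor g (D.σ z) g n := fun hz h => (hor_of_shadow hρ hg h (D.hor (hball hz))).1
  -- escape from the tube happens in uniformly bounded time
  have hesc : ∃ m, ∀ n, ∀ z ∈ closure (O n), ∀ k ≤ n,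
      r₁ ≤ dist (G^[k] (D.σ z)) (G^[k] g) → n - k ≤ m := by
    by_contra hcon
    push Not at hcon
    choose n z hz k hkn hrk hmk using hcon
    have hsh : ∀ m, ∀ j ≤ m, dist (G^[j] (G^[k m] (D.σ (z m)))) (G^[j] (G^[k m] g)) ≤ ρ := by
      intro m j hj
      rw [← Function.iterate_add_apply, ← Function.iterate_add_apply]
      exact (hOcl _ _ (hz m)).2 _ (by have := hmk m; omega)
    have hQ : IsCompact (D.σ '' Metric.closedBall 0 R) :=
      (isCompact_closedBall 0 R).image_of_continuousOn
        (D.cont.mono (Metric.closedBall_subset_ball hRlt))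
    -- The clock is restarted at time `k m`, when the distance is at least `r₁`; the pair then
    -- shadows for `m` more steps, and a limit of such pairs shadows forever.
    obtain ⟨x₀, hx₀, f₀, h1, h2, h3⟩ := exists_limit_slowPair hρ' hA hcompl hρc'
      (totallyBounded_images hρ' hA hg hQ) (x := fun m => G^[k m] g)
      (f := fun m => G^[k m] (D.σ (z m))) (fun m => S.iterate_mem hg _)
      (fun m => ⟨D.σ (z m), mem_image_of_mem _ (mem_closedBall_zero_iff.2 (hOcl _ _ (hz m)).1),
        k m, fun j hj => (hOcl _ _ (hz m)).2 j (hj.trans (hkn m)), rfl⟩) hsh hrk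
      (fun m j hj => slowPair_of_hor hρ (S.iterate_mem hg _) (fun i hi => hsh m i (hi.trans hj))
        (hor_shift.2 (by
          rw [zero_add]
          exact hhor (hOcl _ _ (hz m)).1 fun i hi =>
            (hOcl _ _ (hz m)).2 i (hi.le.trans (hkn m)))))
    exact hno' x₀ hx₀ f₀ (dist_pos.1 (hr₁.trans_le h2)) h1 h3
  obtain ⟨m, hm⟩ := hesc
  -- At some time the transverse component is at least `r₁ / (K * M)`. At most `m` steps remain,
  -- each multiplying it by at least `l0` up to a distortion with total exponent at most `dst * m *
  -- ρ`.
  set c₂ := S.l0 ^ m * Real.exp (-(S.dst * (m * ρ))) * (r₁ / (S.K * S.M)) with hc₂def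
  have hc₂ : 0 < c₂ := by positivity
  set h : ℕ → ℂ → ℂ := fun n z => S.ℓ (G^[n] g) (S.disp g (D.σ z) g n) with hhdef
  have hfrh : ∀ n, ∀ z ∈ frontier (O n), c₂ ≤ ‖h n z‖ := by
    intro n z hz
    obtain ⟨hzR, hzs⟩ := hOcl n z (frontier_subset_closure hz)
    obtain ⟨k, hkn, hk⟩ := hOfr n z hz
    have hnk := hm n z (frontier_subset_closure hz) k hkn hk
    have hhk := hhor (n := k) hzR fun j hj => hzs j (hj.le.trans hkn)
    have h1 := (hor_of_shadow (n := n - k) hρ (S.iterate_mem hg k) (y := G^[k] (D.σ z))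
      (fun j hj => by
        rw [← Function.iterate_add_apply, ← Function.iterate_add_apply]
        exact hzs _ (by omega)) (hor_shift.2 (by rwa [zero_add]))).2
    have e1 : G^[n - k] (G^[k] g) = G^[n] g := by
      rw [← Function.iterate_add_apply, Nat.sub_add_cancel hkn]
    rw [disp_shift, disp_shift, e1, Nat.sub_add_cancel hkn, zero_add] at h1
    refine le_trans ?_ h1
    have h2 : r₁ / (S.K * S.M) ≤ ‖S.ℓ (G^[k] g) (S.disp g (D.σ z) g k)‖ := by
      rw [div_le_iff₀ (by positivity), mul_comm]
      exact hk.trans (dist_le_of_hor hg ((hzs k hkn).trans_lt hρ.lt) hhk)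
    have h3 : S.l0 ^ m ≤ ∏ j ∈ Finset.range (n - k), ‖S.lam (G^[j] (G^[k] g))‖ := by
      calc S.l0 ^ m ≤ S.l0 ^ (n - k) := pow_le_pow_of_le_one hl.le S.l0_le_one hnk
        _ = ∏ j ∈ Finset.range (n - k), S.l0 := by simp
        _ ≤ _ := Finset.prod_le_prod (fun _ _ => hl.le) fun j _ =>
            S.l0_le _ (S.iterate_mem (S.iterate_mem hg k) j)
    have h4 : ∑ j ∈ Finset.range (n - k), dist (G^[j] (G^[k] (D.σ z))) (G^[j] (G^[k] g)) ≤
        m * ρ := by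
      calc _ ≤ ∑ j ∈ Finset.range (n - k), ρ := Finset.sum_le_sum fun j hj => by
            rw [← Function.iterate_add_apply, ← Function.iterate_add_apply]
            exact hzs _ (by have := Finset.mem_range.1 hj; omega)
        _ = (n - k : ℕ) * ρ := by simp
        _ ≤ m * ρ := by gcongr
    have := S.dst_nonneg
    rw [hc₂def]
    gcongr
  have hM₀1 : 1 ≤ M₀ := by simpa using hM₀ 0
  -- If the closed region lay in the disc of radius `s`, the Schwarz lemma would give `1 ≤ (s / c₂)
  -- * M₀ = 1 / 2`.
  set s := c₂ / (2 * M₀) with hsdef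
  have hs : 0 < s := by positivity
  have hbig : ∀ n, ∃ z ∈ closure (O n), s ≤ ‖z‖ := by
    intro n
    by_contra hcon
    push Not at hcon
    have h0mem : (0 : ℂ) ∈ O n := ⟨by simpa using hR, fun k _ => by
      rw [D.σ_zero, dist_self]; exact hρ0⟩
    obtain ⟨v, hv, hℓv⟩ := D.hasDerivAt hg n
    have hder : HasDerivAt (h n) (∏ k ∈ Finset.range n, S.lam (G^[k] g)) 0 := by
      rw [← hℓv]
      exact (S.ℓ (G^[n] g)).hasFDerivAt.comp_hasDerivAt 0 (hv.sub_const (S.ψ (G^[n] g) (G^[n] g)))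
    have hnorm : ‖deriv (h n) 0‖ ≤ M₀ := by
      rw [hder.deriv, norm_prod]; exact hM₀ n
    have hbdd : Bornology.IsBounded (O n) :=
      (Metric.isBounded_ball (x := (0 : ℂ)) (r := R)).subset fun z hz =>
        mem_ball_zero_iff.2 hz.1
    suffices hsuff : 1 ≤ s / c₂ * ‖deriv (h n) 0‖ by
      have h6 : s / c₂ * ‖deriv (h n) 0‖ ≤ s / c₂ * M₀ := by gcongr
      have h7 : s / c₂ * M₀ = 1 / 2 := by rw [hsdef]; field_simp
      linarith
    refine one_le_mul_norm_deriv_of_frontier (hOopen n) hbdd h0mem ?_ ?_ ?_ ?_ ?_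
    · intro z hz
      obtain ⟨hzR, hzs⟩ := hOcl n z hz
      exact (S.ℓ (G^[n] g)).differentiableAt.comp z ((D.holo n z (hball hzR)
        fun k hk => (hzs k hk).trans_lt hρ.lt).sub_const (S.ψ (G^[n] g) (G^[n] g)))
    · simp [hhdef, disp, D.σ_zero]
    · intro z hz hz0
      obtain ⟨hzR, hzs⟩ := hOcl n z hz
      have h1 := (hor_of_shadow (n := n) hρ hg (fun j hj => hzs j hj.le) (D.hor (hball hzR))).2
      rw [D.disp_zero (hball hzR), map_smul, D.ℓ_e, smul_eq_mul, mul_one] at h1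
      refine norm_pos_iff.1 (lt_of_lt_of_le ?_ h1)
      have h2 : 0 < ∏ k ∈ Finset.range n, ‖S.lam (G^[k] g)‖ :=
        Finset.prod_pos fun k _ => hl.trans_le (S.l0_le _ (S.iterate_mem hg k))
      have h3 : 0 < ‖z‖ := norm_pos_iff.2 hz0
      positivity
    · rw [hder.deriv]
      exact Finset.prod_ne_zero_iff.2 fun k _ =>
        norm_pos_iff.1 (hl.trans_le (S.l0_le _ (S.iterate_mem hg k)))
    · intro z hz
      have h1 := hcon z (frontier_subset_closure hz)
      have h2 := hfrh n z hz
      calc ‖z‖ ≤ s := h1.le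
        _ = s / c₂ * c₂ := by field_simp
        _ ≤ s / c₂ * ‖h n z‖ := by gcongr
  choose z hz hsz using hbig
  -- The regions decrease with `n`, so a limit of the chosen parameters lies in every closure and
  -- still has modulus at least `s`.
  obtain ⟨w, -, φ, hφ, hφw⟩ := (isCompact_closedBall (0 : ℂ) R).tendsto_subseq
    fun n => mem_closedBall_zero_iff.2 (hOcl n _ (hz n)).1
  have hw : ∀ n, w ∈ closure (O n) := by
    intro n
    refine isClosed_closure.mem_of_tendsto hφw ?_
    filter_upwards [eventually_ge_atTop n] with j hj
    have hsub : O (φ j) ⊆ O n := fun y hy => ⟨hy.1, fun k hk => hy.2 k (by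
      have := hφ.id_le j
      simp only [Finset.mem_range, id] at hk this ⊢
      omega)⟩
    exact closure_mono hsub (hz (φ j))
  have hws : s ≤ ‖w‖ := ge_of_tendsto' hφw.norm fun j => hsz _
  have hwR := (hOcl 0 w (hw 0)).1
  have hwsh : ∀ k, dist (G^[k] (D.σ w)) (G^[k] g) ≤ ρ := fun k => (hOcl k w (hw k)).2 k le_rfl
  refine hno' g hg (D.σ w) (fun e => ?_) hwsh fun n =>
    slowPair_of_hor hρ hg (fun k _ => hwsh k) (D.hor (hball hwR))
  have := D.norm_le_dist hg (hball hwR)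
  rw [e, dist_self, mul_zero] at this
  linarith

end ConeSystem

/-! ### Maps in charts and quantitative differentiability -/

variable {E : Type*} [NormedAddCommGroup E] [NormedSpace ℂ E]

section Charts

variable {U : Type*} [TopologicalSpace U] [ChartedSpace E U] [IsManifold 𝓘(ℂ, E) ω U]

/-- The differential of the chart around `x₀`, as an operator on the model space. -/
def chartD (x₀ x : U) : E →L[ℂ] E := chartDeriv x₀ x

/-- The differential of `G` at `x`, as an operator on the model space. -/
def tanD (E : Type*) [NormedAddCommGroup E] [NormedSpace ℂ E] {U : Type*} [TopologicalSpace U]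
    [ChartedSpace E U] (G : U → U) (x : U) : E →L[ℂ] E :=
  mfderiv 𝓘(ℂ, E) 𝓘(ℂ, E) G x

lemma exists_equiv_chartDeriv {x₀ x : U} (hx : x ∈ (chartAt E x₀).source) :
    ∃ Θ : E ≃L[ℂ] E, ∀ v : E, Θ v = chartD x₀ x v :=
  ⟨(mdifferentiable_chart (I := 𝓘(ℂ, E)) x₀).mfderiv hx, fun _ => rfl⟩

lemma contMDiffAt_chart' {x₀ x : U} (hx : x ∈ (chartAt E x₀).source) :
    ContMDiffAt 𝓘(ℂ, E) 𝓘(ℂ, E) ω (chartAt E x₀) x :=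
  contMDiffOn_chart.contMDiffAt ((chartAt E x₀).open_source.mem_nhds hx)

lemma contMDiffAt_chart_symm' {x₀ : U} {a : E} (ha : a ∈ (chartAt E x₀).target) :
    ContMDiffAt 𝓘(ℂ, E) 𝓘(ℂ, E) ω (chartAt E x₀).symm a :=
  contMDiffOn_chart_symm.contMDiffAt ((chartAt E x₀).open_target.mem_nhds ha)

/-- The map `G` read in the charts around `i` and `j`. -/
def readMap (E : Type*) [NormedAddCommGroup E] [NormedSpace ℂ E] {U : Type*} [TopologicalSpace U]
    [ChartedSpace E U] (G : U → U) (i j : U) : E → E :=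
  fun a => chartAt E j (G ((chartAt E i).symm a))

lemma contDiffAt_readMap {G : U → U} {i j x : U} (hi : x ∈ (chartAt E i).source)
    (hj : G x ∈ (chartAt E j).source) (hG : ContMDiffAt 𝓘(ℂ, E) 𝓘(ℂ, E) ω G x) :
    ContDiffAt ℂ ω (readMap E G i j) (chartAt E i x) := by
  rw [← contMDiffAt_iff_contDiffAt]
  have h1 : (chartAt E i).symm (chartAt E i x) = x := (chartAt E i).left_inv hi
  have h2 := contMDiffAt_chart_symm' (E := E) ((chartAt E i).map_source hi)
  have h3 : ContMDiffAt 𝓘(ℂ, E) 𝓘(ℂ, E) ω (G ∘ (chartAt E i).symm) (chartAt E i x) :=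
    ContMDiffAt.comp _ (by rwa [h1]) h2
  exact ContMDiffAt.comp (g := chartAt E j) _
    (by rw [h1]; exact contMDiffAt_chart' hj) h3

/-- The differential of `readMap` is the differential of the map, read in charts. -/
lemma fderiv_readMap {G : U → U} {i j x : U} (hi : x ∈ (chartAt E i).source)
    (hj : G x ∈ (chartAt E j).source) (hG : ContMDiffAt 𝓘(ℂ, E) 𝓘(ℂ, E) ω G x) (v : E) :
    fderiv ℂ (readMap E G i j) (chartAt E i x) (chartD i x v) =
      chartD j (G x) (tanD E G x v) := by
  have hω : (ω : WithTop ℕ∞) ≠ 0 := by simp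
  have hd : MDifferentiableAt 𝓘(ℂ, E) 𝓘(ℂ, E) (readMap E G i j) (chartAt E i x) :=
    mdifferentiableAt_iff_differentiableAt.2
      ((contDiffAt_readMap hi hj hG).differentiableAt hω)
  have hc := (contMDiffAt_chart' (E := E) hi).mdifferentiableAt hω
  have hcj := (contMDiffAt_chart' (E := E) hj).mdifferentiableAt hω
  have h1 := mfderiv_comp x hd hc
  have h2 := mfderiv_comp x hcj (hG.mdifferentiableAt hω)
  have h3 : (readMap E G i j ∘ chartAt E i) =ᶠ[𝓝 x] (chartAt E j ∘ G) := by
    filter_upwards [(chartAt E i).open_source.mem_nhds hi] with y hy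
    simp [readMap, (chartAt E i).left_inv hy]
  have h4 := h3.mfderiv_eq (I := 𝓘(ℂ, E)) (I' := 𝓘(ℂ, E))
  rw [h1, h2, mfderiv_eq_fderiv] at h4
  exact DFunLike.congr_fun h4 v

end Charts

/-- Quantitative strict differentiability of a `C²` map, locally uniformly in the base point. -/
lemma exists_strict_bound {F : E → E} {a₀ : E} (hF : ContDiffAt ℂ 2 F a₀) :
    ∃ C : ℝ, 0 < C ∧ ∃ s : ℝ, 0 < s ∧ ∀ a ∈ Metric.ball a₀ s,
      ‖fderiv ℂ F a‖ ≤ C ∧ ∀ b ∈ Metric.ball a₀ s, ∀ b' ∈ Metric.ball a₀ s,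
        ‖F b - F b' - fderiv ℂ F a (b - b')‖ ≤ C * (‖b - a‖ + ‖b' - a‖) * ‖b - b'‖ := by
  have h1 : ContDiffAt ℂ 1 (fderiv ℂ F) a₀ := hF.fderiv_right (m := 1) (by norm_num)
  obtain ⟨C, t, ht, hL⟩ := h1.exists_lipschitzOnWith
  have h2 : ∀ᶠ a in 𝓝 a₀, DifferentiableAt ℂ F a := by
    filter_upwards [hF.eventually (by simp)] with a ha
    exact ha.differentiableAt (by norm_num)
  have h3 : ∀ᶠ a in 𝓝 a₀, ‖fderiv ℂ F a‖ < ‖fderiv ℂ F a₀‖ + 1 :=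
    h1.continuousAt.norm.eventually (gt_mem_nhds (lt_add_one _))
  obtain ⟨s, hs, hball⟩ := Metric.eventually_nhds_iff_ball.1
    ((h2.and h3).and (Filter.eventually_iff.2 ht))
  refine ⟨C + (‖fderiv ℂ F a₀‖ + 1), by positivity, s, hs, fun a ha => ⟨?_, ?_⟩⟩
  · have := (hball a ha).1.2
    have hC : (0 : ℝ) ≤ C := C.2
    linarith
  · intro b hb b' hb'
    -- Cutting down to the ball around `a` containing `b` and `b'` bounds the variation of the
    -- derivative by their distances to `a`, which makes the error quadratic.
    have hconv : Convex ℝ (Metric.ball a₀ s ∩ Metric.closedBall a (max ‖b - a‖ ‖b' - a‖)) :=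
      (convex_ball a₀ s).inter (convex_closedBall _ _)
    have hbound := hconv.norm_image_sub_le_of_norm_fderiv_le' (𝕜 := ℂ) (f := F)
      (φ := fderiv ℂ F a) (C := C * max ‖b - a‖ ‖b' - a‖) (x := b') (y := b)
      (fun z hz => (hball z hz.1).1.1) (fun z hz => ?_)
      ⟨hb', by rw [Metric.mem_closedBall, dist_eq_norm]; exact le_max_right _ _⟩
      ⟨hb, by rw [Metric.mem_closedBall, dist_eq_norm]; exact le_max_left _ _⟩
    · refine hbound.trans ?_
      have : max ‖b - a‖ ‖b' - a‖ ≤ ‖b - a‖ + ‖b' - a‖ :=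
        max_le_add_of_nonneg (norm_nonneg _) (norm_nonneg _)
      have hC : (0 : ℝ) ≤ C := C.2
      gcongr
      linarith [norm_nonneg (fderiv ℂ F a₀)]
    · have := hL.dist_le_mul z (hball z hz.1).2 a (hball a ha).2
      rw [dist_eq_norm] at this
      refine this.trans ?_
      gcongr
      exact hz.2

/-! ### Local frames and finite frame atlases -/

section Frames

variable {U : Type*} [MetricSpace U] [ChartedSpace E U] [IsManifold 𝓘(ℂ, E) ω U]

/-- Local data around `x₀`: the chart is bi-Lipschitz on `W`, the tangent norms are equivalent to
the chart norm, and `Es x` is the kernel of a functional `ℓ x` in the chart. -/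
structure LocalFrame (N : U → Seminorm ℂ E) (A : Set U)
    (Es : U → Submodule ℂ E) (x₀ : U) where
  K : ℝ
  W : Set U
  ℓ : U → E →L[ℂ] ℂ
  e : E
  one_le_K : 1 ≤ K
  isOpen : IsOpen W
  mem : x₀ ∈ W
  subset : W ⊆ (chartAt E x₀).source
  bilip : ∀ x ∈ W, ∀ y ∈ W, dist x y ≤ K * ‖chartAt E x₀ x - chartAt E x₀ y‖ ∧
    ‖chartAt E x₀ x - chartAt E x₀ y‖ ≤ K * dist x y
  norm : ∀ x ∈ W ∩ A, ∀ v : E, N x v ≤ K * ‖chartD x₀ x v‖ ∧ ‖chartD x₀ x v‖ ≤ K * N x v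
  cont : ContinuousOn ℓ (W ∩ A)
  ker : ∀ x ∈ W ∩ A, ∀ v : E, v ∈ Es x ↔ ℓ x (chartD x₀ x v) = 0
  norm_ℓ : ∀ x ∈ W ∩ A, ‖ℓ x‖ ≤ K
  norm_e : ‖e‖ ≤ K
  one_le_ℓ : ∀ x ∈ W ∩ A, 1 ≤ ‖ℓ x e‖

/-- A closed hyperplane, read through a linear equivalence, is the kernel of a functional. -/
lemma exists_functional {H F : Submodule ℂ E} (hF : IsClosed (F : Set E))
    (hH : Module.finrank ℂ (E ⧸ H) = 1) (Ψ : E ≃L[ℂ] E) (h : ∀ v, v ∈ H ↔ Ψ v ∈ F) :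
    ∃ (l : E →L[ℂ] ℂ) (e : E), (∀ v, v ∈ F ↔ l v = 0) ∧ ‖l (Ψ e)‖ = 2 := by
  have hfin : Module.finrank ℂ (E ⧸ H) = Module.finrank ℂ ℂ := by rw [hH, Module.finrank_self]
  -- An infinite-dimensional quotient has `finrank` zero, so rank one does imply finiteness.
  have : FiniteDimensional ℂ (E ⧸ H) := Module.finite_of_finrank_pos (by omega)
  let θ : (E ⧸ H) ≃ₗ[ℂ] ℂ := LinearEquiv.ofFinrankEq _ _ hfin
  let l₀ : E →ₗ[ℂ] ℂ := θ.toLinearMap ∘ₗ H.mkQ ∘ₗ Ψ.symm.toLinearEquiv.toLinearMap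
  have hl₀ : ∀ v, l₀ v = θ (H.mkQ (Ψ.symm v)) := fun v => rfl
  have hker : ∀ v, v ∈ F ↔ l₀ v = 0 := by
    intro v
    rw [hl₀, LinearEquiv.map_eq_zero_iff, Submodule.mkQ_apply, Submodule.Quotient.mk_eq_zero, h,
      ContinuousLinearEquiv.apply_symm_apply]
  have hc : Continuous l₀ := by
    refine l₀.continuous_of_isClosed_ker ?_
    have : (l₀.ker : Set E) = F := by
      ext v
      rw [SetLike.mem_coe, LinearMap.mem_ker, SetLike.mem_coe, hker]
    rwa [this]
  obtain ⟨e, he⟩ := H.mkQ_surjective (θ.symm 2)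
  refine ⟨⟨l₀, hc⟩, e, hker, ?_⟩
  change ‖l₀ (Ψ e)‖ = 2
  rw [hl₀, ContinuousLinearEquiv.symm_apply_apply, he, LinearEquiv.apply_symm_apply]
  simp

/-- The subbundle trivialisation moves the spaces to a fixed hyperplane, the kernel of one
functional; pulling it back by `Φ x` gives a continuous family. Its value has norm 2 on the
reference vector at `x₀`, which leaves room for the bound 1 nearby. -/
lemma nonempty_localFrame {N : U → Seminorm ℂ E} {A : Set U}
    {Es : U → Submodule ℂ E} (hdist : CompatibleDist E A) (hnorm : CompatibleNorm (E := E) N A)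
    (hEs : IsSubbundle (E := E) A Es) (hcodim : ∀ x ∈ A, Module.finrank ℂ (E ⧸ Es x) = 1)
    {x₀ : U} (hx₀ : x₀ ∈ A) : Nonempty (LocalFrame N A Es x₀) := by
  obtain ⟨K₁, hK₁, W₁, hW₁, h₁⟩ := hdist x₀ hx₀
  obtain ⟨K₂, hK₂, W₂, hW₂, h₂⟩ := hnorm x₀ hx₀
  obtain ⟨F, hF, -, W₃, hW₃, Φ, hΦ, h₃⟩ := hEs x₀ hx₀
  obtain ⟨Θ, hΘ⟩ := exists_equiv_chartDeriv (mem_chart_source E x₀)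
  obtain ⟨l, e, hl, hle⟩ := exists_functional (E := E) (H := Es x₀) hF (hcodim x₀ hx₀) (Θ.trans (Φ x₀))
    (fun v => by
      rw [ContinuousLinearEquiv.trans_apply, hΘ]
      exact h₃ x₀ ⟨mem_of_mem_nhds hW₃, hx₀⟩ v)
  set ℓ : U → E →L[ℂ] ℂ := fun x => l.comp (Φ x : E →L[ℂ] E) with hℓ
  have hcont : ContinuousOn ℓ (W₃ ∩ A) := continuousOn_const.clm_comp hΦ
  have hx₃ : x₀ ∈ W₃ ∩ A := ⟨mem_of_mem_nhds hW₃, hx₀⟩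
  have hc₀ : ContinuousWithinAt ℓ A x₀ := by
    have := hcont x₀ hx₃
    rwa [inter_comm, continuousWithinAt_inter hW₃] at this
  have ev1 : ∀ᶠ x in 𝓝[A] x₀, ‖ℓ x‖ < ‖ℓ x₀‖ + 1 :=
    hc₀.norm.eventually (gt_mem_nhds (lt_add_one _))
  have ev2 : ∀ᶠ x in 𝓝[A] x₀, 1 < ‖ℓ x (Θ e)‖ := by
    have : ContinuousWithinAt (fun x => ℓ x (Θ e)) A x₀ := hc₀.clm_apply continuousWithinAt_const
    refine this.norm.eventually (lt_mem_nhds ?_)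
    exact (one_lt_two (α := ℝ)).trans_eq hle.symm
  obtain ⟨W₄, hW₄, h₄⟩ := mem_nhdsWithin_iff_exists_mem_nhds_inter.1 (ev1.and ev2)
  obtain ⟨W, hW, hWo, hxW⟩ := mem_nhds_iff.1
    (inter_mem (inter_mem hW₁ hW₂) (inter_mem hW₃ (inter_mem hW₄
      ((chartAt E x₀).open_source.mem_nhds (mem_chart_source E x₀)))))
  set K := 1 + K₁ + K₂ + (‖ℓ x₀‖ + 1) + ‖Θ e‖ with hK
  have hn1 := norm_nonneg (ℓ x₀)
  have hn2 := norm_nonneg (Θ e)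
  have hK1 : K₁ ≤ K := by rw [hK]; linarith
  have hK2 : K₂ ≤ K := by rw [hK]; linarith
  refine ⟨⟨K, W, ℓ, Θ e, by rw [hK]; linarith, hWo, hxW, fun x hx => (hW hx).2.2.2, ?_, ?_, ?_,
    ?_, ?_, by rw [hK]; linarith, ?_⟩⟩
  · intro x hx y hy
    obtain ⟨a, b⟩ := h₁ x (hW hx).1.1 y (hW hy).1.1
    exact ⟨a.trans (by gcongr), b.trans (by gcongr)⟩
  · intro x hx v
    obtain ⟨a, b⟩ := h₂ x ⟨(hW hx.1).1.2, hx.2⟩ v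
    exact ⟨a.trans (mul_le_mul_of_nonneg_right hK2 (norm_nonneg (chartD x₀ x v))),
      b.trans (mul_le_mul_of_nonneg_right hK2 (apply_nonneg _ _))⟩
  · exact hcont.mono fun x hx => ⟨(hW hx.1).2.1, hx.2⟩
  · intro x hx v
    exact (h₃ x ⟨(hW hx.1).2.1, hx.2⟩ v).trans (hl _)
  · intro x hx
    have := (h₄ ⟨(hW hx.1).2.2.1, hx.2⟩).1
    rw [hK]; linarith
  · intro x hx
    exact (h₄ ⟨(hW hx.1).2.2.1, hx.2⟩).2.le

/-- Finitely many local frames covering `A`, with a choice `c x` of a frame around each point. -/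
structure FrameAtlas (N : U → Seminorm ℂ E) (A : Set U)
    (Es : U → Submodule ℂ E) where
  t : Finset U
  c : U → U
  r : ℝ
  K : ℝ
  W : U → Set U
  ℓ : U → U → E →L[ℂ] ℂ
  e : U → E
  r_pos : 0 < r
  one_le_K : 1 ≤ K
  c_mem : ∀ x ∈ A, c x ∈ t
  ball_subset : ∀ x ∈ A, Metric.ball x r ⊆ W (c x)
  isOpen : ∀ i ∈ t, IsOpen (W i)
  subset : ∀ i ∈ t, W i ⊆ (chartAt E i).source
  bilip : ∀ i ∈ t, ∀ x ∈ W i, ∀ y ∈ W i, dist x y ≤ K * ‖chartAt E i x - chartAt E i y‖ ∧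
    ‖chartAt E i x - chartAt E i y‖ ≤ K * dist x y
  norm : ∀ i ∈ t, ∀ x ∈ W i ∩ A, ∀ v : E,
    N x v ≤ K * ‖chartD i x v‖ ∧ ‖chartD i x v‖ ≤ K * N x v
  cont : ∀ i ∈ t, ContinuousOn (ℓ i) (W i ∩ A)
  ker : ∀ i ∈ t, ∀ x ∈ W i ∩ A, ∀ v : E, v ∈ Es x ↔ ℓ i x (chartD i x v) = 0
  norm_ℓ : ∀ i ∈ t, ∀ x ∈ W i ∩ A, ‖ℓ i x‖ ≤ K
  norm_e : ∀ i ∈ t, ‖e i‖ ≤ K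
  one_le_ℓ : ∀ i ∈ t, ∀ x ∈ W i ∩ A, 1 ≤ ‖ℓ i x (e i)‖

-- A Lebesgue number provides one radius `r` for which each ball centred in `A` lies in a single
-- frame domain; the choice of this frame need not be continuous.
omit [IsManifold 𝓘(ℂ, E) ω U] in
lemma nonempty_frameAtlas {N : U → Seminorm ℂ E} {A : Set U} (hA : IsCompact A)
    {Es : U → Submodule ℂ E} (h : ∀ x ∈ A, Nonempty (LocalFrame N A Es x)) :
    Nonempty (FrameAtlas N A Es) := by
  classical
  rcases isEmpty_or_nonempty A with hAe | ⟨⟨a₀, ha₀⟩⟩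
  · have hA0 : ∀ x, x ∉ A := fun x hx => hAe.false ⟨x, hx⟩
    exact ⟨⟨∅, id, 1, 1, fun _ => ∅, fun _ _ => 0, fun _ => 0, one_pos, le_rfl,
      fun x hx => absurd hx (hA0 x), fun x hx => absurd hx (hA0 x), by simp, by simp, by simp,
      by simp, by simp, by simp, by simp, by simp, by simp⟩⟩
  let Fr : ∀ x : U, x ∈ A → LocalFrame N A Es x := fun x hx => (h x hx).some
  obtain ⟨t, ht⟩ := hA.elim_nhds_subcover' (fun x hx => (Fr x hx).W)
    (fun x hx => (Fr x hx).isOpen.mem_nhds (Fr x hx).mem)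
  let W : U → Set U := fun i => if hi : i ∈ A then (Fr i hi).W else ∅
  let ℓ : U → U → E →L[ℂ] ℂ := fun i => if hi : i ∈ A then (Fr i hi).ℓ else 0
  let e : U → E := fun i => if hi : i ∈ A then (Fr i hi).e else 0
  let k : U → ℝ := fun i => if hi : i ∈ A then (Fr i hi).K else 0
  let s : Finset U := t.image Subtype.val
  have hs : ∀ i ∈ s, i ∈ A := by
    intro i hi
    obtain ⟨j, -, rfl⟩ := Finset.mem_image.1 hi
    exact j.2
  have hWo : ∀ i ∈ s, IsOpen (W i) := fun i hi => by
    simp only [W, dif_pos (hs i hi)]; exact (Fr i (hs i hi)).isOpen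
  have hcov : A ⊆ ⋃ i : s, W i := by
    intro x hx
    obtain ⟨y, hy, hxy⟩ := mem_iUnion₂.1 (ht hx)
    refine mem_iUnion.2 ⟨⟨y, Finset.mem_image_of_mem _ hy⟩, ?_⟩
    simp only [W, dif_pos y.2]
    exact hxy
  obtain ⟨r, hr, hleb⟩ := lebesgue_number_lemma_of_metric hA (fun i : s => hWo i i.2) hcov
  have : Nonempty s := by
    obtain ⟨i, -⟩ := mem_iUnion.1 (hcov ha₀); exact ⟨i⟩
  choose! c hc using hleb
  have hk0 : ∀ i ∈ s, 0 ≤ k i := fun i hi => by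
    simp only [k, dif_pos (hs i hi)]
    exact zero_le_one.trans (Fr i (hs i hi)).one_le_K
  have hk : ∀ i (hi : i ∈ s), (Fr i (hs i hi)).K ≤ 1 + ∑ i ∈ s, k i := fun i hi => by
    have h1 := Finset.single_le_sum hk0 hi
    simp only [k, dif_pos (hs i hi)] at h1
    linarith
  refine ⟨⟨s, fun x => c x, r, 1 + ∑ i ∈ s, k i, W, ℓ, e, hr, ?_, fun x hx => (c x).2, hc, hWo,
    ?_, ?_, ?_, ?_, ?_, ?_, ?_, ?_⟩⟩
  · linarith [Finset.sum_nonneg hk0]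
  all_goals
    intro i hi
    have hiA := hs i hi
    have hki := hk i hi
    simp only [W, ℓ, e, dif_pos hiA]
  · exact (Fr i hiA).subset
  · intro x hx y hy
    obtain ⟨a, b⟩ := (Fr i hiA).bilip x hx y hy
    exact ⟨a.trans (by gcongr), b.trans (by gcongr)⟩
  · intro x hx v
    obtain ⟨a, b⟩ := (Fr i hiA).norm x hx v
    exact ⟨a.trans (by gcongr), b.trans (mul_le_mul_of_nonneg_right hki (apply_nonneg _ _))⟩
  · exact (Fr i hiA).cont
  · exact (Fr i hiA).ker
  · exact fun x hx => ((Fr i hiA).norm_ℓ x hx).trans hki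
  · exact (Fr i hiA).norm_e.trans hki
  · exact (Fr i hiA).one_le_ℓ

end Frames

end LyubichHyp

/-! ### Estimates uniform over the chosen frames -/

namespace LyubichHyp

namespace FrameAtlas

variable {E : Type*} [NormedAddCommGroup E] [NormedSpace ℂ E]
variable {U : Type*} [MetricSpace U] [ChartedSpace E U]
variable {N : U → Seminorm ℂ E} {A : Set U} {Es : U → Submodule ℂ E} (F : FrameAtlas N A Es)

lemma K_pos : 0 < F.K := zero_lt_one.trans_le F.one_le_K

lemma mem_W {x : U} (hx : x ∈ A) : x ∈ F.W (F.c x) :=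
  F.ball_subset x hx (Metric.mem_ball_self F.r_pos)

lemma mem_source {x : U} (hx : x ∈ A) : x ∈ (chartAt E (F.c x)).source :=
  F.subset _ (F.c_mem x hx) (F.mem_W hx)

/-- Locally uniform estimates, valid for all admissible frames, are uniform for the chosen
frames. -/
lemma exists_uniform (hA : IsCompact A) {G : U → U} (hG : ∀ x ∈ A, ContinuousAt G x)
    (hm : MapsTo G A A) {p : U → U → U → ℝ → Prop}
    (mono : ∀ i j x C C', C ≤ C' → p i j x C → p i j x C')
    (loc : ∀ x₀ ∈ A, ∀ i ∈ F.t, ∀ j ∈ F.t, x₀ ∈ F.W i → G x₀ ∈ F.W j →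
      ∃ C, ∀ᶠ x in 𝓝[A] x₀, p i j x C) : ∃ C, ∀ x ∈ A, p (F.c x) (F.c (G x)) x C := by
  have key : ∃ C, ∀ x ∈ A, x ∈ A → p (F.c x) (F.c (G x)) x C := by
    refine hA.induction_on (p := fun s => ∃ C, ∀ x ∈ s, x ∈ A → p (F.c x) (F.c (G x)) x C)
      ⟨0, by simp⟩ (fun s s' hs ⟨C, hC⟩ => ⟨C, fun x hx => hC x (hs hx)⟩) ?_ ?_
    · rintro s s' ⟨C, hC⟩ ⟨C', hC'⟩
      refine ⟨max C C', fun x hx hxA => ?_⟩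
      rcases hx with hx | hx
      · exact mono _ _ _ _ _ (le_max_left _ _) (hC x hx hxA)
      · exact mono _ _ _ _ _ (le_max_right _ _) (hC' x hx hxA)
    · intro x₀ hx₀
      have h1 : ∀ q : U × U, ∃ C : ℝ, q ∈ F.t ×ˢ F.t → x₀ ∈ F.W q.1 → G x₀ ∈ F.W q.2 →
          ∀ᶠ x in 𝓝[A] x₀, p q.1 q.2 x C := by
        intro q
        by_cases hq : q ∈ F.t ×ˢ F.t ∧ x₀ ∈ F.W q.1 ∧ G x₀ ∈ F.W q.2
        · obtain ⟨C, hC⟩ := loc x₀ hx₀ q.1 (Finset.mem_product.1 hq.1).1 q.2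
            (Finset.mem_product.1 hq.1).2 hq.2.1 hq.2.2
          exact ⟨C, fun _ _ _ => hC⟩
        · exact ⟨0, fun a b c => absurd ⟨a, b, c⟩ hq⟩
      choose C hC using h1
      have hCle : ∀ q ∈ F.t ×ˢ F.t, C q ≤ ∑ q ∈ F.t ×ˢ F.t, |C q| := fun q hq =>
        (le_abs_self _).trans
          (Finset.single_le_sum (f := fun q => |C q|) (fun _ _ => abs_nonneg _) hq)
      have hall : ∀ᶠ x in 𝓝[A] x₀, ∀ q ∈ F.t ×ˢ F.t, x₀ ∈ F.W q.1 → G x₀ ∈ F.W q.2 →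
          p q.1 q.2 x (∑ q ∈ F.t ×ˢ F.t, |C q|) := by
        refine (Filter.eventually_all_finset _).2 fun q hq => ?_
        by_cases hx : x₀ ∈ F.W q.1 ∧ G x₀ ∈ F.W q.2
        · filter_upwards [hC q hq hx.1 hx.2] with x hp _ _
          exact mono _ _ _ _ _ (hCle q hq) hp
        · exact Filter.Eventually.of_forall fun x a b => absurd ⟨a, b⟩ hx
      -- For `x` near `x₀`, the frames chosen at `x` and `G x` are admissible at `x₀` and `G x₀`, so
      -- the finitely many local constants suffice.
      have hnear : ∀ᶠ x in 𝓝[A] x₀, x₀ ∈ Metric.ball x F.r ∧ G x₀ ∈ Metric.ball (G x) F.r := by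
        have a1 : ∀ᶠ x in 𝓝 x₀, dist x x₀ < F.r := Metric.ball_mem_nhds _ F.r_pos
        have a2 : ∀ᶠ x in 𝓝 x₀, dist (G x) (G x₀) < F.r :=
          (hG x₀ hx₀).eventually (Metric.ball_mem_nhds _ F.r_pos)
        filter_upwards [nhdsWithin_le_nhds a1, nhdsWithin_le_nhds a2] with x h1 h2
        exact ⟨by rwa [Metric.mem_ball'], by rwa [Metric.mem_ball']⟩
      refine ⟨_, hall.and hnear, _, fun x hx hxA => hx.1 (F.c x, F.c (G x)) ?_ ?_ ?_⟩
      · exact Finset.mem_product.2 ⟨F.c_mem x hxA, F.c_mem _ (hm hxA)⟩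
      · exact F.ball_subset x hxA hx.2.1
      · exact F.ball_subset _ (hm hxA) hx.2.2
  obtain ⟨C, hC⟩ := key
  exact ⟨C, fun x hx => hC x hx hx⟩

/-- The differential of `G` read in the frames `i` and `j`. -/
def Tij (G : U → U) (i j x : U) : E →L[ℂ] E := fderiv ℂ (readMap E G i j) (chartAt E i x)

/-- The factor by which `G` multiplies the transverse functionals of the frames `i`, `j`. -/
def lamIJ (G : U → U) (i j x : U) : ℂ :=
  F.ℓ j (G x) (Tij G i j x (F.e i)) / F.ℓ i x (F.e i)

/-- The transverse functional at `x`, on the tangent space. -/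
def m (x : U) : E →L[ℂ] ℂ := (F.ℓ (F.c x) x).comp (chartD (F.c x) x)

lemma norm_ℓ_chartD_le {i x : U} (hi : i ∈ F.t) (hxi : x ∈ F.W i) (hx : x ∈ A) (v : E) :
    ‖F.ℓ i x (chartD i x v)‖ ≤ F.K ^ 2 * N x v := by
  have hK := F.K_pos
  calc _ ≤ ‖F.ℓ i x‖ * ‖chartD i x v‖ := (F.ℓ i x).le_opNorm _
    _ ≤ F.K * (F.K * N x v) := by
        gcongr
        · exact F.norm_ℓ i hi x ⟨hxi, hx⟩
        · exact (F.norm i hi x ⟨hxi, hx⟩ v).2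
    _ = _ := by ring

lemma mem_Es_iff {x : U} (hx : x ∈ A) (v : E) : v ∈ Es x ↔ F.m x v = 0 :=
  F.ker _ (F.c_mem x hx) x ⟨F.mem_W hx, hx⟩ v

lemma norm_m_le {x : U} (hx : x ∈ A) (v : E) : ‖F.m x v‖ ≤ F.K ^ 2 * N x v :=
  F.norm_ℓ_chartD_le (F.c_mem x hx) (F.mem_W hx) hx v

variable [IsManifold 𝓘(ℂ, E) ω U]

lemma Tij_chartD {G : U → U} {i j x : U} (hi : i ∈ F.t) (hj : j ∈ F.t) (hxi : x ∈ F.W i)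
    (hxj : G x ∈ F.W j) (hG : ContMDiffAt 𝓘(ℂ, E) 𝓘(ℂ, E) ω G x) (v : E) :
    Tij G i j x (chartD i x v) = chartD j (G x) (tanD E G x v) :=
  fderiv_readMap (F.subset i hi hxi) (F.subset j hj hxj) hG v

/-- Invariance of `Es` sends the kernel of `ℓ i x` into that of `ℓ j (G x)`, so the pulled-back
functional is a multiple of `ℓ i x`; evaluation at `e i` identifies the factor. -/
lemma ℓ_Tij {G : U → U} (hm : MapsTo G A A)
    (hinv : ∀ x ∈ A, ∀ v ∈ Es x, tanD E G x v ∈ Es (G x)) {i j x : U} (hx : x ∈ A) (hi : i ∈ F.t)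
    (hj : j ∈ F.t) (hxi : x ∈ F.W i) (hxj : G x ∈ F.W j)
    (hG : ContMDiffAt 𝓘(ℂ, E) 𝓘(ℂ, E) ω G x) (v : E) :
    F.ℓ j (G x) (Tij G i j x v) = F.lamIJ G i j x * F.ℓ i x v := by
  obtain ⟨Θ, hΘ⟩ := exists_equiv_chartDeriv (F.subset i hi hxi)
  have he : F.ℓ i x (F.e i) ≠ 0 :=
    norm_pos_iff.1 (zero_lt_one.trans_le (F.one_le_ℓ i hi x ⟨hxi, hx⟩))
  set a := F.ℓ i x v / F.ℓ i x (F.e i)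
  have h1 : F.ℓ i x (v - a • F.e i) = 0 := by
    rw [map_sub, map_smul, smul_eq_mul, div_mul_cancel₀ _ he, sub_self]
  have h2 : Θ.symm (v - a • F.e i) ∈ Es x := by
    rw [F.ker i hi x ⟨hxi, hx⟩, ← hΘ, ContinuousLinearEquiv.apply_symm_apply, h1]
  have h3 := hinv x hx _ h2
  rw [F.ker j hj _ ⟨hxj, hm hx⟩, ← F.Tij_chartD hi hj hxi hxj hG, ← hΘ,
    ContinuousLinearEquiv.apply_symm_apply, map_sub, map_sub, map_smul, map_smul, sub_eq_zero,
    smul_eq_mul] at h3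
  rw [h3, lamIJ]
  ring

lemma continuousAt_Tij {G : U → U} {i j x₀ : U} (hi : i ∈ F.t) (hj : j ∈ F.t) (hxi : x₀ ∈ F.W i)
    (hxj : G x₀ ∈ F.W j) (hG : ContMDiffAt 𝓘(ℂ, E) 𝓘(ℂ, E) ω G x₀) :
    ContinuousAt (Tij (E := E) G i j) x₀ := by
  have h1 := contDiffAt_readMap (F.subset i hi hxi) (F.subset j hj hxj) hG
  have h2 : ContDiffAt ℂ 1 (fderiv ℂ (readMap E G i j)) (chartAt E i x₀) :=
    h1.fderiv_right (m := 1) le_top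
  exact ContinuousAt.comp (g := fderiv ℂ (readMap E G i j)) h2.continuousAt
    ((chartAt E i).continuousAt (F.subset i hi hxi))

/-- Continuity holds for fixed frames `i`, `j`, whereas the cocycle in the frames `c x` may jump
with `x`. Semicontinuity arguments therefore go through `lamIJ`. -/
lemma continuousWithinAt_lamIJ {G : U → U} (hm : MapsTo G A A) {i j x₀ : U} (hx : x₀ ∈ A)
    (hi : i ∈ F.t) (hj : j ∈ F.t) (hxi : x₀ ∈ F.W i)
    (hxj : G x₀ ∈ F.W j) (hG : ContMDiffAt 𝓘(ℂ, E) 𝓘(ℂ, E) ω G x₀) :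
    ContinuousWithinAt (F.lamIJ G i j) A x₀ := by
  have hcont : ∀ k ∈ F.t, ∀ y ∈ A, y ∈ F.W k → ContinuousWithinAt (F.ℓ k) A y := by
    intro k hk y hy hyk
    have := F.cont k hk y ⟨hyk, hy⟩
    rwa [inter_comm, continuousWithinAt_inter ((F.isOpen k hk).mem_nhds hyk)] at this
  have h1 : ContinuousWithinAt (fun x => F.ℓ j (G x)) A x₀ :=
    (hcont j hj _ (hm hx) hxj).comp hG.continuousAt.continuousWithinAt hm
  refine ContinuousWithinAt.div (h1.clm_apply ?_)
    ((hcont i hi x₀ hx hxi).clm_apply continuousWithinAt_const)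
    (norm_pos_iff.1 (zero_lt_one.trans_le (F.one_le_ℓ i hi x₀ ⟨hxi, hx⟩)))
  exact (F.continuousAt_Tij hi hj hxi hxj hG).continuousWithinAt.clm_apply
    continuousWithinAt_const

/-- Uniform strict differentiability of `G` along `A` in the chosen frames. -/
lemma exists_strict (hA : IsCompact A) {G : U → U} {O : Set U} (hO : IsOpen O) (hAO : A ⊆ O)
    (hG : ContMDiffOn 𝓘(ℂ, E) 𝓘(ℂ, E) ω G O) (hm : MapsTo G A A) :
    ∃ C : ℝ, ∀ x ∈ A, 1 ≤ C ∧ ‖Tij (E := E) G (F.c x) (F.c (G x)) x‖ ≤ C ∧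
      (∀ y ∈ Metric.ball x (1 / C), ContinuousAt G y) ∧
      ∀ y ∈ Metric.ball x (1 / C), ∀ y' ∈ Metric.ball x (1 / C),
        ‖chartAt E (F.c (G x)) (G y) - chartAt E (F.c (G x)) (G y') -
            Tij G (F.c x) (F.c (G x)) x (chartAt E (F.c x) y - chartAt E (F.c x) y')‖ ≤
          C * (dist y x + dist y' x) * ‖chartAt E (F.c x) y - chartAt E (F.c x) y'‖ := by
  have hGat : ∀ x ∈ O, ContMDiffAt 𝓘(ℂ, E) 𝓘(ℂ, E) ω G x := fun x hx =>
    hG.contMDiffAt (hO.mem_nhds hx)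
  refine F.exists_uniform hA (G := G) (fun x hx => (hGat x (hAO hx)).continuousAt) hm
    (p := fun i j x C => 1 ≤ C ∧ ‖Tij (E := E) G i j x‖ ≤ C ∧
      (∀ y ∈ Metric.ball x (1 / C), ContinuousAt G y) ∧
      ∀ y ∈ Metric.ball x (1 / C), ∀ y' ∈ Metric.ball x (1 / C),
        ‖chartAt E j (G y) - chartAt E j (G y') - Tij G i j x (chartAt E i y - chartAt E i y')‖ ≤
          C * (dist y x + dist y' x) * ‖chartAt E i y - chartAt E i y'‖) ?_ ?_
  · rintro i j x C C' hCC' ⟨h1, h2, h3, h4⟩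
    have hsub : Metric.ball x (1 / C') ⊆ Metric.ball x (1 / C) :=
      Metric.ball_subset_ball (one_div_le_one_div_of_le (by linarith) hCC')
    exact ⟨h1.trans hCC', h2.trans hCC', fun y hy => h3 y (hsub hy), fun y hy y' hy' =>
      (h4 y (hsub hy) y' (hsub hy')).trans (by gcongr)⟩
  · intro x₀ hx₀ i hi j hj hxi hxj
    obtain ⟨C₀, hC₀, s, hs, hst⟩ := exists_strict_bound
      ((contDiffAt_readMap (F.subset i hi hxi) (F.subset j hj hxj) (hGat x₀ (hAO hx₀))).of_le
        (le_top (a := (2 : WithTop ℕ∞))))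
    have hev : ∀ᶠ y in 𝓝 x₀, y ∈ O ∧ y ∈ F.W i ∧ chartAt E i y ∈ Metric.ball (chartAt E i x₀) s :=
      (hO.eventually_mem (hAO hx₀)).and (((F.isOpen i hi).eventually_mem hxi).and
        (((chartAt E i).continuousAt (F.subset i hi hxi)).eventually (Metric.ball_mem_nhds _ hs)))
    obtain ⟨ρ, hρ, hball⟩ := Metric.eventually_nhds_iff_ball.1 hev
    -- The term `2 / ρ` keeps the ball of radius `1 / C` in the good neighbourhood, and `C₀ * K`
    -- converts chart norms into distances.
    set C := 1 + C₀ + C₀ * F.K + 2 / ρ with hCdef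
    have hK := F.K_pos
    have hC1 : C₀ ≤ C := by have : 0 ≤ C₀ * F.K + 2 / ρ := by positivity
                            rw [hCdef]; linarith
    have hC2 : C₀ * F.K ≤ C := by have : 0 ≤ 2 / ρ := by positivity
                                  rw [hCdef]; linarith
    have hC3 : 2 / ρ ≤ C := by have : 0 ≤ C₀ * F.K := by positivity
                               rw [hCdef]; linarith
    have hC4 : 1 ≤ C := by have : 0 ≤ C₀ * F.K + 2 / ρ := by positivity
                           rw [hCdef]; linarith
    refine ⟨C, ?_⟩
    filter_upwards [nhdsWithin_le_nhds (Metric.ball_mem_nhds x₀ (half_pos hρ))] with x hx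
    have hx' : dist x x₀ < ρ / 2 := hx
    have hsub : Metric.ball x (1 / C) ⊆ Metric.ball x₀ ρ := by
      refine Metric.ball_subset_ball' ?_
      have : 1 / C ≤ ρ / 2 := by
        rw [div_le_iff₀ (by linarith)]
        rw [div_le_iff₀ hρ] at hC3
        linarith
      linarith
    have hxb := hball x (Metric.ball_subset_ball (by linarith) hx)
    obtain ⟨h1, h2⟩ := hst _ hxb.2.2
    refine ⟨hC4, h1.trans hC1, fun y hy => (hGat y (hball y (hsub hy)).1).continuousAt,
      fun y hy y' hy' => ?_⟩
    have hy1 := hball y (hsub hy)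
    have hy1' := hball y' (hsub hy')
    have h3 := h2 _ hy1.2.2 _ hy1'.2.2
    have e1 : readMap E G i j (chartAt E i y) = chartAt E j (G y) := by
      rw [readMap, (chartAt E i).left_inv (F.subset i hi hy1.2.1)]
    have e2 : readMap E G i j (chartAt E i y') = chartAt E j (G y') := by
      rw [readMap, (chartAt E i).left_inv (F.subset i hi hy1'.2.1)]
    rw [e1, e2] at h3
    refine h3.trans ?_
    have b1 := (F.bilip i hi y hy1.2.1 x hxb.2.1).2
    have b2 := (F.bilip i hi y' hy1'.2.1 x hxb.2.1).2
    calc C₀ * (‖chartAt E i y - chartAt E i x‖ + ‖chartAt E i y' - chartAt E i x‖) *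
          ‖chartAt E i y - chartAt E i y'‖
        ≤ C₀ * (F.K * dist y x + F.K * dist y' x) * ‖chartAt E i y - chartAt E i y'‖ := by gcongr
      _ = C₀ * F.K * (dist y x + dist y' x) * ‖chartAt E i y - chartAt E i y'‖ := by ring
      _ ≤ _ := by gcongr

lemma exists_vec {i x : U} (hi : i ∈ F.t) (hxi : x ∈ F.W i) (hx : x ∈ A) :
    ∃ w : E, F.ℓ i x (chartD i x w) = 1 ∧ N x w ≤ F.K ^ 2 := by
  have hK := F.K_pos
  obtain ⟨Θ, hΘ⟩ := exists_equiv_chartDeriv (F.subset i hi hxi)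
  have h1 := F.one_le_ℓ i hi x ⟨hxi, hx⟩
  have he : F.ℓ i x (F.e i) ≠ 0 := norm_pos_iff.1 (zero_lt_one.trans_le h1)
  refine ⟨(F.ℓ i x (F.e i))⁻¹ • Θ.symm (F.e i), ?_, ?_⟩
  · rw [map_smul, map_smul, ← hΘ, ContinuousLinearEquiv.apply_symm_apply, smul_eq_mul,
      inv_mul_cancel₀ he]
  · rw [map_smul_eq_mul, norm_inv]
    have h2 := (F.norm i hi x ⟨hxi, hx⟩ (Θ.symm (F.e i))).1
    rw [← hΘ, ContinuousLinearEquiv.apply_symm_apply] at h2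
    calc ‖F.ℓ i x (F.e i)‖⁻¹ * N x (Θ.symm (F.e i)) ≤ 1 * (F.K * F.K) := by
          gcongr
          · exact inv_le_one_of_one_le₀ h1
          · exact h2.trans (by gcongr; exact F.norm_e i hi)
      _ = _ := by ring

/-- Both functionals vanish exactly on `Es x`, so it is enough to compare them on one normalised
vector of size at most `K ^ 2`. -/
lemma norm_ℓ_comparable {i j x : U} (hi : i ∈ F.t) (hj : j ∈ F.t) (hxi : x ∈ F.W i)
    (hxj : x ∈ F.W j) (hx : x ∈ A) (v : E) :
    ‖F.ℓ i x (chartD i x v)‖ ≤ F.K ^ 4 * ‖F.ℓ j x (chartD j x v)‖ := by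
  obtain ⟨w, hw, hNw⟩ := F.exists_vec hj hxj hx
  set a := F.ℓ j x (chartD j x v)
  have h1 : v - a • w ∈ Es x := by
    rw [F.ker j hj x ⟨hxj, hx⟩, map_sub, map_sub, map_smul, map_smul, hw, smul_eq_mul, mul_one,
      sub_self]
  rw [F.ker i hi x ⟨hxi, hx⟩, map_sub, map_sub, map_smul, map_smul, sub_eq_zero] at h1
  rw [h1, norm_smul, mul_comm]
  have := F.K_pos
  gcongr
  calc _ ≤ F.K ^ 2 * N x w := F.norm_ℓ_chartD_le hi hxi hx w
    _ ≤ F.K ^ 2 * F.K ^ 2 := by gcongr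
    _ = _ := by ring

lemma exists_ehat : ∃ w : U → E, ∀ x ∈ A, F.m x (w x) = 1 ∧ N x (w x) ≤ F.K ^ 2 := by
  have h : ∀ x : U, ∃ w : E, x ∈ A → F.m x w = 1 ∧ N x w ≤ F.K ^ 2 := by
    intro x
    by_cases hx : x ∈ A
    · obtain ⟨w, hw⟩ := F.exists_vec (F.c_mem x hx) (F.mem_W hx) hx
      exact ⟨w, fun _ => hw⟩
    · exact ⟨0, fun h => absurd h hx⟩
  choose w hw using h
  exact ⟨w, hw⟩

/-- Vectors transverse to `Es`, normalised by the transverse functional. -/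
def ehat : U → E := F.exists_ehat.choose

lemma m_ehat {x : U} (hx : x ∈ A) : F.m x (F.ehat x) = 1 := (F.exists_ehat.choose_spec x hx).1

lemma N_ehat {x : U} (hx : x ∈ A) : N x (F.ehat x) ≤ F.K ^ 2 := (F.exists_ehat.choose_spec x hx).2

end FrameAtlas

/-! ### The transverse cocycle and its continuity -/

section Cocycle

variable {E : Type*} [NormedAddCommGroup E] [NormedSpace ℂ E]
variable {U : Type*} [MetricSpace U] [ChartedSpace E U]

/-- `G` preserves `A`, is analytic near `A`, and preserves the family of subspaces `Es`. -/
structure InvMap (A : Set U) (Es : U → Submodule ℂ E) (G : U → U) : Prop where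
  maps : MapsTo G A A
  smooth : ∀ x ∈ A, ContMDiffAt 𝓘(ℂ, E) 𝓘(ℂ, E) ω G x
  inv : ∀ x ∈ A, ∀ v ∈ Es x, tanD E G x v ∈ Es (G x)

namespace InvMap

variable {A : Set U} {Es : U → Submodule ℂ E} {L : U → U}

lemma tanD_zero (x : U) (v : E) : tanD E L^[0] x v = v := by
  have : mfderiv 𝓘(ℂ, E) 𝓘(ℂ, E) (id : U → U) x = ContinuousLinearMap.id ℂ _ := mfderiv_id
  exact DFunLike.congr_fun this v

lemma smooth_iterate (h : InvMap A Es L) (n : ℕ) {x : U} (hx : x ∈ A) :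
    ContMDiffAt 𝓘(ℂ, E) 𝓘(ℂ, E) ω L^[n] x := by
  induction n generalizing x with
  | zero => exact contMDiffAt_id
  | succ n ih =>
    rw [Function.iterate_succ]
    exact ContMDiffAt.comp (g := L^[n]) x (ih (h.maps hx)) (h.smooth x hx)

lemma tanD_add (h : InvMap A Es L) (n k : ℕ) {x : U} (hx : x ∈ A) (v : E) :
    tanD E L^[n + k] x v = tanD E L^[n] (L^[k] x) (tanD E L^[k] x v) := by
  have hω : (ω : WithTop ℕ∞) ≠ 0 := by simp
  have h1 := mfderiv_comp x
    ((h.smooth_iterate n (h.maps.iterate k hx)).mdifferentiableAt hω)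
    ((h.smooth_iterate k hx).mdifferentiableAt hω)
  rw [← Function.iterate_add] at h1
  exact DFunLike.congr_fun h1 v

lemma iterate (h : InvMap A Es L) (n : ℕ) : InvMap A Es L^[n] where
  maps := h.maps.iterate n
  smooth := fun _ hx => h.smooth_iterate n hx
  inv := by
    induction n with
    | zero => intro x _ v hv; rwa [tanD_zero]
    | succ n ih =>
      intro x hx v hv
      rw [add_comm, h.tanD_add 1 n hx, Function.iterate_add_apply]
      exact h.inv _ (h.maps.iterate n hx) _ (ih x hx v hv)

end InvMap

end Cocycle

namespace FrameAtlas

variable {E : Type*} [NormedAddCommGroup E] [NormedSpace ℂ E]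
variable {U : Type*} [MetricSpace U] [ChartedSpace E U] [IsManifold 𝓘(ℂ, E) ω U]
variable {N : U → Seminorm ℂ E} {A : Set U} {Es : U → Submodule ℂ E} (F : FrameAtlas N A Es)
  {L : U → U}

/-- The cocycle induced by the iterates of `L` on the quotient by `Es`. -/
def lam (L : U → U) (n : ℕ) (x : U) : ℂ := F.m (L^[n] x) (tanD E L^[n] x (F.ehat x))

/-- Subtracting `m x v • ehat x` puts `v` in `Es x`, which the differential maps into `Es`; modulo
`Es` only the image of `ehat x` remains. -/
lemma lam_spec (h : InvMap A Es L) (n : ℕ) {x : U} (hx : x ∈ A) (v : E) :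
    F.m (L^[n] x) (tanD E L^[n] x v) = F.lam L n x * F.m x v := by
  have h1 : v - F.m x v • F.ehat x ∈ Es x := by
    rw [F.mem_Es_iff hx, map_sub, map_smul, F.m_ehat hx, smul_eq_mul, mul_one, sub_self]
  have h2 := (h.iterate n).inv x hx _ h1
  rw [F.mem_Es_iff ((h.iterate n).maps hx), map_sub, map_sub, map_smul, map_smul, sub_eq_zero] at h2
  rw [h2, lam, smul_eq_mul, mul_comm]

lemma lam_add (h : InvMap A Es L) (n k : ℕ) {x : U} (hx : x ∈ A) :
    F.lam L (n + k) x = F.lam L n (L^[k] x) * F.lam L k x := by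
  have h1 := F.lam_spec h n (h.maps.iterate k hx) (tanD E L^[k] x (F.ehat x))
  rw [lam, h.tanD_add n k hx, Function.iterate_add_apply, h1]
  rfl

lemma lam_zero {x : U} (hx : x ∈ A) : F.lam L 0 x = 1 := by
  rw [lam, InvMap.tanD_zero]
  exact F.m_ehat hx

lemma lam_iterate (m n : ℕ) (x : U) :
    F.lam L^[m] n x = F.lam L (m * n) x := by
  rw [lam, lam, Function.iterate_mul]

lemma lam_eq_prod (h : InvMap A Es L) (n : ℕ) {x : U} (hx : x ∈ A) :
    F.lam L n x = ∏ k ∈ Finset.range n, F.lam L 1 (L^[k] x) := by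
  induction n with
  | zero => simp [F.lam_zero hx]
  | succ n ih => rw [Finset.prod_range_succ, add_comm, F.lam_add h 1 n hx, ih, mul_comm]

lemma ℓ_tanD {G : U → U} (h : InvMap A Es G) {i j x : U} (hx : x ∈ A) (hi : i ∈ F.t) (hj : j ∈ F.t)
    (hxi : x ∈ F.W i) (hxj : G x ∈ F.W j) (v : E) :
    F.ℓ j (G x) (chartD j (G x) (tanD E G x v)) = F.lamIJ G i j x * F.ℓ i x (chartD i x v) := by
  rw [← F.Tij_chartD hi hj hxi hxj (h.smooth x hx), F.ℓ_Tij h.maps h.inv hx hi hj hxi hxj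
    (h.smooth x hx)]

lemma lam_one_eq {G : U → U} (h : InvMap A Es G) {x : U} (hx : x ∈ A) :
    F.lam G 1 x = F.lamIJ G (F.c x) (F.c (G x)) x := by
  have h1 := F.ℓ_tanD h hx (F.c_mem x hx) (F.c_mem _ (h.maps hx)) (F.mem_W hx)
    (F.mem_W (h.maps hx)) (F.ehat x)
  have h2 : F.ℓ (F.c x) x (chartD (F.c x) x (F.ehat x)) = 1 := F.m_ehat hx
  rw [h2, mul_one] at h1
  exact h1

/-- Uniform upper bounds for the differential. -/
lemma exists_upper (hA : IsCompact A) {G : U → U} {O : Set U} (hO : IsOpen O) (hAO : A ⊆ O)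
    (hGO : ContMDiffOn 𝓘(ℂ, E) 𝓘(ℂ, E) ω G O) (h : InvMap A Es G) :
    ∃ B : ℝ, 1 ≤ B ∧ ∀ x ∈ A, (∀ v, N (G x) (tanD E G x v) ≤ B * N x v) ∧ ‖F.lam G 1 x‖ ≤ B := by
  obtain ⟨C, hC⟩ := F.exists_strict hA hO hAO hGO h.maps
  have hK := F.one_le_K
  have hK0 := F.K_pos
  have hC0 : 0 ≤ |C| := abs_nonneg C
  refine ⟨1 + F.K ^ 6 * |C|, by have := mul_nonneg (pow_nonneg hK0.le 6) hC0; linarith,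
    fun x hx => ?_⟩
  have hT : ‖Tij (E := E) G (F.c x) (F.c (G x)) x‖ ≤ |C| := (hC x hx).2.1.trans (le_abs_self C)
  have hv : ∀ v, N (G x) (tanD E G x v) ≤ F.K ^ 2 * |C| * N x v := by
    intro v
    have hGx := h.maps hx
    calc _ ≤ F.K * ‖chartD (F.c (G x)) (G x) (tanD E G x v)‖ :=
          (F.norm _ (F.c_mem _ hGx) _ ⟨F.mem_W hGx, hGx⟩ _).1
      _ = F.K * ‖Tij G (F.c x) (F.c (G x)) x (chartD (F.c x) x v)‖ := by
          rw [F.Tij_chartD (F.c_mem _ hx) (F.c_mem _ hGx) (F.mem_W hx) (F.mem_W hGx)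
            (h.smooth x hx)]
      _ ≤ F.K * (|C| * (F.K * N x v)) := by
          gcongr
          refine (ContinuousLinearMap.le_opNorm _ _).trans ?_
          gcongr
          exact (F.norm _ (F.c_mem _ hx) _ ⟨F.mem_W hx, hx⟩ _).2
      _ = _ := by ring
  constructor
  · intro v
    refine (hv v).trans ?_
    have hN : 0 ≤ N x v := apply_nonneg _ _
    gcongr
    have : F.K ^ 2 ≤ F.K ^ 6 := pow_le_pow_right₀ hK (by norm_num)
    have := mul_le_mul_of_nonneg_right this hC0
    linarith
  · have h1 : F.lam G 1 x = F.m (G x) (tanD E G x (F.ehat x)) := rfl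
    rw [h1]
    calc _ ≤ F.K ^ 2 * N (G x) (tanD E G x (F.ehat x)) := F.norm_m_le (h.maps hx) _
      _ ≤ F.K ^ 2 * (F.K ^ 2 * |C| * F.K ^ 2) := by
          gcongr
          exact (hv _).trans (by gcongr; exact F.N_ehat hx)
      _ = F.K ^ 6 * |C| := by ring
      _ ≤ _ := by linarith

/-- Locally uniform lower bounds for the transverse cocycle. -/
lemma exists_lower (hA : IsCompact A) {G : U → U} (h : InvMap A Es G)
    (h0 : ∀ x ∈ A, F.lam G 1 x ≠ 0) : ∃ b : ℝ, ∀ x ∈ A, 1 ≤ b * ‖F.lam G 1 x‖ := by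
  have := F.exists_uniform hA (fun x hx => (h.smooth x hx).continuousAt) h.maps
    (p := fun i j x C => 1 ≤ C * ‖F.lamIJ G i j x‖)
    (fun i j x C C' hC h1 => h1.trans (by gcongr)) ?_
  · obtain ⟨b, hb⟩ := this
    exact ⟨b, fun x hx => by rw [F.lam_one_eq h hx]; exact hb x hx⟩
  · intro x₀ hx₀ i hi j hj hxi hxj
    have hne : F.lamIJ G i j x₀ ≠ 0 := by
      intro hz
      have h1 := F.ℓ_tanD h hx₀ hi hj hxi hxj (F.ehat x₀)
      rw [hz, zero_mul, ← F.ker j hj _ ⟨hxj, h.maps hx₀⟩, F.mem_Es_iff (h.maps hx₀)] at h1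
      exact h0 x₀ hx₀ h1
    have hpos := norm_pos_iff.2 hne
    refine ⟨2 / ‖F.lamIJ G i j x₀‖, ?_⟩
    have hc := (F.continuousWithinAt_lamIJ h.maps hx₀ hi hj hxi hxj (h.smooth x₀ hx₀)).norm
    filter_upwards [hc.eventually (lt_mem_nhds (half_lt_self hpos))] with x hx
    have hx' : ‖F.lamIJ G i j x₀‖ / 2 < ‖F.lamIJ G i j x‖ := hx
    rw [div_mul_eq_mul_div, le_div_iff₀ hpos]
    linarith

/-- Uniform continuity of the transverse cocycle, read in the frames of a reference point. -/
lemma exists_lam_close (hA : IsCompact A) {G : U → U} (h : InvMap A Es G)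
    (h0 : ∀ x ∈ A, F.lam G 1 x ≠ 0) {δ : ℝ} (hδ : 0 < δ) :
    ∃ η : ℝ, 0 < η ∧ ∀ x ∈ A, ∀ y ∈ A, dist x y ≤ η →
      ‖F.lamIJ G (F.c x) (F.c (G x)) y‖ ≤ Real.exp δ * ‖F.lam G 1 x‖ := by
  have := F.exists_uniform hA (fun x hx => (h.smooth x hx).continuousAt) h.maps
    (p := fun i j x C => 0 < C ∧ ∀ y ∈ A, dist x y ≤ 1 / C →
      ‖F.lamIJ G i j y‖ ≤ Real.exp δ * ‖F.lamIJ G i j x‖)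
    (fun i j x C C' hC h1 => ⟨h1.1.trans_le hC, fun y hy hxy => h1.2 y hy
      (hxy.trans (one_div_le_one_div_of_le h1.1 hC))⟩) ?_
  · obtain ⟨C, hC⟩ := this
    rcases A.eq_empty_or_nonempty with rfl | ⟨a, ha⟩
    · exact ⟨1, one_pos, by simp⟩
    · exact ⟨1 / C, one_div_pos.2 (hC a ha).1, fun x hx y hy hxy => by
        rw [F.lam_one_eq h hx]; exact (hC x hx).2 y hy hxy⟩
  · intro x₀ hx₀ i hi j hj hxi hxj
    have hne : F.lamIJ G i j x₀ ≠ 0 := by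
      intro hz
      have h1 := F.ℓ_tanD h hx₀ hi hj hxi hxj (F.ehat x₀)
      rw [hz, zero_mul, ← F.ker j hj _ ⟨hxj, h.maps hx₀⟩, F.mem_Es_iff (h.maps hx₀)] at h1
      exact h0 x₀ hx₀ h1
    set a := ‖F.lamIJ G i j x₀‖
    have hpos : 0 < a := norm_pos_iff.2 hne
    have hc := (F.continuousWithinAt_lamIJ h.maps hx₀ hi hj hxi hxj (h.smooth x₀ hx₀)).norm
    have e1 : a < Real.exp (δ / 2) * a := lt_mul_left hpos (Real.one_lt_exp_iff.2 (half_pos hδ))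
    have e2 : Real.exp (-(δ / 2)) * a < a :=
      mul_lt_of_lt_one_left hpos (Real.exp_lt_one_iff.2 (by linarith))
    obtain ⟨ρ, hρ, hball⟩ := Metric.mem_nhdsWithin_iff.1
      ((hc.eventually (gt_mem_nhds e1)).and (hc.eventually (lt_mem_nhds e2)))
    refine ⟨2 / ρ, ?_⟩
    filter_upwards [inter_mem_nhdsWithin A (Metric.ball_mem_nhds x₀ (half_pos hρ))] with x hx
    have hx2 : dist x x₀ < ρ / 2 := hx.2
    refine ⟨by positivity, fun y hy hxy => ?_⟩
    rw [one_div_div] at hxy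
    have hyb : dist y x₀ < ρ := by
      rw [dist_comm] at hxy; linarith [dist_triangle y x x₀]
    have h1 := (hball ⟨hyb, hy⟩).1
    have h2 := (hball ⟨Metric.ball_subset_ball (by linarith) hx.2, hx.1⟩).2
    have h1' : ‖F.lamIJ G i j y‖ < Real.exp (δ / 2) * a := h1
    have h2' : Real.exp (-(δ / 2)) * a < ‖F.lamIJ G i j x‖ := h2
    calc _ ≤ Real.exp (δ / 2) * a := h1'.le
      _ = Real.exp δ * (Real.exp (-(δ / 2)) * a) := by
          rw [← mul_assoc, ← Real.exp_add]; congr 2; ring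
      _ ≤ _ := by gcongr

/-- Lower semicontinuity of the cocycle up to a uniform factor. -/
lemma eventually_lt_lam {G : U → U} (h : InvMap A Es G) {x₀ : U} (hx₀ : x₀ ∈ A) {a : ℝ}
    (ha : a < ‖F.lam G 1 x₀‖) : ∀ᶠ x in 𝓝[A] x₀, a < F.K ^ 8 * ‖F.lam G 1 x‖ := by
  have hi := F.c_mem x₀ hx₀
  have hG₀ := h.maps hx₀
  have hj := F.c_mem _ hG₀
  have hc := (F.continuousWithinAt_lamIJ h.maps hx₀ hi hj (F.mem_W hx₀) (F.mem_W hG₀)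
    (h.smooth x₀ hx₀)).norm
  rw [F.lam_one_eq h hx₀] at ha
  have hGc : ∀ᶠ x in 𝓝[A] x₀, G x ∈ F.W (F.c (G x₀)) :=
    nhdsWithin_le_nhds ((h.smooth x₀ hx₀).continuousAt.eventually
      ((F.isOpen _ hj).eventually_mem (F.mem_W hG₀)))
  filter_upwards [hc.eventually (lt_mem_nhds ha), hGc, self_mem_nhdsWithin,
    nhdsWithin_le_nhds ((F.isOpen _ hi).mem_nhds (F.mem_W hx₀))] with x h1 h2 hxA hxi
  refine h1.trans_le ?_
  have hGx := h.maps hxA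
  have hK := F.K_pos
  -- Continuity is known in the frames of `x₀` and `G x₀`; replacing them by those chosen at `x` and
  -- `G x` costs `K ^ 4` at each end.
  have e1 := F.ℓ_tanD h hxA hi hj hxi h2 (F.ehat x)
  have e2 := F.norm_ℓ_comparable hj (F.c_mem _ hGx) h2 (F.mem_W hGx) hGx (tanD E G x (F.ehat x))
  have e3 := F.norm_ℓ_comparable (F.c_mem _ hxA) hi (F.mem_W hxA) hxi hxA (F.ehat x)
  have e4 : ‖F.ℓ (F.c x) x (chartD (F.c x) x (F.ehat x))‖ = 1 := by
    have : F.ℓ (F.c x) x (chartD (F.c x) x (F.ehat x)) = 1 := F.m_ehat hxA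
    rw [this, norm_one]
  have e5 : ‖F.ℓ (F.c (G x)) (G x) (chartD (F.c (G x)) (G x) (tanD E G x (F.ehat x)))‖ =
      ‖F.lam G 1 x‖ := rfl
  rw [e1, norm_mul, e5] at e2
  rw [e4] at e3
  have e6 := mul_le_mul_of_nonneg_left e3 (norm_nonneg (F.lamIJ G (F.c x₀) (F.c (G x₀)) x))
  calc _ ≤ ‖F.lamIJ G (F.c x₀) (F.c (G x₀)) x‖ *
        (F.K ^ 4 * ‖F.ℓ (F.c x₀) x (chartD (F.c x₀) x (F.ehat x))‖) := by linarith
    _ = F.K ^ 4 * (‖F.lamIJ G (F.c x₀) (F.c (G x₀)) x‖ *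
        ‖F.ℓ (F.c x₀) x (chartD (F.c x₀) x (F.ehat x))‖) := by ring
    _ ≤ F.K ^ 4 * (F.K ^ 4 * ‖F.lam G 1 x‖) := by gcongr
    _ = _ := by ring

end FrameAtlas

/-! ### Growth of the cocycle: specification and the expansion alternative -/

namespace FrameAtlas

variable {E : Type*} [NormedAddCommGroup E] [NormedSpace ℂ E]
variable {U : Type*} [MetricSpace U] [ChartedSpace E U] [IsManifold 𝓘(ℂ, E) ω U]
variable {N : U → Seminorm ℂ E} {A : Set U} {Es : U → Submodule ℂ E} (F : FrameAtlas N A Es)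
  {L : U → U}

/-- Two-sided bounds for the transverse cocycle and an upper bound for the differential. -/
structure Bounds (F : FrameAtlas N A Es) (L : U → U) (B : ℝ) : Prop where
  one_le : 1 ≤ B
  tanD_le : ∀ x ∈ A, ∀ v, N (L x) (tanD E L x v) ≤ B * N x v
  lam_le : ∀ x ∈ A, ‖F.lam L 1 x‖ ≤ B
  le_lam : ∀ x ∈ A, 1 ≤ B * ‖F.lam L 1 x‖

lemma exists_bounds (hA : IsCompact A) {O : Set U} (hO : IsOpen O) (hAO : A ⊆ O)
    (hLO : ContMDiffOn 𝓘(ℂ, E) 𝓘(ℂ, E) ω L O) (h : InvMap A Es L)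
    (h0 : ∀ x ∈ A, F.lam L 1 x ≠ 0) : ∃ B, F.Bounds L B := by
  obtain ⟨B, hB, hB'⟩ := F.exists_upper hA hO hAO hLO h
  obtain ⟨b, hb⟩ := F.exists_lower hA h h0
  exact ⟨max B b, hB.trans (le_max_left _ _),
    fun x hx v => ((hB' x hx).1 v).trans
      (mul_le_mul_of_nonneg_right (le_max_left _ _) (apply_nonneg _ _)),
    fun x hx => (hB' x hx).2.trans (le_max_left _ _),
    fun x hx => (hb x hx).trans (by gcongr; exact le_max_right _ _)⟩

variable {F}

lemma Bounds.ne_zero {B : ℝ} (hB : F.Bounds L B) {x : U} (hx : x ∈ A) : F.lam L 1 x ≠ 0 := by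
  intro h
  have := hB.le_lam x hx
  rw [h, norm_zero, mul_zero] at this
  linarith

lemma Bounds.lam_iter_le {B : ℝ} (hB : F.Bounds L B) (h : InvMap A Es L) (n : ℕ) {x : U}
    (hx : x ∈ A) : ‖F.lam L n x‖ ≤ B ^ n := by
  rw [F.lam_eq_prod h n hx, norm_prod]
  calc _ ≤ ∏ k ∈ Finset.range n, B := Finset.prod_le_prod (fun _ _ => norm_nonneg _)
        fun k _ => hB.lam_le _ (h.maps.iterate k hx)
    _ = B ^ n := by simp

lemma Bounds.le_lam_iter {B : ℝ} (hB : F.Bounds L B) (h : InvMap A Es L) (n : ℕ) {x : U}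
    (hx : x ∈ A) : 1 ≤ B ^ n * ‖F.lam L n x‖ := by
  rw [F.lam_eq_prod h n hx, norm_prod]
  calc (1 : ℝ) = ∏ k ∈ Finset.range n, (1 : ℝ) := by simp
    _ ≤ ∏ k ∈ Finset.range n, (B * ‖F.lam L 1 (L^[k] x)‖) :=
        Finset.prod_le_prod (fun _ _ => zero_le_one) fun k _ => hB.le_lam _ (h.maps.iterate k hx)
    _ = _ := by rw [Finset.prod_mul_distrib]; simp

lemma Bounds.tanD_iter_le {B : ℝ} (hB : F.Bounds L B) (h : InvMap A Es L) (n : ℕ) {x : U}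
    (hx : x ∈ A) (v : E) : N (L^[n] x) (tanD E L^[n] x v) ≤ B ^ n * N x v := by
  induction n with
  | zero => rw [InvMap.tanD_zero]; simp
  | succ n ih =>
    have e : tanD E L^[n + 1] x v = tanD E L (L^[n] x) (tanD E L^[n] x v) := by
      rw [add_comm, h.tanD_add 1 n hx]; rfl
    rw [e, Function.iterate_succ_apply', pow_succ']
    have hB0 : 0 ≤ B := zero_le_one.trans hB.one_le
    calc _ ≤ B * N (L^[n] x) (tanD E L^[n] x v) := hB.tanD_le _ (h.maps.iterate n hx) _
      _ ≤ B * (B ^ n * N x v) := by gcongr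
      _ = _ := by ring

/-- Both orbits are read in the frames chosen along the orbit of `x`. Each step loses at most `exp
δ`, and frames are changed only at the two ends, so `K ^ 8` does not accumulate with `n`. -/
lemma norm_lam_le_of_shadow (h : InvMap A Es L) {δ η : ℝ} (hη : η < F.r)
    (hclose : ∀ x ∈ A, ∀ y ∈ A, dist x y ≤ η →
      ‖F.lamIJ L (F.c x) (F.c (L x)) y‖ ≤ Real.exp δ * ‖F.lam L 1 x‖) {x y : U}
    (hx : x ∈ A) (hy : y ∈ A) {n : ℕ} (hsh : ∀ k ≤ n, dist (L^[k] x) (L^[k] y) ≤ η) :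
    ‖F.lam L n y‖ ≤ F.K ^ 8 * Real.exp (δ * n) * ‖F.lam L n x‖ := by
  have hW : ∀ k ≤ n, L^[k] y ∈ F.W (F.c (L^[k] x)) := fun k hk =>
    F.ball_subset _ (h.maps.iterate k hx)
      (by rw [Metric.mem_ball']; exact (hsh k hk).trans_lt hη)
  have hK := F.K_pos
  have key : ∀ k ≤ n, ∀ v, ‖F.ℓ (F.c (L^[k] x)) (L^[k] y)
      (chartD (F.c (L^[k] x)) (L^[k] y) (tanD E L^[k] y v))‖ ≤
      Real.exp (δ * k) * ‖F.lam L k x‖ * ‖F.ℓ (F.c x) y (chartD (F.c x) y v)‖ := by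
    intro k
    induction k with
    | zero =>
      intro _ v
      rw [InvMap.tanD_zero, F.lam_zero hx]
      simp
    | succ k ih =>
      intro hk v
      have hkx := h.maps.iterate k hx
      have hky := h.maps.iterate k hy
      have e : tanD E L^[k + 1] y v = tanD E L (L^[k] y) (tanD E L^[k] y v) := by
        rw [add_comm, h.tanD_add 1 k hy]; rfl
      have hWk := hW (k + 1) hk
      rw [Function.iterate_succ_apply', Function.iterate_succ_apply'] at hWk
      rw [e, Function.iterate_succ_apply', Function.iterate_succ_apply',
        F.ℓ_tanD h hky (F.c_mem _ hkx) (F.c_mem _ (h.maps hkx)) (hW k (by omega)) hWk, norm_mul,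
        add_comm k 1, F.lam_add h 1 k hx, norm_mul]
      have h1 := hclose _ hkx _ hky (hsh k (by omega))
      have h2 := ih (by omega) v
      calc _ ≤ (Real.exp δ * ‖F.lam L 1 (L^[k] x)‖) *
            (Real.exp (δ * k) * ‖F.lam L k x‖ * ‖F.ℓ (F.c x) y (chartD (F.c x) y v)‖) := by
            gcongr
        _ = (Real.exp δ * Real.exp (δ * k)) * (‖F.lam L 1 (L^[k] x)‖ * ‖F.lam L k x‖) *
            ‖F.ℓ (F.c x) y (chartD (F.c x) y v)‖ := by ring
        _ = _ := by rw [← Real.exp_add]; push_cast; ring_nf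
  have hny := h.maps.iterate n hy
  have hnx := h.maps.iterate n hx
  have h1 := key n le_rfl (F.ehat y)
  have h2 := F.norm_ℓ_comparable (F.c_mem _ hny) (F.c_mem _ hnx) (F.mem_W hny) (hW n le_rfl) hny
    (tanD E L^[n] y (F.ehat y))
  have hW₀ : y ∈ F.W (F.c x) := hW 0 (Nat.zero_le n)
  have h3 := F.norm_ℓ_comparable (F.c_mem _ hx) (F.c_mem _ hy) hW₀
    (F.mem_W hy) hy (F.ehat y)
  have h4 : F.ℓ (F.c y) y (chartD (F.c y) y (F.ehat y)) = 1 := F.m_ehat hy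
  rw [h4, norm_one, mul_one] at h3
  calc ‖F.lam L n y‖ ≤ F.K ^ 4 * (Real.exp (δ * n) * ‖F.lam L n x‖ * F.K ^ 4) := by
        refine h2.trans ?_
        gcongr
        refine h1.trans ?_
        gcongr
    _ = _ := by ring

/-- If all periodic multipliers are at least one in absolute value then, by specification, the
transverse cocycle contracts at most subexponentially. -/
theorem exists_lam_lower (hA : IsCompact A) (h : InvMap A Es L) {B : ℝ} (hB : F.Bounds L B)
    (hspec : SpecificationOn L A)
    (hper : ∀ y ∈ A, ∀ p : ℕ, 1 ≤ p → Function.IsPeriodicPt L p y → 1 ≤ ‖F.lam L p y‖)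
    {δ : ℝ} (hδ : 0 < δ) :
    ∃ c : ℝ, 0 < c ∧ ∀ x ∈ A, ∀ n : ℕ, c * Real.exp (-(δ * n)) ≤ ‖F.lam L n x‖ := by
  obtain ⟨η₀, hη₀, hclose⟩ := F.exists_lam_close hA h (fun x hx => hB.ne_zero hx) (half_pos hδ)
  set η := min η₀ (F.r / 2)
  have hη : 0 < η := lt_min hη₀ (half_pos F.r_pos)
  have hηr : η < F.r := (min_le_right _ _).trans_lt (half_lt_self F.r_pos)
  have hclose' : ∀ x ∈ A, ∀ y ∈ A, dist x y ≤ η →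
      ‖F.lamIJ L (F.c x) (F.c (L x)) y‖ ≤ Real.exp (δ / 2) * ‖F.lam L 1 x‖ :=
    fun x hx y hy hxy => hclose x hx y hy (hxy.trans (min_le_left _ _))
  obtain ⟨l, hl⟩ := hspec η hη
  have hK := F.K_pos
  have hK1 := F.one_le_K
  have hB1 := hB.one_le
  have hB0 : 0 < B := by linarith
  -- After `n₀` steps, half of the permitted exponential loss absorbs the frame factor, so the
  -- induction can keep the same constant `c`.
  obtain ⟨n₀, hn₀⟩ : ∃ n₀ : ℕ, F.K ^ 8 ≤ Real.exp (δ / 2 * n₀) := by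
    obtain ⟨n₀, hn₀⟩ := exists_nat_ge (F.K ^ 8 / (δ / 2))
    refine ⟨n₀, ?_⟩
    rw [div_le_iff₀ (by positivity)] at hn₀
    linarith [Real.add_one_le_exp (δ / 2 * n₀)]
  set c := (B ^ (l + 1 + 2 * n₀) * F.K ^ 8)⁻¹ with hc
  have hcpos : 0 < c := by positivity
  refine ⟨c, hcpos, fun x hx n => ?_⟩
  induction n using Nat.strong_induction_on generalizing x with
  | _ n ih =>
    have hexp : Real.exp (-(δ * n)) ≤ 1 := Real.exp_le_one_iff.2 (by
      have : 0 ≤ δ * n := by positivity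
      linarith)
    by_cases hn : n ≤ 2 * n₀
    · have h1 := hB.le_lam_iter h n hx
      have h2 : B ^ n ≤ B ^ (l + 1 + 2 * n₀) * F.K ^ 8 := by
        calc B ^ n ≤ B ^ (l + 1 + 2 * n₀) := pow_le_pow_right₀ hB1 (by omega)
          _ ≤ _ := le_mul_of_one_le_right (by positivity) (one_le_pow₀ hK1)
      calc c * Real.exp (-(δ * n)) ≤ c * 1 := by gcongr
        _ ≤ ‖F.lam L n x‖ := by
          rw [mul_one, hc, inv_le_iff_one_le_mul₀ (by positivity)]
          exact h1.trans (by rw [mul_comm]; gcongr)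
    push Not at hn
    -- Length `n + 1` is needed to shadow at time `n` too, where the final frames are compared; it
    -- gives `p - n ≤ l + 1`.
    obtain ⟨y, hy, p, hp, hpl, hpy, hsh⟩ := hl (n + 1) (by omega) x hx
    have hshle : ∀ s ≤ n, ‖F.lam L s y‖ ≤ F.K ^ 8 * Real.exp (δ / 2 * s) * ‖F.lam L s x‖ :=
      fun s hs => norm_lam_le_of_shadow h hηr hclose' hx hy
        fun k hk => hsh k (Nat.lt_succ_of_le (hk.trans hs))
    rcases le_or_gt n p with hnp | hnp
    · have h1 := hper y hy p hp hpy
      have e : p = (p - n) + n := by omega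
      rw [e, F.lam_add h _ _ hy, norm_mul] at h1
      have h2 := hB.lam_iter_le h (p - n) (h.maps.iterate n hy)
      have h3 : B ^ (p - n) ≤ B ^ (l + 1 + 2 * n₀) := pow_le_pow_right₀ hB1 (by omega)
      have h4 : 1 ≤ B ^ (l + 1 + 2 * n₀) * F.K ^ 8 * (Real.exp (δ / 2 * n) * ‖F.lam L n x‖) := by
        calc (1 : ℝ) ≤ ‖F.lam L (p - n) (L^[n] y)‖ * ‖F.lam L n y‖ := h1
          _ ≤ B ^ (l + 1 + 2 * n₀) * (F.K ^ 8 * Real.exp (δ / 2 * n) * ‖F.lam L n x‖) := by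
              gcongr
              · exact h2.trans h3
              · exact hshle n le_rfl
          _ = _ := by ring
      have h5 : c ≤ Real.exp (δ / 2 * n) * ‖F.lam L n x‖ := by
        rw [hc, inv_le_iff_one_le_mul₀ (by positivity), mul_comm]; exact h4
      calc c * Real.exp (-(δ * n)) ≤ Real.exp (δ / 2 * n) * ‖F.lam L n x‖ *
            Real.exp (-(δ * n)) := by gcongr
        _ = Real.exp (-(δ / 2 * n)) * ‖F.lam L n x‖ := by
            rw [mul_right_comm, ← Real.exp_add]; congr 2; ring
        _ ≤ 1 * ‖F.lam L n x‖ := by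
            gcongr
            refine Real.exp_le_one_iff.2 ?_
            have : 0 ≤ δ / 2 * n := by positivity
            linarith
        _ = _ := one_mul _
    -- Here `s` is the last return of `y` before or at time `n`. It exceeds `n / 2`, hence `n₀`, so
    -- the initial segment satisfies a bound with constant one and the rest follows by induction.
    · set s := n / p * p with hs
      have hs1 : s ≤ n := Nat.div_mul_le_self n p
      have hdiv : 1 ≤ n / p := (Nat.one_le_div_iff (by omega)).2 hnp.le
      have hps : p ≤ s := Nat.le_mul_of_pos_left p (by omega)
      have hs2 : n < s + p := by
        have := Nat.lt_div_mul_add (a := n) (b := p) (by omega)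
        omega
      have h1 := hper y hy s (by omega) (hpy.const_mul _)
      have h2 := h1.trans (hshle s hs1)
      have h3 : F.K ^ 8 ≤ Real.exp (δ / 2 * s) := by
        refine hn₀.trans (Real.exp_le_exp.2 ?_)
        have : n₀ ≤ s := by omega
        gcongr
      have h4 : Real.exp (-(δ * s)) ≤ ‖F.lam L s x‖ := by
        have h5 : 1 ≤ Real.exp (δ * s) * ‖F.lam L s x‖ := by
          calc (1 : ℝ) ≤ F.K ^ 8 * Real.exp (δ / 2 * s) * ‖F.lam L s x‖ := h2
            _ ≤ Real.exp (δ / 2 * s) * Real.exp (δ / 2 * s) * ‖F.lam L s x‖ := by gcongr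
            _ = _ := by rw [← Real.exp_add]; congr 2; ring
        rw [Real.exp_neg, inv_le_iff_one_le_mul₀ (Real.exp_pos _), mul_comm]
        exact h5
      have h6 := ih (n - s) (by omega) _ (h.maps.iterate s hx)
      have e : n = (n - s) + s := by omega
      calc c * Real.exp (-(δ * n)) =
            c * Real.exp (-(δ * (n - s : ℕ))) * Real.exp (-(δ * s)) := by
            rw [mul_assoc, ← Real.exp_add]
            congr 2
            rw [Nat.cast_sub hs1]; ring
        _ ≤ ‖F.lam L (n - s) (L^[s] x)‖ * ‖F.lam L s x‖ := by gcongr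
        _ = ‖F.lam L n x‖ := by
            conv_rhs => rw [e, F.lam_add h _ _ hx, norm_mul]

/-- Either the transverse cocycle is uniformly expanding, or it is bounded along some orbit. -/
theorem uniform_expansion_or_bounded (hA : IsCompact A) (h : InvMap A Es L) {B : ℝ}
    (hB : F.Bounds L B) :
    (∃ c ρ : ℝ, 0 < c ∧ 1 < ρ ∧ ∀ x ∈ A, ∀ n : ℕ, c * ρ ^ n ≤ ‖F.lam L n x‖) ∨
      ∃ g ∈ A, ∀ n, ‖F.lam L n g‖ ≤ 2 * F.K ^ 8 := by
  rw [or_iff_not_imp_right]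
  intro hno
  push Not at hno
  have hK := F.K_pos
  have hB1 := hB.one_le
  -- Every point has a time when the cocycle exceeds `2 * K ^ 8`; lower semicontinuity loses `K ^
  -- 8`, so nearby points exceed 2 at the same time.
  obtain ⟨M, hM⟩ : ∃ M : ℕ, ∀ x ∈ A, x ∈ A → ∃ n ≤ M, 2 < ‖F.lam L n x‖ := by
    refine hA.induction_on (p := fun s => ∃ M : ℕ, ∀ x ∈ s, x ∈ A → ∃ n ≤ M, 2 < ‖F.lam L n x‖)
      ⟨0, by simp⟩ (fun s s' hs ⟨M, hM⟩ => ⟨M, fun x hx => hM x (hs hx)⟩) ?_ ?_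
    · rintro s s' ⟨M, hM⟩ ⟨M', hM'⟩
      refine ⟨max M M', fun x hx hxA => ?_⟩
      rcases hx with hx | hx
      · obtain ⟨n, hn, hn'⟩ := hM x hx hxA
        exact ⟨n, hn.trans (le_max_left _ _), hn'⟩
      · obtain ⟨n, hn, hn'⟩ := hM' x hx hxA
        exact ⟨n, hn.trans (le_max_right _ _), hn'⟩
    · intro g hg
      obtain ⟨n, hn⟩ := hno g hg
      have hlt : 2 * F.K ^ 8 < ‖F.lam L^[n] 1 g‖ := by rwa [F.lam_iterate, mul_one]
      refine ⟨_, F.eventually_lt_lam (h.iterate n) hg hlt, n, fun x hx _ => ⟨n, le_rfl, ?_⟩⟩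
      have hx' : 2 * F.K ^ 8 < F.K ^ 8 * ‖F.lam L^[n] 1 x‖ := hx
      rw [F.lam_iterate, mul_one, mul_comm] at hx'
      exact lt_of_mul_lt_mul_left hx' (by positivity)
  -- A block of length `k ≤ M` gains a factor 2, which is at least `ρ ^ k`; the factor `2 * B ^ M`
  -- pays for the last incomplete block.
  set ρ : ℝ := 2 ^ (1 / ((M : ℝ) + 1)) with hρ
  have hρ1 : 1 < ρ := Real.one_lt_rpow (by norm_num) (by positivity)
  have hρM : ρ ^ (M + 1) = 2 := by
    rw [hρ, ← Real.rpow_natCast, ← Real.rpow_mul (by norm_num)]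
    push_cast
    rw [one_div_mul_cancel (by positivity), Real.rpow_one]
  have hρle : ∀ n ≤ M, ρ ^ n ≤ 2 := fun n hn =>
    (pow_le_pow_right₀ hρ1.le (by omega)).trans hρM.le
  refine ⟨(2 * B ^ M)⁻¹, ρ, by positivity, hρ1, fun x hx n => ?_⟩
  induction n using Nat.strong_induction_on generalizing x with
  | _ n ih =>
    rcases le_or_gt n M with hn | hn
    · have h1 := hB.le_lam_iter h n hx
      rw [inv_mul_le_iff₀ (by positivity)]
      calc ρ ^ n ≤ 2 * 1 := by linarith [hρle n hn]
        _ ≤ 2 * (B ^ M * ‖F.lam L n x‖) := by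
            gcongr
            exact h1.trans (by gcongr)
        _ = _ := by ring
    · obtain ⟨k, hk, hk2⟩ := hM x hx hx
      have hk0 : k ≠ 0 := by
        rintro rfl
        rw [F.lam_zero hx, norm_one] at hk2
        linarith
      have h1 := ih (n - k) (by omega) _ (h.maps.iterate k hx)
      have e : n = (n - k) + k := by omega
      calc (2 * B ^ M)⁻¹ * ρ ^ n = (2 * B ^ M)⁻¹ * ρ ^ (n - k) * ρ ^ k := by
            conv_lhs => rw [e, pow_add]
            ring
        _ ≤ ‖F.lam L (n - k) (L^[k] x)‖ * ‖F.lam L k x‖ := by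
            gcongr
            exact (hρle k hk).trans hk2.le
        _ = ‖F.lam L n x‖ := by
            conv_rhs => rw [e, F.lam_add h _ _ hx, norm_mul]

end FrameAtlas

/-! ### Attracting periodic points -/

/-- A transitive set containing an attracting periodic point is the orbit of that point. -/
lemma subset_orbit_of_attracting {X : Type*} [MetricSpace X] {L : X → X} {A : Set X}
    (htrans : IsTransitiveOn L A) {g : X} (hg : g ∈ A) {n : ℕ} (hn : 1 ≤ n)
    (hcont : ∀ i, ContinuousAt L^[i] g) {s₀ : ℝ} (hs₀ : 0 < s₀)
    (hattr : ∀ y ∈ Metric.ball g s₀, dist (L^[n] y) g ≤ 1 / 2 * dist y g) :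
    ∀ y ∈ A, ∃ i < n, L^[i] g = y := by
  by_contra! hcon
  obtain ⟨y, hy, hne⟩ := hcon
  obtain ⟨ε, hε, hεle⟩ : ∃ ε > 0, ∀ i ∈ Finset.range n, ε ≤ dist (L^[i] g) y := by
    obtain ⟨i₀, hi₀, hmin⟩ := Finset.exists_min_image (Finset.range n)
      (fun i => dist (L^[i] g) y) ⟨0, Finset.mem_range.2 (by omega)⟩
    exact ⟨_, dist_pos.2 (hne i₀ (Finset.mem_range.1 hi₀)), hmin⟩
  have hev : ∀ᶠ z in 𝓝 g, ∀ i ∈ Finset.range n, dist (L^[i] z) (L^[i] g) < ε / 2 :=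
    (Filter.eventually_all_finset _).2 fun i _ =>
      (hcont i).eventually (Metric.ball_mem_nhds _ (half_pos hε))
  obtain ⟨s₁, hs₁, hball⟩ := Metric.eventually_nhds_iff_ball.1 hev
  set s := min s₀ s₁
  have hs : 0 < s := lt_min hs₀ hs₁
  obtain ⟨m, x, hx, hxm⟩ := htrans (Metric.ball g s) (Metric.ball y (ε / 2)) Metric.isOpen_ball
    Metric.isOpen_ball ⟨g, Metric.mem_ball_self hs, hg⟩
    ⟨y, Metric.mem_ball_self (half_pos hε), hy⟩
  -- The returns of `x` at multiples of `n` never leave the ball, so its whole orbit stays within `ε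
  -- / 2` of the orbit of `g` and cannot come within `ε / 2` of `y`.
  have hinv : ∀ k : ℕ, L^[n * k] x ∈ Metric.ball g s := by
    intro k
    induction k with
    | zero => exact hx.1
    | succ k ih =>
      have h1 := hattr _ (Metric.ball_subset_ball (min_le_left _ _) ih)
      rw [← Function.iterate_add_apply] at h1
      have h2 : dist (L^[n * k] x) g < s := ih
      rw [Nat.mul_succ, add_comm, Metric.mem_ball]
      have := dist_nonneg (x := L^[n * k] x) (y := g)
      linarith
  have hm : m % n < n := Nat.mod_lt _ (by omega)
  have h1 := hball _ (Metric.ball_subset_ball (min_le_right _ _) (hinv (m / n))) (m % n)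
    (Finset.mem_range.2 hm)
  rw [← Function.iterate_add_apply, Nat.mod_add_div] at h1
  have h2 := hεle (m % n) (Finset.mem_range.2 hm)
  have h3 : dist (L^[m] x) y < ε / 2 := hxm.1
  linarith [dist_triangle_left (L^[m % n] g) y (L^[m] x)]

namespace FrameAtlas

variable {E : Type*} [NormedAddCommGroup E] [NormedSpace ℂ E]
variable {U : Type*} [MetricSpace U] [ChartedSpace E U] [IsManifold 𝓘(ℂ, E) ω U]
variable {N : U → Seminorm ℂ E} {A : Set U} {Es : U → Submodule ℂ E} {F : FrameAtlas N A Es}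
  {L : U → U}

/-- The differential of `L` is uniformly contracting on `Es`. -/
def Contracts (E : Type*) [NormedAddCommGroup E] [NormedSpace ℂ E] {U : Type*}
    [MetricSpace U] [ChartedSpace E U] (N : U → Seminorm ℂ E) (A : Set U)
    (Es : U → Submodule ℂ E) (L : U → U) : Prop :=
  ∃ C q : ℝ, 0 < C ∧ 0 < q ∧ q < 1 ∧ ∀ x ∈ A, ∀ v ∈ Es x, ∀ n : ℕ,
    N (L^[n] x) (tanD E L^[n] x v) ≤ C * q ^ n * N x v

/-- At a periodic point with transverse multiplier less than one, high iterates contract the whole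
tangent space. -/
lemma exists_contracting_iterate (h : InvMap A Es L) (hc : Contracts E N A Es L) {g : U}
    (hg : g ∈ A) {p : ℕ} (hp : 1 ≤ p) (hgp : Function.IsPeriodicPt L p g)
    (hlam : ‖F.lam L p g‖ < 1) {a : ℝ} (ha : 0 < a) :
    ∃ n, p ∣ n ∧ 1 ≤ n ∧ ∀ v, N g (tanD E L^[n] g v) ≤ a * N g v := by
  obtain ⟨C, q, hC, hq0, hq1, hCq⟩ := hc
  have hK := F.K_pos
  have hlim : Tendsto (fun k : ℕ => C * q ^ k) atTop (𝓝 (C * 0)) :=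
    (tendsto_pow_atTop_nhds_zero_of_lt_one hq0.le hq1).const_mul C
  rw [mul_zero] at hlim
  obtain ⟨k, hk1, hk⟩ := ((eventually_ge_atTop 1).and
    (hlim.eventually (gt_mem_nhds (show (0 : ℝ) < 1 / 4 by norm_num)))).exists
  set n := p * k with hn
  have hkn : k ≤ n := Nat.le_mul_of_pos_left k (by omega)
  have hn4 : C * q ^ n ≤ 1 / 4 :=
    le_trans (by have := pow_le_pow_of_le_one hq0.le hq1.le hkn; gcongr) hk.le
  have hper : ∀ j, L^[n * j] g = g := fun j => by
    rw [hn, mul_assoc]; exact hgp.mul_const _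
  have hgn : L^[n] g = g := by simpa using hper 1
  set μ := F.lam L n g
  have hμ : ‖μ‖ < 1 := by
    have : ∀ k, F.lam L (p * k) g = F.lam L p g ^ k := by
      intro k
      induction k with
      | zero => simp [F.lam_zero hg]
      | succ k ih =>
        rw [Nat.mul_succ, add_comm, F.lam_add h p _ hg, ih, hgp.mul_const k, pow_succ']
    change ‖F.lam L (p * k) g‖ < 1
    rw [this, norm_pow]
    exact pow_lt_one₀ (norm_nonneg _) hlam (by omega)
  set D := tanD E L^[n] g
  set b := 1 / 4 * N g (F.ehat g) + N g (D (F.ehat g))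
  have hb : 0 ≤ b := add_nonneg (mul_nonneg (by norm_num) (apply_nonneg _ _)) (apply_nonneg _ _)
  have h1 : ∀ v, N g (D v) ≤ 1 / 4 * N g v + b * ‖F.m g v‖ := by
    intro v
    have hmem : v - F.m g v • F.ehat g ∈ Es g := by
      rw [F.mem_Es_iff hg, map_sub, map_smul, F.m_ehat hg, smul_eq_mul, mul_one, sub_self]
    have h2 := hCq g hg _ hmem n
    rw [hgn] at h2
    have h3 : N g (v - F.m g v • F.ehat g) ≤ N g v + ‖F.m g v‖ * N g (F.ehat g) := by
      rw [← map_smul_eq_mul]; exact map_sub_le_add _ _ _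
    have h4 : N g (D v) ≤ N g (D (v - F.m g v • F.ehat g)) + ‖F.m g v‖ * N g (D (F.ehat g)) := by
      rw [← map_smul_eq_mul]
      refine le_trans (le_of_eq ?_) (map_add_le_add _ _ _)
      rw [map_sub, map_smul, sub_add_cancel]
    have h5 : N g (D (v - F.m g v • F.ehat g)) ≤
        1 / 4 * (N g v + ‖F.m g v‖ * N g (F.ehat g)) :=
      h2.trans (mul_le_mul hn4 h3 (apply_nonneg _ _) (by norm_num))
    simp only [b]
    linarith
  -- The differential is triangular with respect to `Es` and the quotient. This weight on the
  -- quotient absorbs the off-diagonal term `b`, and `N + M * ‖m‖` is contracted by `θ`.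
  set M := 2 * b / (1 - ‖μ‖)
  have hμ1 : 0 < 1 - ‖μ‖ := by linarith
  have hM : 0 ≤ M := div_nonneg (by linarith) hμ1.le
  have hMb : M * (1 - ‖μ‖) = 2 * b := div_mul_cancel₀ _ hμ1.ne'
  set θ := (1 + ‖μ‖) / 2
  have hθ : θ < 1 := by simp only [θ]; linarith
  have hθ0 : 1 / 2 ≤ θ := by simp only [θ]; linarith [norm_nonneg μ]
  have hstep : ∀ v, N g (D v) + M * ‖F.m g (D v)‖ ≤ θ * (N g v + M * ‖F.m g v‖) := by
    intro v
    have h2 := F.lam_spec h n hg v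
    rw [hgn] at h2
    have h3 : ‖F.m g (D v)‖ = ‖μ‖ * ‖F.m g v‖ := by rw [← norm_mul, ← h2]
    rw [h3]
    have h4 := h1 v
    have h5 : 0 ≤ N g v := apply_nonneg _ _
    have h6 : θ * M = M * ‖μ‖ + b := by simp only [θ]; linarith
    have h7 : 1 / 4 * N g v ≤ θ * N g v := by gcongr; linarith
    calc _ ≤ 1 / 4 * N g v + b * ‖F.m g v‖ + M * (‖μ‖ * ‖F.m g v‖) := by gcongr
      _ ≤ θ * N g v + (M * ‖μ‖ + b) * ‖F.m g v‖ := by linarith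
      _ = _ := by rw [← h6]; ring
  have hiter : ∀ j v, N g (tanD E L^[n * j] g v) ≤ θ ^ j * (N g v + M * ‖F.m g v‖) := by
    have : ∀ j v, N g (tanD E L^[n * j] g v) + M * ‖F.m g (tanD E L^[n * j] g v)‖ ≤
        θ ^ j * (N g v + M * ‖F.m g v‖) := by
      intro j v
      induction j with
      | zero => rw [mul_zero, InvMap.tanD_zero]; simp
      | succ j ih =>
        have e : tanD E L^[n * (j + 1)] g v = D (tanD E L^[n * j] g v) := by
          rw [Nat.mul_succ, add_comm, h.tanD_add n _ hg, hper]
        rw [e]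
        calc _ ≤ θ * (N g (tanD E L^[n * j] g v) + M * ‖F.m g (tanD E L^[n * j] g v)‖) := hstep _
          _ ≤ θ * (θ ^ j * (N g v + M * ‖F.m g v‖)) := mul_le_mul_of_nonneg_left ih (by linarith)
          _ = _ := by ring
    intro j v
    have h2 := this j v
    have h3 : 0 ≤ M * ‖F.m g (tanD E L^[n * j] g v)‖ := by positivity
    linarith
  have hlim2 : Tendsto (fun j : ℕ => θ ^ j * (1 + M * F.K ^ 2)) atTop
      (𝓝 (0 * (1 + M * F.K ^ 2))) :=
    (tendsto_pow_atTop_nhds_zero_of_lt_one (by linarith) hθ).mul_const _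
  rw [zero_mul] at hlim2
  obtain ⟨j, hj1, hj⟩ := ((eventually_ge_atTop 1).and (hlim2.eventually (gt_mem_nhds ha))).exists
  refine ⟨n * j, Dvd.dvd.mul_right (Dvd.intro _ rfl) j, ?_, fun v => ?_⟩
  · exact Nat.mul_pos (Nat.mul_pos (by omega) (by omega)) (by omega)
  · have hθpos : 0 < θ := by linarith
    have hN : 0 ≤ N g v := apply_nonneg _ _
    calc _ ≤ θ ^ j * (N g v + M * ‖F.m g v‖) := hiter j v
      _ ≤ θ ^ j * (N g v + M * (F.K ^ 2 * N g v)) := by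
          gcongr; exact F.norm_m_le hg v
      _ = θ ^ j * (1 + M * F.K ^ 2) * N g v := by ring
      _ ≤ _ := by gcongr

/-- A fixed point at which the differential is strongly contracting is attracting. -/
lemma exists_attracting_ball {G : U → U} (h : InvMap A Es G) {g : U} (hg : g ∈ A) (hGg : G g = g)
    (hc : ∀ v, N g (tanD E G g v) ≤ 1 / (4 * F.K ^ 4) * N g v) :
    ∃ s : ℝ, 0 < s ∧ ∀ y ∈ Metric.ball g s, dist (G y) g ≤ 1 / 2 * dist y g := by
  have hK := F.K_pos
  have hi := F.c_mem g hg
  have hW := F.mem_W hg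
  have hj : F.c g ∈ F.t := hi
  have hGW : G g ∈ F.W (F.c g) := by rw [hGg]; exact hW
  have hs := h.smooth g hg
  set φ := chartAt E (F.c g)
  set T := Tij (E := E) G (F.c g) (F.c g) g with hT
  obtain ⟨Θ, hΘ⟩ := exists_equiv_chartDeriv (F.mem_source hg)
  -- Of the factor `K ^ 4`, half is spent here on comparing `N` with the chart norm and half later
  -- on comparing the chart norm with the distance.
  have hTle : ∀ w, ‖T w‖ ≤ 1 / (4 * F.K ^ 2) * ‖w‖ := by
    intro w
    have h1 := F.Tij_chartD hi hj hW hGW hs (Θ.symm w)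
    rw [← hΘ, ContinuousLinearEquiv.apply_symm_apply, hGg] at h1
    have h2 := (F.norm _ hi g ⟨hW, hg⟩ (tanD E G g (Θ.symm w))).2
    have h3 := (F.norm _ hi g ⟨hW, hg⟩ (Θ.symm w)).1
    rw [← hΘ (Θ.symm w), ContinuousLinearEquiv.apply_symm_apply] at h3
    rw [hT, h1]
    calc _ ≤ F.K * N g (tanD E G g (Θ.symm w)) := h2
      _ ≤ F.K * (1 / (4 * F.K ^ 4) * (F.K * ‖w‖)) := by
          gcongr
          exact (hc _).trans (by gcongr)
      _ = _ := by field_simp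
  have hd : HasFDerivAt (readMap E G (F.c g) (F.c g)) T (φ g) :=
    ((contDiffAt_readMap (F.subset _ hi hW) (F.subset _ hj hGW) hs).differentiableAt
      (by simp)).hasFDerivAt
  have hlo := (hasFDerivAt_iff_isLittleO.1 hd).bound (show 0 < 1 / (4 * F.K ^ 2) by positivity)
  have hφc : ContinuousAt φ g := φ.continuousAt (F.subset _ hi hW)
  have hGc : ∀ᶠ y in 𝓝 g, G y ∈ F.W (F.c g) :=
    hs.continuousAt.eventually ((F.isOpen _ hi).eventually_mem hGW)
  obtain ⟨s, hs0, hball⟩ := Metric.eventually_nhds_iff_ball.1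
    ((hφc.eventually hlo).and (hGc.and ((F.isOpen _ hi).eventually_mem hW)))
  refine ⟨s, hs0, fun y hy => ?_⟩
  obtain ⟨h1, h2, h3⟩ := hball y hy
  have e1 : readMap E G (F.c g) (F.c g) (φ y) = φ (G y) := by
    rw [readMap, φ.left_inv (F.subset _ hi h3)]
  have e2 : readMap E G (F.c g) (F.c g) (φ g) = φ g := by
    rw [readMap, φ.left_inv (F.subset _ hi hW), hGg]
  rw [e1, e2] at h1
  have h4 : ‖φ (G y) - φ g‖ ≤ 1 / (2 * F.K ^ 2) * ‖φ y - φ g‖ := by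
    have h5 := norm_add_le (T (φ y - φ g)) (φ (G y) - φ g - T (φ y - φ g))
    rw [add_sub_cancel] at h5
    have h6 := hTle (φ y - φ g)
    calc _ ≤ 1 / (4 * F.K ^ 2) * ‖φ y - φ g‖ + 1 / (4 * F.K ^ 2) * ‖φ y - φ g‖ := by linarith
      _ = _ := by field_simp; ring
  calc dist (G y) g ≤ F.K * ‖φ (G y) - φ g‖ := (F.bilip _ hi _ h2 _ hW).1
    _ ≤ F.K * (1 / (2 * F.K ^ 2) * (F.K * dist y g)) := by
        gcongr
        refine h4.trans ?_
        gcongr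
        exact (F.bilip _ hi _ h3 _ hW).2
    _ = _ := by field_simp

/-- If some periodic point is transversally attracting then the differential is uniformly
contracting on the whole tangent bundle over `A`. -/
theorem contracts_top_of_attracting (h : InvMap A Es L) (hc : Contracts E N A Es L) {B : ℝ}
    (hB : F.Bounds L B) (htrans : IsTransitiveOn L A) {g : U} (hg : g ∈ A) {p : ℕ} (hp : 1 ≤ p)
    (hgp : Function.IsPeriodicPt L p g) (hlam : ‖F.lam L p g‖ < 1) :
    Contracts E N A (fun _ => ⊤) L := by
  have hK := F.K_pos
  have hB1 := hB.one_le
  have hB0 : 0 < B := by linarith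
  have horb : ∀ x ∈ A, ∃ i < p, L^[i] g = x := by
    obtain ⟨n, ⟨k, rfl⟩, hn1, hn⟩ := F.exists_contracting_iterate h hc hg hp hgp hlam
      (show 0 < 1 / (4 * F.K ^ 4) by positivity)
    have hfix : L^[p * k] g = g := hgp.mul_const k
    obtain ⟨s, hs, hs'⟩ := F.exists_attracting_ball (h.iterate _) hg hfix hn
    intro x hx
    obtain ⟨i, -, rfl⟩ := subset_orbit_of_attracting htrans hg hn1
      (fun i => ((h.iterate i).smooth g hg).continuousAt) hs hs' x hx
    refine ⟨i % p, Nat.mod_lt _ (by omega), hgp.iterate_mod_apply i⟩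
  -- Contraction at `g` is transported around the orbit: reaching `g` and coming back costs at most
  -- `B ^ p`, so a factor `1 / (2 * B ^ p)` at `g` leaves 1/2 everywhere.
  obtain ⟨n, ⟨k, rfl⟩, hn1, hn⟩ := F.exists_contracting_iterate h hc hg hp hgp hlam
    (show 0 < 1 / (2 * B ^ p) by positivity)
  have hfix : L^[p * k] g = g := hgp.mul_const k
  set d := p + p * k with hd
  have hstep : ∀ x ∈ A, L^[d] x = x ∧ ∀ v, N x (tanD E L^[d] x v) ≤ 1 / 2 * N x v := by
    intro x hx
    obtain ⟨i, hi, rfl⟩ := horb x hx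
    have e1 : L^[p - i] (L^[i] g) = g := by
      rw [← Function.iterate_add_apply, Nat.sub_add_cancel hi.le]; exact hgp
    have e2 : d = i + (p * k + (p - i)) := by omega
    have e3 : L^[d] (L^[i] g) = L^[i] g := by
      rw [e2, Function.iterate_add_apply, Function.iterate_add_apply, e1, hfix]
    refine ⟨e3, fun v => ?_⟩
    have h1 : tanD E L^[d] (L^[i] g) v =
        tanD E L^[i] g (tanD E L^[p * k] g (tanD E L^[p - i] (L^[i] g) v)) := by
      rw [e2, h.tanD_add _ _ hx, h.tanD_add _ _ hx, Function.iterate_add_apply, e1, hfix]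
    have h2 := hB.tanD_iter_le h (p - i) hx v
    rw [e1] at h2
    rw [h1]
    have hN : 0 ≤ N (L^[i] g) v := apply_nonneg _ _
    calc _ ≤ B ^ i * N g (tanD E L^[p * k] g (tanD E L^[p - i] (L^[i] g) v)) :=
          hB.tanD_iter_le h i hg _
      _ ≤ B ^ i * (1 / (2 * B ^ p) * (B ^ (p - i) * N (L^[i] g) v)) := by
          gcongr
          exact (hn _).trans (by gcongr)
      _ = 1 / (2 * B ^ p) * (B ^ i * B ^ (p - i)) * N (L^[i] g) v := by ring
      _ = _ := by
          rw [← pow_add, Nat.add_sub_cancel' hi.le]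
          field_simp
  have hd0 : 0 < d := by omega
  set q : ℝ := (1 / 2) ^ (1 / (d : ℝ)) with hq
  have hq0 : 0 < q := by positivity
  have hd0' : (0 : ℝ) < d := Nat.cast_pos.2 hd0
  have hq1 : q < 1 := Real.rpow_lt_one (by norm_num) (by norm_num) (by positivity)
  have hqd : q ^ d = 1 / 2 := by
    rw [hq, ← Real.rpow_natCast, ← Real.rpow_mul (by norm_num), one_div_mul_cancel hd0'.ne',
      Real.rpow_one]
  refine ⟨2 * B ^ d, q, by positivity, hq0, hq1, fun x hx v _ n => ?_⟩
  have hN : 0 ≤ N x v := apply_nonneg _ _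
  have hmul : ∀ j, L^[d * j] x = x ∧ N x (tanD E L^[d * j] x v) ≤ (1 / 2) ^ j * N x v := by
    intro j
    induction j with
    | zero => exact ⟨rfl, by rw [mul_zero, InvMap.tanD_zero]; simp⟩
    | succ j ih =>
      rw [Nat.mul_succ, add_comm, Function.iterate_add_apply, ih.1, h.tanD_add _ _ hx, ih.1,
        pow_succ', mul_assoc]
      exact ⟨(hstep x hx).1, ((hstep x hx).2 _).trans (by gcongr; exact ih.2)⟩
  have e : n = n % d + d * (n / d) := (Nat.mod_add_div n d).symm
  have hmod : n % d < d := Nat.mod_lt _ hd0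
  obtain ⟨h1, h2⟩ := hmul (n / d)
  have h3 : tanD E L^[n] x v = tanD E L^[n % d] x (tanD E L^[d * (n / d)] x v) := by
    conv_lhs => rw [e, h.tanD_add _ _ hx, h1]
  have h4 : L^[n] x = L^[n % d] x := by
    conv_lhs => rw [e, Function.iterate_add_apply, h1]
  have h5 : (1 / 2 : ℝ) ^ (n / d) ≤ 2 * q ^ n := by
    have : q ^ d ≤ q ^ (n % d) := pow_le_pow_of_le_one hq0.le hq1.le hmod.le
    rw [hqd] at this
    calc (1 / 2 : ℝ) ^ (n / d) = 2 * (1 / 2 * q ^ (d * (n / d))) := by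
          rw [pow_mul, hqd]; ring
      _ ≤ 2 * (q ^ (n % d) * q ^ (d * (n / d))) := by gcongr
      _ = 2 * q ^ n := by rw [← pow_add, Nat.mod_add_div]
  rw [h3, h4]
  calc _ ≤ B ^ (n % d) * N x (tanD E L^[d * (n / d)] x v) := hB.tanD_iter_le h _ hx _
    _ ≤ B ^ d * ((2 * q ^ n) * N x v) := by
        gcongr
        exact h2.trans (by gcongr)
    _ = _ := by ring

end FrameAtlas

/-! ### Unstable directions along backward orbits -/

lemma iterate_backward {X : Type*} {L : X → X} {y : ℕ → X} (hyL : ∀ n, L (y (n + 1)) = y n) (n : ℕ) :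
    L^[n] (y n) = y 0 := by
  induction n with
  | zero => rfl
  | succ n ih => rw [Function.iterate_succ_apply, hyL, ih]

namespace FrameAtlas

variable {E : Type*} [NormedAddCommGroup E] [NormedSpace ℂ E]
variable {U : Type*} [MetricSpace U] [ChartedSpace E U] [IsManifold 𝓘(ℂ, E) ω U]
variable {N : U → Seminorm ℂ E} {A : Set U} {Es : U → Submodule ℂ E} (F : FrameAtlas N A Es)
  {L : U → U}

lemma exists_norm_equiv (F : FrameAtlas N A Es) {x : U} (hx : x ∈ A) :
    ∃ κ : ℝ, 0 ≤ κ ∧ ∀ v : E, ‖v‖ ≤ κ * N x v ∧ N x v ≤ κ * ‖v‖ := by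
  have hK := F.K_pos
  obtain ⟨Θ, hΘ⟩ := exists_equiv_chartDeriv (F.mem_source hx)
  have hn := F.norm _ (F.c_mem x hx) x ⟨F.mem_W hx, hx⟩
  refine ⟨F.K * (‖(Θ.symm : E →L[ℂ] E)‖ + ‖(Θ : E →L[ℂ] E)‖), by positivity, fun v => ?_⟩
  have hN : 0 ≤ N x v := apply_nonneg _ _
  have hv := norm_nonneg v
  have h1 : 0 ≤ ‖(Θ.symm : E →L[ℂ] E)‖ := norm_nonneg _
  have h2 : 0 ≤ ‖(Θ : E →L[ℂ] E)‖ := norm_nonneg _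
  constructor
  · have h3 : ‖v‖ ≤ ‖(Θ.symm : E →L[ℂ] E)‖ * ‖Θ v‖ := by
      simpa using (Θ.symm : E →L[ℂ] E).le_opNorm (Θ v)
    rw [hΘ] at h3
    calc _ ≤ ‖(Θ.symm : E →L[ℂ] E)‖ * (F.K * N x v) :=
          h3.trans (mul_le_mul_of_nonneg_left (hn v).2 h1)
      _ ≤ _ := by nlinarith [mul_nonneg hK.le hN, mul_nonneg (mul_nonneg hK.le hN) h2]
  · have h3 : ‖Θ v‖ ≤ ‖(Θ : E →L[ℂ] E)‖ * ‖v‖ := (Θ : E →L[ℂ] E).le_opNorm v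
    rw [hΘ] at h3
    calc _ ≤ F.K * (‖(Θ : E →L[ℂ] E)‖ * ‖v‖) :=
          (hn v).1.trans (mul_le_mul_of_nonneg_left h3 hK.le)
      _ ≤ _ := by nlinarith [mul_nonneg hK.le hv, mul_nonneg (mul_nonneg hK.le hv) h1]

/-- Push-forwards, along a backward orbit, of transverse vectors, normalized transversally. -/
def pushVec (L : U → U) (y : ℕ → U) (n : ℕ) : E :=
  (F.lam L n (y n))⁻¹ • tanD E L^[n] (y n) (F.ehat (y n))

section Expanding

variable {F} {B c ρ : ℝ}

lemma ne_zero_of_expanding (hc0 : 0 < c) (hρ : 1 < ρ)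
    (hexp : ∀ x ∈ A, ∀ n : ℕ, c * ρ ^ n ≤ ‖F.lam L n x‖) {x : U} (hx : x ∈ A) (n : ℕ) :
    F.lam L n x ≠ 0 :=
  norm_pos_iff.1 ((by positivity : 0 < c * ρ ^ n).trans_le (hexp x hx n))

lemma m_pushVec (h : InvMap A Es L) (hne : ∀ x ∈ A, ∀ n, F.lam L n x ≠ 0) {y : ℕ → U}
    (hy : ∀ n, y n ∈ A) (hyL : ∀ n, L (y (n + 1)) = y n) (n : ℕ) :
    F.m (y 0) (F.pushVec L y n) = 1 := by
  have h1 := F.lam_spec h n (hy n) (F.ehat (y n))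
  rw [iterate_backward hyL, F.m_ehat (hy n), mul_one] at h1
  rw [pushVec, map_smul, h1, smul_eq_mul, inv_mul_cancel₀ (hne _ (hy n) n)]

/-- Two consecutive push-forwards are images under the same `DL^n` of vectors at `y n` with the same
transverse value. Their difference therefore comes from `Es`. -/
lemma pushVec_succ_sub (h : InvMap A Es L) {y : ℕ → U}
    (hy : ∀ n, y n ∈ A) (hyL : ∀ n, L (y (n + 1)) = y n) (n : ℕ) :
    F.pushVec L y (n + 1) - F.pushVec L y n = (F.lam L n (y n))⁻¹ • tanD E L^[n] (y n)
      ((F.lam L 1 (y (n + 1)))⁻¹ • tanD E L (y (n + 1)) (F.ehat (y (n + 1))) - F.ehat (y n)) := by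
  have h1 := h.tanD_add n 1 (hy (n + 1)) (F.ehat (y (n + 1)))
  have h2 := F.lam_add h n 1 (hy (n + 1))
  rw [Function.iterate_one, hyL] at h1 h2
  rw [pushVec, pushVec, h1, h2, map_sub, map_smul, smul_sub, smul_smul, mul_inv]

/-- On the difference, which comes from `Es`, the differential contributes `C * q ^ n`, and the
normalisation by `lam` at most `c⁻¹`; the other factors bound the size of that vector of `Es`. -/
lemma exists_pushVec_bound (h : InvMap A Es L) (hB : F.Bounds L B) (hc : Contracts E N A Es L)
    (hc0 : 0 < c) (hρ : 1 < ρ) (hexp : ∀ x ∈ A, ∀ n : ℕ, c * ρ ^ n ≤ ‖F.lam L n x‖) :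
    ∃ D q : ℝ, 0 ≤ D ∧ 0 < q ∧ q < 1 ∧ ∀ y : ℕ → U, (∀ n, y n ∈ A) →
      (∀ n, L (y (n + 1)) = y n) →
      ∀ n, N (y 0) (F.pushVec L y (n + 1) - F.pushVec L y n) ≤ D * q ^ n := by
  obtain ⟨C, q, hC, hq0, hq1, hCq⟩ := hc
  have hK := F.K_pos
  have hB0 : 0 < B := zero_lt_one.trans_le hB.one_le
  refine ⟨c⁻¹ * (C * (B * (B * F.K ^ 2) + F.K ^ 2)), q, by positivity, hq0, hq1,
    fun y hy hyL n => ?_⟩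
  have hne := fun x hx => ne_zero_of_expanding hc0 hρ hexp (x := x) hx
  rw [pushVec_succ_sub h hy hyL, map_smul_eq_mul]
  set w := (F.lam L 1 (y (n + 1)))⁻¹ • tanD E L (y (n + 1)) (F.ehat (y (n + 1))) - F.ehat (y n)
  have hw : w ∈ Es (y n) := by
    have h1 := F.lam_spec h 1 (hy (n + 1)) (F.ehat (y (n + 1)))
    rw [Function.iterate_one, hyL, F.m_ehat (hy _), mul_one] at h1
    rw [F.mem_Es_iff (hy n), map_sub, map_smul, h1, F.m_ehat (hy n), smul_eq_mul,
      inv_mul_cancel₀ (hne _ (hy _) 1), sub_self]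
  have hNw : N (y n) w ≤ B * (B * F.K ^ 2) + F.K ^ 2 := by
    refine (map_sub_le_add _ _ _).trans (add_le_add ?_ (F.N_ehat (hy n)))
    rw [map_smul_eq_mul]
    have h2 := hB.tanD_le _ (hy (n + 1)) (F.ehat (y (n + 1)))
    rw [hyL] at h2
    have h3 : ‖(F.lam L 1 (y (n + 1)))⁻¹‖ ≤ B := by
      rw [norm_inv]
      exact inv_le_of_inv_le₀ hB0 (by
        rw [inv_le_iff_one_le_mul₀ hB0, mul_comm]; exact hB.le_lam _ (hy _))
    exact mul_le_mul h3 (h2.trans (mul_le_mul_of_nonneg_left (F.N_ehat (hy _)) hB0.le))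
      (apply_nonneg _ _) hB0.le
  have h4 := hCq _ (hy n) w hw n
  rw [iterate_backward hyL] at h4
  have h5 : ‖(F.lam L n (y n))⁻¹‖ ≤ c⁻¹ := by
    rw [norm_inv]
    refine inv_anti₀ hc0 (le_trans ?_ (hexp _ (hy n) n))
    exact le_mul_of_one_le_right hc0.le (one_le_pow₀ hρ.le)
  calc _ ≤ c⁻¹ * (C * q ^ n * (B * (B * F.K ^ 2) + F.K ^ 2)) :=
        mul_le_mul h5 (h4.trans (mul_le_mul_of_nonneg_left hNw (by positivity)))
          (apply_nonneg _ _) (by positivity)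
    _ = _ := by ring

/-- The bound `D` does not depend on the backward orbit; this uniform transversality is what makes
the expansion constant on the unstable lines uniform. -/
lemma exists_unstable_vector [CompleteSpace E] (h : InvMap A Es L) (hB : F.Bounds L B)
    (hc : Contracts E N A Es L) (hc0 : 0 < c) (hρ : 1 < ρ)
    (hexp : ∀ x ∈ A, ∀ n : ℕ, c * ρ ^ n ≤ ‖F.lam L n x‖) :
    ∃ D : ℝ, 0 < D ∧ ∀ y : ℕ → U, (∀ n, y n ∈ A) → (∀ n, L (y (n + 1)) = y n) →
      ∃ u : E, Tendsto (F.pushVec L y) atTop (𝓝 u) ∧ F.m (y 0) u = 1 ∧ N (y 0) u ≤ D := by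
  obtain ⟨D, q, hD, hq0, hq1, hDq⟩ := exists_pushVec_bound h hB hc hc0 hρ hexp
  have hK := F.K_pos
  have hne := fun x hx => ne_zero_of_expanding hc0 hρ hexp (x := x) hx
  have hq' : 0 < 1 - q := by linarith
  refine ⟨F.K ^ 2 + D / (1 - q), by positivity, fun y hy hyL => ?_⟩
  obtain ⟨κ, hκ, hκN⟩ := F.exists_norm_equiv (hy 0)
  have hb := hDq y hy hyL
  have hcau : CauchySeq (F.pushVec L y) := by
    refine cauchySeq_of_le_geometric q (κ * D) hq1 fun n => ?_
    rw [dist_eq_norm', mul_assoc]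
    exact (hκN _).1.trans (mul_le_mul_of_nonneg_left (hb n) hκ)
  obtain ⟨u, hu⟩ := cauchySeq_tendsto_of_complete hcau
  refine ⟨u, hu, ?_, ?_⟩
  · refine tendsto_nhds_unique (((F.m (y 0)).continuous.tendsto u).comp hu) ?_
    exact tendsto_const_nhds.congr fun n => (m_pushVec h hne hy hyL n).symm
  · have h1 : ∀ n, N (y 0) (F.pushVec L y n) ≤ F.K ^ 2 + D / (1 - q) * (1 - q ^ n) := by
      intro n
      induction n with
      | zero =>
        rw [pushVec, F.lam_zero (hy 0), InvMap.tanD_zero]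
        simpa using F.N_ehat (hy 0)
      | succ n ih =>
        have h2 : N (y 0) (F.pushVec L y (n + 1)) ≤ N (y 0) (F.pushVec L y n) +
            N (y 0) (F.pushVec L y (n + 1) - F.pushVec L y n) := by
          refine le_trans (le_of_eq ?_) (map_add_le_add _ _ _)
          rw [add_sub_cancel]
        have h3 : D / (1 - q) * (1 - q ^ (n + 1)) = D / (1 - q) * (1 - q ^ n) + D * q ^ n := by
          field_simp; ring
        rw [h3]
        linarith [hb n]
    have h2 : ∀ n, N (y 0) u ≤ F.K ^ 2 + D / (1 - q) + κ * ‖u - F.pushVec L y n‖ := by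
      intro n
      have h3 : N (y 0) u ≤ N (y 0) (F.pushVec L y n) + N (y 0) (u - F.pushVec L y n) := by
        refine le_trans (le_of_eq ?_) (map_add_le_add _ _ _)
        rw [add_sub_cancel]
      have h4 : D / (1 - q) * (1 - q ^ n) ≤ D / (1 - q) :=
        mul_le_of_le_one_right (by positivity) (by linarith [pow_pos hq0 n])
      linarith [h1 n, (hκN (u - F.pushVec L y n)).2]
    refine ge_of_tendsto' (x := atTop) (f := fun n => F.K ^ 2 + D / (1 - q) +
      κ * ‖u - F.pushVec L y n‖) ?_ h2
    have h3 : Tendsto (fun n => ‖u - F.pushVec L y n‖) atTop (𝓝 0) := by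
      simpa using (hu.const_sub u).norm
    simpa using (h3.const_mul κ).const_add (F.K ^ 2 + D / (1 - q))

/-- If the transverse cocycle is uniformly expanding, there is an unstable line over every
two-sided orbit. -/
theorem exists_unstable_family [CompleteSpace E] (h : InvMap A Es L) (hB : F.Bounds L B)
    (hc : Contracts E N A Es L) (hc0 : 0 < c) (hρ : 1 < ρ)
    (hexp : ∀ x ∈ A, ∀ n : ℕ, c * ρ ^ n ≤ ‖F.lam L n x‖) :
    ∃ Eu : NatExt L A → Submodule ℂ E,
      (∀ f, IsClosed (Eu f : Set E)) ∧ (∀ f, IsCompl (Es (f.pt 0)) (Eu f)) ∧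
      (∀ f, Eu f.lift = (Eu f).map (tanD E L (f.pt 0)).toLinearMap) ∧
      ∃ c ρ : ℝ, 0 < c ∧ 1 < ρ ∧ ∀ f : NatExt L A, ∀ v ∈ Eu f, ∀ n : ℕ,
        c * ρ ^ n * N (f.pt 0) v ≤ N (L^[n] (f.pt 0)) (tanD E L^[n] (f.pt 0) v) := by
  obtain ⟨D, hD, hD'⟩ := exists_unstable_vector h hB hc hc0 hρ hexp
  have hK := F.K_pos
  have hne := fun x hx => ne_zero_of_expanding hc0 hρ hexp (x := x) hx
  have hyA : ∀ f : NatExt L A, ∀ n : ℕ, f.pt (-(n : ℤ)) ∈ A := fun f n => f.mem _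
  have hyL : ∀ f : NatExt L A, ∀ n : ℕ, L (f.pt (-((n + 1 : ℕ) : ℤ))) = f.pt (-(n : ℤ)) := by
    intro f n
    rw [f.orbit]; congr 1; push_cast; ring
  have hex := fun f : NatExt L A => hD' (fun n => f.pt (-(n : ℤ))) (hyA f) (hyL f)
  choose u hut hum huN using hex
  have hz : ∀ f : NatExt L A, f.pt (-((0 : ℕ) : ℤ)) = f.pt 0 := fun f => by simp
  have hum' : ∀ f, F.m (f.pt 0) (u f) = 1 := fun f => by rw [← hz f]; exact hum f
  have huN' : ∀ f, N (f.pt 0) (u f) ≤ D := fun f => by rw [← hz f]; exact huN f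
  -- The backward orbit of the lift is that of `f` with one point added in front, so both sides are
  -- limits of the same normalised push-forwards.
  have hlift : ∀ f, u f.lift = (F.lam L 1 (f.pt 0))⁻¹ • tanD E L (f.pt 0) (u f) := by
    intro f
    have h1 := (tendsto_add_atTop_iff_nat 1).2 (hut f.lift)
    have h2 := (((tanD E L (f.pt 0)).continuous.tendsto _).comp (hut f)).const_smul
      (F.lam L 1 (f.pt 0))⁻¹
    refine tendsto_nhds_unique h1 (h2.congr fun n => ?_)
    have e : f.lift.pt (-((n + 1 : ℕ) : ℤ)) = f.pt (-(n : ℤ)) := hyL f n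
    have hb : L^[n] (f.pt (-(n : ℤ))) = f.pt 0 := by
      rw [← hz f]; exact iterate_backward (y := fun n : ℕ => f.pt (-(n : ℤ))) (hyL f) n
    have h3 := h.tanD_add 1 n (hyA f n) (F.ehat (f.pt (-(n : ℤ))))
    have h4 := F.lam_add h 1 n (hyA f n)
    rw [hb, add_comm] at h3 h4
    simp only [pushVec, Function.comp_apply]
    rw [e, h3, h4, map_smul, smul_smul, mul_inv, Function.iterate_one]
  -- The expansion of `m` becomes one of `N` through `‖m‖ ≤ K ^ 2 * N` and `N (u f) ≤ D`, whence the
  -- constant.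
  refine ⟨fun f => Submodule.span ℂ {u f}, fun f => ?_, fun f => ?_, fun f => ?_,
    c / (F.K ^ 2 * D), ρ, by positivity, hρ, fun f v hv n => ?_⟩
  · exact Submodule.closed_of_finiteDimensional _
  · rw [isCompl_iff, disjoint_iff_inf_le, codisjoint_iff_le_sup]
    constructor
    · intro v hv
      obtain ⟨a, rfl⟩ := Submodule.mem_span_singleton.1 hv.2
      have h1 := (F.mem_Es_iff (f.mem 0) _).1 hv.1
      rw [map_smul, hum', smul_eq_mul, mul_one] at h1
      simp [h1]
    · intro v _
      refine Submodule.mem_sup.2 ⟨v - F.m (f.pt 0) v • u f, ?_, F.m (f.pt 0) v • u f,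
        Submodule.smul_mem _ _ (Submodule.mem_span_singleton_self _), by rw [sub_add_cancel]⟩
      rw [F.mem_Es_iff (f.mem 0), map_sub, map_smul, hum', smul_eq_mul, mul_one, sub_self]
  · simp only [Submodule.map_span, image_singleton, hlift]
    exact Submodule.span_singleton_smul_eq (IsUnit.mk0 _ (inv_ne_zero (hne _ (f.mem 0) 1))) _
  · obtain ⟨a, rfl⟩ := Submodule.mem_span_singleton.1 hv
    have h1 := F.lam_spec h n (f.mem 0) (a • u f)
    have h2 := F.norm_m_le ((h.iterate n).maps (f.mem 0)) (tanD E L^[n] (f.pt 0) (a • u f))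
    rw [h1, norm_mul, map_smul, hum', smul_eq_mul, mul_one] at h2
    have h3 : N (f.pt 0) (a • u f) ≤ ‖a‖ * D := by
      rw [map_smul_eq_mul]; exact mul_le_mul_of_nonneg_left (huN' f) (norm_nonneg _)
    have h4 : c * ρ ^ n * ‖a‖ ≤ ‖F.lam L n (f.pt 0)‖ * ‖a‖ :=
      mul_le_mul_of_nonneg_right (hexp _ (f.mem 0) n) (norm_nonneg _)
    calc _ ≤ c / (F.K ^ 2 * D) * ρ ^ n * (‖a‖ * D) :=
          mul_le_mul_of_nonneg_left h3 (by positivity)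
      _ = (c * ρ ^ n * ‖a‖) / F.K ^ 2 := by field_simp
      _ ≤ _ := by rw [div_le_iff₀ (by positivity), mul_comm]; linarith

end Expanding

end FrameAtlas

/-! ### From the cocycle to cone systems and slow shadowing -/

namespace FrameAtlas

variable {E : Type*} [NormedAddCommGroup E] [NormedSpace ℂ E]
variable {U : Type*} [MetricSpace U] [ChartedSpace E U]
variable {N : U → Seminorm ℂ E} {A : Set U} {Es : U → Submodule ℂ E} (F : FrameAtlas N A Es)
  {L G : U → U}

/-- The chart is bi-Lipschitz on the frame domain, so Cauchy sequences converge in `E`; for a small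
radius the limit remains in the open chart image and lifts back. -/
lemma exists_isComplete_closedBall_at [CompleteSpace E] (F : FrameAtlas N A Es) {x : U} (hx : x ∈ A) :
    ∃ ρ : ℝ, 0 < ρ ∧ IsComplete (Metric.closedBall x ρ) := by
  set φ := chartAt E (F.c x)
  have hi := F.c_mem x hx
  have hK := F.K_pos
  have hopen : IsOpen (φ '' F.W (F.c x)) :=
    φ.isOpen_image_of_subset_source (F.isOpen _ hi) (F.subset _ hi)
  obtain ⟨s, hs, hball⟩ := Metric.isOpen_iff.1 hopen (φ x) (mem_image_of_mem _ (F.mem_W hx))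
  have hr := F.r_pos
  set ρ := min (F.r / 2) (s / (2 * F.K))
  have hρ : 0 < ρ := by positivity
  have hρr : ρ < F.r := (min_le_left _ _).trans_lt (half_lt_self hr)
  have hW : Metric.closedBall x ρ ⊆ F.W (F.c x) :=
    (Metric.closedBall_subset_ball hρr).trans (F.ball_subset x hx)
  refine ⟨ρ, hρ, ?_⟩
  rw [← completeSpace_coe_iff_isComplete]
  refine Metric.complete_of_cauchySeq_tendsto fun y hy => ?_
  have hyφ : CauchySeq fun n => φ (y n) := by
    rw [Metric.cauchySeq_iff'] at hy ⊢
    intro ε hε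
    obtain ⟨n₀, hn₀⟩ := hy (ε / F.K) (by positivity)
    refine ⟨n₀, fun n hn => ?_⟩
    rw [dist_eq_norm]
    have h1 := (F.bilip _ hi _ (hW (y n).2) _ (hW (y n₀).2)).2
    have h2 : dist (y n : U) (y n₀) < ε / F.K := hn₀ n hn
    rw [lt_div_iff₀ hK] at h2
    linarith
  obtain ⟨a, ha⟩ := cauchySeq_tendsto_of_complete hyφ
  have has : a ∈ Metric.ball (φ x) s := by
    have h1 : a ∈ Metric.closedBall (φ x) (s / 2) := by
      refine Metric.isClosed_closedBall.mem_of_tendsto ha (Eventually.of_forall fun n => ?_)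
      rw [Metric.mem_closedBall, dist_eq_norm]
      have h1 := (F.bilip _ hi _ (hW (y n).2) _ (F.mem_W hx)).2
      have h2 : dist (y n : U) x ≤ s / (2 * F.K) := (Metric.mem_closedBall.1 (y n).2).trans
        (min_le_right _ _)
      calc _ ≤ F.K * (s / (2 * F.K)) := h1.trans (by gcongr)
        _ = s / 2 := by field_simp
    exact Metric.closedBall_subset_ball (half_lt_self hs) h1
  obtain ⟨z, hz, hza⟩ := hball has
  have hlim : Tendsto (fun n => (y n : U)) atTop (𝓝 z) := by
    rw [tendsto_iff_dist_tendsto_zero]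
    have h1 : Tendsto (fun n => F.K * ‖φ (y n) - φ z‖) atTop (𝓝 0) := by
      rw [hza]
      simpa using ((ha.sub_const a).norm).const_mul F.K
    exact squeeze_zero (fun _ => dist_nonneg)
      (fun n => (F.bilip _ hi _ (hW (y n).2) _ hz).1) h1
  have hzb : z ∈ Metric.closedBall x ρ :=
    Metric.isClosed_closedBall.mem_of_tendsto hlim (Eventually.of_forall fun n => (y n).2)
  exact ⟨⟨z, hzb⟩, tendsto_subtype_rng.2 hlim⟩

lemma exists_isComplete_closedBall [CompleteSpace E] (F : FrameAtlas N A Es)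
    (hA : IsCompact A) :
    ∃ ρ : ℝ, 0 < ρ ∧ ∀ x ∈ A, IsComplete (Metric.closedBall x ρ) := by
  have h := fun x : A => F.exists_isComplete_closedBall_at x.2
  choose ρ hρ hcomp using h
  obtain ⟨δ, hδ, hsub⟩ := lebesgue_number_lemma_of_metric hA
    (c := fun x : A => Metric.ball (x : U) (ρ x)) (fun _ => Metric.isOpen_ball)
    (fun x hx => mem_iUnion.2 ⟨⟨x, hx⟩, Metric.mem_ball_self (hρ _)⟩)
  refine ⟨δ / 2, half_pos hδ, fun x hx => ?_⟩
  obtain ⟨i, hi⟩ := hsub x hx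
  have h1 : Metric.closedBall x (δ / 2) ⊆ Metric.closedBall (i : U) (ρ i) :=
    ((Metric.closedBall_subset_ball (half_lt_self hδ)).trans hi).trans Metric.ball_subset_closedBall
  have h2 := isComplete_inter_of_isClosed (hcomp i) (Metric.isClosed_closedBall (x := x)
    (ε := δ / 2))
  rwa [inter_eq_right.2 h1] at h2

variable [IsManifold 𝓘(ℂ, E) ω U]

/-- A map contracting `Es` much more than the transverse direction defines a cone system. -/
theorem exists_coneSystem (hA : IsCompact A) (h : InvMap A Es G) {l q : ℝ} (hl : 0 < l)
    (hl1 : l ≤ 1) (hq : 0 ≤ q) (hql : F.K ^ 2 * q ≤ l / 4)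
    (hcontr : ∀ x ∈ A, ∀ v ∈ Es x, N (G x) (tanD E G x v) ≤ q * N x v)
    (hlow : ∀ x ∈ A, l ≤ ‖F.lam G 1 x‖) :
    ∃ S : ConeSystem E G A, S.ψ = (fun x y => chartAt E (F.c x) y) ∧
      S.ℓ = (fun x => F.ℓ (F.c x) x) ∧ S.lam = F.lam G 1 ∧ F.K ^ 3 ≤ S.K ∧ S.r ≤ F.r ∧
      ∀ x ∈ A, ∀ y ∈ Metric.ball x S.r, ContMDiffAt 𝓘(ℂ, E) 𝓘(ℂ, E) ω G y := by
  set O := interior {x | ContMDiffAt 𝓘(ℂ, E) 𝓘(ℂ, E) ω G x}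
  have hO : IsOpen O := isOpen_interior
  have hAO : A ⊆ O := fun x hx => by
    rw [mem_interior_iff_mem_nhds]
    exact (contMDiffAt_iff_contMDiffAt_nhds (by simp)).1 (h.smooth x hx)
  have hGO : ∀ x ∈ O, ContMDiffAt 𝓘(ℂ, E) 𝓘(ℂ, E) ω G x := fun x hx => interior_subset hx
  obtain ⟨C, hC⟩ := F.exists_strict hA hO hAO (fun x hx => (hGO x hx).contMDiffWithinAt) h.maps
  obtain ⟨d, hd, hthick⟩ := hA.exists_thickening_subset_open hO hAO
  have hK := F.K_pos
  have hr := F.r_pos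
  have hC1 : (1 : ℝ) ≤ max C 1 := le_max_right _ _
  set r := min (min F.r (1 / max C 1)) d
  have hrF : r ≤ F.r := (min_le_left _ _).trans (min_le_left _ _)
  have hrC : ∀ x ∈ A, r ≤ 1 / C := fun x hx => by
    refine ((min_le_left _ _).trans (min_le_right _ _)).trans (le_of_eq ?_)
    rw [max_eq_left (hC x hx).1]
  have hrpos : 0 < r := by positivity
  set K := max (max (F.K ^ 3) C) F.K
  have hKF : F.K ≤ K := le_max_right _ _
  have hKC : C ≤ K := (le_max_right _ _).trans (le_max_left _ _)
  have hsub : ∀ x ∈ A, Metric.ball x r ⊆ F.W (F.c x) := fun x hx =>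
    (Metric.ball_subset_ball hrF).trans (F.ball_subset x hx)
  refine ⟨{
    ψ := fun x y => chartAt E (F.c x) y
    ℓ := fun x => F.ℓ (F.c x) x
    T := fun x => Tij G (F.c x) (F.c (G x)) x
    lam := F.lam G 1
    r := r
    K := K
    q := F.K ^ 2 * q
    B := F.K ^ 3 * q + F.K ^ 3 * max C 1
    l0 := l
    r_pos := hrpos
    one_le_K := F.one_le_K.trans hKF
    q_nonneg := by positivity
    B_nonneg := by positivity
    l0_pos := hl
    l0_le_one := hl1
    q_le := hql
    bilip := fun x hx y hy y' hy' => ?_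
    strict := fun x hx y hy y' hy' => ?_
    T_le := fun x hx v => ?_
    equivar := fun x hx v => ?_
    l0_le := hlow
    norm_ℓ_le := fun x hx => (F.norm_ℓ _ (F.c_mem x hx) x ⟨F.mem_W hx, hx⟩).trans hKF
    maps := h.maps
    cont := fun x hx y hy => (hC x hx).2.2.1 y (Metric.ball_subset_ball (hrC x hx) hy) },
    rfl, rfl, rfl, (le_max_left _ _).trans (le_max_left _ _), hrF, fun x hx y hy => ?_⟩
  · have h1 := F.bilip _ (F.c_mem x hx) y (hsub x hx hy) y' (hsub x hx hy')
    exact ⟨h1.1.trans (by gcongr), h1.2.trans (by gcongr)⟩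
  · refine ((hC x hx).2.2.2 y (Metric.ball_subset_ball (hrC x hx) hy) y'
      (Metric.ball_subset_ball (hrC x hx) hy')).trans ?_
    gcongr
  · obtain ⟨Θ, hΘ⟩ := exists_equiv_chartDeriv (F.mem_source hx)
    obtain ⟨w, rfl⟩ : ∃ w, chartD (F.c x) x w = v := ⟨Θ.symm v, by rw [← hΘ]; simp⟩
    -- Splitting off `a • ehat x` leaves a vector of `Es`, on which the small rate `q` acts; all
    -- terms proportional to `‖a‖` go into `B`.
    set a := F.ℓ (F.c x) x (chartD (F.c x) x w)
    have ha : F.m x w = a := rfl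
    have hmem : w - a • F.ehat x ∈ Es x := by
      rw [F.mem_Es_iff hx, map_sub, map_smul, F.m_ehat hx, ha, smul_eq_mul, mul_one, sub_self]
    have hT : ∀ u, Tij G (F.c x) (F.c (G x)) x (chartD (F.c x) x u) =
        chartD (F.c (G x)) (G x) (tanD E G x u) :=
      F.Tij_chartD (F.c_mem x hx) (F.c_mem _ (h.maps hx)) (F.mem_W hx) (F.mem_W (h.maps hx))
        (h.smooth x hx)
    have hn := F.norm _ (F.c_mem x hx) x ⟨F.mem_W hx, hx⟩
    have hnG := F.norm _ (F.c_mem _ (h.maps hx)) (G x) ⟨F.mem_W (h.maps hx), h.maps hx⟩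
    have e : chartD (F.c x) x w = chartD (F.c x) x (w - a • F.ehat x) +
        a • chartD (F.c x) x (F.ehat x) := by
      rw [map_sub, map_smul, sub_add_cancel]
    have h1 : N x (w - a • F.ehat x) ≤ F.K * ‖chartD (F.c x) x w‖ + ‖a‖ * F.K ^ 2 := by
      refine (map_sub_le_add _ _ _).trans (add_le_add (hn w).1 ?_)
      rw [map_smul_eq_mul]
      exact mul_le_mul_of_nonneg_left (F.N_ehat hx) (norm_nonneg _)
    have h2 : ‖Tij G (F.c x) (F.c (G x)) x (chartD (F.c x) x (w - a • F.ehat x))‖ ≤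
        F.K * (q * (F.K * ‖chartD (F.c x) x w‖ + ‖a‖ * F.K ^ 2)) := by
      rw [hT]
      refine (hnG _).2.trans ?_
      gcongr
      exact (hcontr x hx _ hmem).trans (by gcongr)
    have h3 : ‖Tij G (F.c x) (F.c (G x)) x (chartD (F.c x) x (F.ehat x))‖ ≤
        max C 1 * (F.K * F.K ^ 2) := by
      refine (ContinuousLinearMap.le_opNorm _ _).trans ?_
      gcongr
      · exact (hC x hx).2.1.trans (le_max_left _ _)
      · exact (hn _).2.trans (mul_le_mul_of_nonneg_left (F.N_ehat hx) hK.le)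
    calc _ ≤ ‖Tij G (F.c x) (F.c (G x)) x (chartD (F.c x) x (w - a • F.ehat x))‖ +
          ‖a‖ * ‖Tij G (F.c x) (F.c (G x)) x (chartD (F.c x) x (F.ehat x))‖ := by
          conv_lhs => rw [e]
          rw [map_add, map_smul, ← norm_smul]
          exact norm_add_le _ _
      _ ≤ F.K * (q * (F.K * ‖chartD (F.c x) x w‖ + ‖a‖ * F.K ^ 2)) +
          ‖a‖ * (max C 1 * (F.K * F.K ^ 2)) := by gcongr
      _ = _ := by ring
  · have h1 := F.ℓ_Tij h.maps h.inv hx (F.c_mem x hx) (F.c_mem _ (h.maps hx)) (F.mem_W hx)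
      (F.mem_W (h.maps hx)) (h.smooth x hx) v
    rw [F.lam_one_eq h hx]
    exact h1
  · exact hGO y (hthick (Metric.mem_thickening_iff.2
      ⟨x, hx, (Metric.mem_ball.1 hy).trans_le (min_le_right _ _)⟩))

/-- The affine disc in a chart, transverse to `Es`. -/
lemma nonempty_flatDisc (h : InvMap A Es G) (S : ConeSystem E G A)
    (hψ : S.ψ = fun x y => chartAt E (F.c x) y) (hℓ : S.ℓ = fun x => F.ℓ (F.c x) x)
    (hSK : F.K ^ 3 ≤ S.K) (hSr : S.r ≤ F.r)
    (hsm : ∀ x ∈ A, ∀ y ∈ Metric.ball x S.r, ContMDiffAt 𝓘(ℂ, E) 𝓘(ℂ, E) ω G y)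
    {g : U} (hg : g ∈ A) : Nonempty (S.FlatDisc g) := by
  have hK := F.K_pos
  set φ := chartAt E (F.c g)
  have hgs : g ∈ φ.source := F.mem_source hg
  set e := chartD (F.c g) g (F.ehat g)
  set p : ℂ → E := fun z => φ g + z • e
  have hp : Continuous p := by fun_prop
  have hp0 : p 0 = φ g := by simp [p]
  have h1 : ∀ᶠ z in 𝓝 (0 : ℂ), p z ∈ φ.target :=
    hp.continuousAt.eventually (φ.open_target.eventually_mem (by rw [hp0]; exact φ.map_source hgs))
  have h2 : ∀ᶠ z in 𝓝 (0 : ℂ), φ.symm (p z) ∈ Metric.ball g S.r := by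
    have h3 : ContinuousAt (fun z => φ.symm (p z)) 0 :=
      ContinuousAt.comp (g := φ.symm) (φ.continuousAt_symm (by rw [hp0]; exact φ.map_source hgs))
        hp.continuousAt
    refine h3.eventually (Metric.isOpen_ball.eventually_mem ?_)
    simp only [hp0, φ.left_inv hgs]
    exact Metric.mem_ball_self S.r_pos
  obtain ⟨R, hR, hball⟩ := Metric.eventually_nhds_iff_ball.1 (h1.and h2)
  refine ⟨{
    e := e
    σ := fun z => φ.symm (p z)
    R := R
    R_pos := hR
    norm_e := ?_
    ℓ_e := by rw [hℓ]; exact F.m_ehat hg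
    σ_zero := by rw [hp0, φ.left_inv hgs]
    mem := fun z hz => (hball z hz).2
    coord := fun z hz => by rw [hψ]; exact φ.right_inv (hball z hz).1
    cont := φ.continuousOn_symm.comp hp.continuousOn fun z hz => (hball z hz).1
    holo := fun n z hz hk => ?_ }⟩
  · refine le_trans ?_ hSK
    calc _ ≤ F.K * N g (F.ehat g) := (F.norm _ (F.c_mem g hg) g ⟨F.mem_W hg, hg⟩ _).2
      _ ≤ F.K * F.K ^ 2 := mul_le_mul_of_nonneg_left (F.N_ehat hg) hK.le
      _ = _ := by ring
  · have hσ : ContMDiffAt 𝓘(ℂ, ℂ) 𝓘(ℂ, E) ω (fun z => φ.symm (p z)) z := by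
      refine ContMDiffAt.comp (g := φ.symm) z (contMDiffAt_chart_symm' (hball z hz).1) ?_
      rw [contMDiffAt_iff_contDiffAt]
      exact contDiffAt_const.add (contDiffAt_id.smul contDiffAt_const)
    have hiter : ∀ k ≤ n, ContMDiffAt 𝓘(ℂ, ℂ) 𝓘(ℂ, E) ω (fun w => G^[k] (φ.symm (p w))) z := by
      intro k
      induction k with
      | zero => exact fun _ => hσ
      | succ k ih =>
        intro hkn
        simp only [Function.iterate_succ_apply']
        exact ContMDiffAt.comp (g := G) z
          (hsm _ (h.maps.iterate k hg) _ (hk k (by omega))) (ih (by omega))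
    have hn := h.maps.iterate n hg
    have hmem : G^[n] (φ.symm (p z)) ∈ (chartAt E (F.c (G^[n] g))).source :=
      F.subset _ (F.c_mem _ hn) (F.ball_subset _ hn
        (Metric.ball_subset_ball hSr (hk n le_rfl)))
    have h3 : ContMDiffAt 𝓘(ℂ, ℂ) 𝓘(ℂ, E) ω
        (fun w => chartAt E (F.c (G^[n] g)) (G^[n] (φ.symm (p w)))) z :=
      ContMDiffAt.comp (g := chartAt E (F.c (G^[n] g))) z (contMDiffAt_chart' hmem) (hiter n le_rfl)
    rw [contMDiffAt_iff_contDiffAt] at h3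
    rw [hψ]
    exact h3.differentiableAt (by simp)

end FrameAtlas

/-- Orbit segments of bounded length depend equicontinuously on the initial point near a compact
set. -/
lemma exists_dist_iterate_le {X : Type*} [MetricSpace X] {L : X → X} {A : Set X}
    (hA : IsCompact A) (hcont : ∀ k, ∀ x ∈ A, ContinuousAt L^[k] x) (m : ℕ) {ε : ℝ} (hε : 0 < ε) :
    ∃ ε' : ℝ, 0 < ε' ∧ ∀ x ∈ A, ∀ y, dist y x ≤ ε' → ∀ k < m, dist (L^[k] y) (L^[k] x) ≤ ε := by
  have h : ∀ k ∈ Finset.range m, ∀ᶠ p : X × X in uniformity X, p.1 ∈ A →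
      dist (L^[k] p.1) (L^[k] p.2) < ε := fun k _ =>
    hA.uniformContinuousAt_of_continuousAt L^[k] (hcont k) (Metric.dist_mem_uniformity hε)
  obtain ⟨ε', hε', hball⟩ := Metric.mem_uniformity_dist.1 ((Filter.eventually_all_finset _).2 h)
  refine ⟨ε' / 2, half_pos hε', fun x hx y hxy k hk => ?_⟩
  rw [dist_comm]
  exact (hball (a := x) (b := y) (by rw [dist_comm]; linarith) k (Finset.mem_range.2 hk) hx).le

lemma ExpAsymptotic.iterate {X : Type*} [MetricSpace X] {L : X → X} {x y : X}
    (h : ExpAsymptotic L x y) {m : ℕ} (hm : 1 ≤ m) : ExpAsymptotic L^[m] x y := by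
  obtain ⟨C, q, hC, hq0, hq1, hCq⟩ := h
  refine ⟨C, q ^ m, hC, pow_pos hq0 m, pow_lt_one₀ hq0.le hq1 (by omega), fun n => ?_⟩
  rw [← Function.iterate_mul, ← pow_mul]
  exact hCq _

namespace FrameAtlas

variable {E : Type*} [NormedAddCommGroup E] [NormedSpace ℂ E]
variable {U : Type*} [MetricSpace U] [ChartedSpace E U] [IsManifold 𝓘(ℂ, E) ω U]
variable {N : U → Seminorm ℂ E} {A : Set U} {Es : U → Submodule ℂ E} (F : FrameAtlas N A Es)
  {L : U → U}

/-- If the transverse cocycle has no exponential contraction, and is bounded along some orbit,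
there are slowly shadowing orbits. -/
theorem not_noSlowShadowing [CompleteSpace E] (hA : IsCompact A) {V : Set U} (hV : IsOpen V)
    (hAV : A ⊆ V) (h : InvMap A Es L) (hc : Contracts E N A Es L)
    (hlow : ∀ δ : ℝ, 0 < δ → ∃ c : ℝ, 0 < c ∧ ∀ x ∈ A, ∀ n : ℕ,
      c * Real.exp (-(δ * n)) ≤ ‖F.lam L n x‖) {g : U} (hg : g ∈ A) {M₀ : ℝ}
    (hM₀ : ∀ n, ‖F.lam L n g‖ ≤ M₀) {ε : ℝ} (hε : 0 < ε) : ¬ NoSlowShadowing L V A ε := by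
  obtain ⟨C, q, hC, hq0, hq1, hCq⟩ := hc
  have hK := F.K_pos
  -- With `s = exp (-δ)` one has `q = s ^ 2`: `Es` contracts like `s ^ (2m)` while the cocycle is at
  -- least `c * s ^ m`, so a large `m` gives the domination required for cones.
  set δ := -Real.log q / 2
  have hδ : 0 < δ := by
    have := Real.log_neg hq0 hq1
    simp only [δ]; linarith
  have hqδ : q = Real.exp (-δ) * Real.exp (-δ) := by
    rw [← Real.exp_add, ← Real.exp_log hq0]
    congr 1
    simp only [δ]; ring
  set s := Real.exp (-δ)
  have hs0 : 0 < s := Real.exp_pos _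
  have hs1 : s < 1 := Real.exp_lt_one_iff.2 (by linarith)
  obtain ⟨c, hc0, hcδ⟩ := hlow δ hδ
  have hlim : Tendsto (fun m : ℕ => F.K ^ 2 * (C * s ^ m)) atTop (𝓝 0) := by
    simpa using ((tendsto_pow_atTop_nhds_zero_of_lt_one hs0.le hs1).const_mul C).const_mul (F.K ^ 2)
  obtain ⟨m, hm1, hm⟩ := ((eventually_ge_atTop 1).and
    (hlim.eventually (gt_mem_nhds (by positivity : 0 < min 1 c / 4)))).exists
  have hmpos : 0 < m := hm1
  have hsm : s ^ m = Real.exp (-(δ * m)) := by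
    rw [← Real.exp_nat_mul]; congr 1; ring
  set l := min 1 (c * s ^ m)
  have hql : F.K ^ 2 * (C * q ^ m) ≤ l / 4 := by
    have h1 : F.K ^ 2 * (C * q ^ m) = F.K ^ 2 * (C * s ^ m) * s ^ m := by
      rw [hqδ, mul_pow]; ring
    have hsm1 : s ^ m ≤ 1 := pow_le_one₀ hs0.le hs1.le
    have hsm0 : 0 < s ^ m := pow_pos hs0 m
    have h2 : F.K ^ 2 * (C * s ^ m) * s ^ m ≤ min 1 c / 4 * s ^ m := by gcongr
    have h3 : min 1 c * s ^ m ≤ l := by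
      refine le_min ?_ ?_
      · exact mul_le_one₀ (min_le_left _ _) hsm0.le hsm1
      · exact mul_le_mul_of_nonneg_right (min_le_right _ _) hsm0.le
    rw [h1]; linarith
  have hm' := h.iterate m
  obtain ⟨S, hψ, hℓ, hlam, hSK, hSr, hsmooth⟩ := F.exists_coneSystem hA hm' (l := l)
    (q := C * q ^ m) (by positivity) (min_le_left _ _) (by positivity) hql
    (fun x hx v hv => hCq x hx v hv m) (fun x hx => by
      rw [F.lam_iterate, mul_one]
      refine (min_le_right _ _).trans ?_
      rw [hsm]; exact hcδ x hx m)
  obtain ⟨D⟩ := F.nonempty_flatDisc hm' S hψ hℓ hSK hSr hsmooth hg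
  obtain ⟨ρc, hρc, hcompl⟩ := F.exists_isComplete_closedBall hA
  have hprod : ∀ x ∈ A, ∀ n, ∏ k ∈ Finset.range n, ‖S.lam ((L^[m])^[k] x)‖ =
      ‖F.lam L (m * n) x‖ := by
    intro x hx n
    rw [← F.lam_iterate, F.lam_eq_prod hm' n hx, norm_prod, hlam]
  obtain ⟨d, hd, hthick⟩ := hA.exists_thickening_subset_open hV hAV
  obtain ⟨ε', hε', hshort⟩ := exists_dist_iterate_le hA
    (fun k x hx => (h.smooth_iterate k hx).continuousAt) m (lt_min hε (half_pos hd))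
  obtain ⟨x, hx, f, hfx, hnot⟩ := S.exists_slow_shadow hA hρc hcompl (fun δ' hδ' => by
    obtain ⟨c', hc', hle⟩ := hlow (δ' / m) (by positivity)
    refine ⟨c', hc', fun z hz n => ?_⟩
    rw [hprod z hz]
    refine le_trans (le_of_eq ?_) (hle z hz (m * n))
    congr 3
    push_cast
    field_simp) hg (M₀ := M₀) (fun n => by rw [hprod g hg]; exact hM₀ _) D hε'
  -- Shadowing under `L^[m]` is extended to the intermediate iterates of `L`; the bound `d / 2` also
  -- keeps the orbit of `f` inside `V`.
  have hdist : ∀ n, dist (L^[n] f) (L^[n] x) ≤ min ε (d / 2) := by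
    intro n
    have h1 := hshort _ (hm'.maps.iterate (n / m) hx) _ (hfx (n / m)) (n % m)
      (Nat.mod_lt _ hmpos)
    rwa [← Function.iterate_mul, ← Function.iterate_add_apply, ← Function.iterate_add_apply,
      Nat.mod_add_div] at h1
  refine not_not.2 ⟨f, x, hx, fun n => ?_, fun n => (hdist n).trans (min_le_left _ _),
    fun hexp => hnot (hexp.iterate hm1)⟩
  refine hthick (Metric.mem_thickening_iff.2 ⟨_, h.maps.iterate n hx, ?_⟩)
  linarith [(hdist n).trans (min_le_right _ _)]

end FrameAtlas

/-! ### Assembly of the criterion -/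

variable {E : Type*} [NormedAddCommGroup E] [NormedSpace ℂ E]
variable {U : Type*} [MetricSpace U] [ChartedSpace E U] [IsManifold 𝓘(ℂ, E) ω U]
variable {N : U → Seminorm ℂ E} {A : Set U} {Es : U → Submodule ℂ E} {L : U → U}

omit [IsManifold 𝓘(ℂ, E) ω U] in
lemma isSubbundle_top : IsSubbundle (E := E) A (fun _ => ⊤) := fun _ _ =>
  ⟨⊤, isClosed_univ, Submodule.closedComplemented_top, univ, univ_mem,
    fun _ => ContinuousLinearEquiv.refl ℂ E, continuousOn_const, fun _ _ _ => by simp⟩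

/-- A transversally nonsingular map has a nonvanishing transverse cocycle. -/
lemma FrameAtlas.lam_one_ne_zero (F : FrameAtlas N A Es) (h : InvMap A Es L)
    (hinj : ∀ x ∈ A, ∀ v, tanD E L x v ∈ Es (L x) → v ∈ Es x) {x : U} (hx : x ∈ A) :
    F.lam L 1 x ≠ 0 := by
  intro h0
  have h1 := F.lam_spec h 1 hx (F.ehat x)
  rw [h0, zero_mul, Function.iterate_one] at h1
  have h2 := (F.mem_Es_iff hx _).1 (hinj x hx _ ((F.mem_Es_iff (h.maps hx) _).2 h1))
  rw [F.m_ehat hx] at h2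
  exact one_ne_zero h2

omit [IsManifold 𝓘(ℂ, E) ω U] in
/-- If the whole tangent bundle over `A` is contracted, `A` is hyperbolic, with trivial unstable
spaces. -/
lemma uniformlyHyperbolic_of_contracts_top (h : FrameAtlas.Contracts E N A (fun _ => ⊤) L) :
    UniformlyHyperbolic (E := E) N L A :=
  have hzero : ∀ x y : U, ∀ D : E →L[ℂ] E, ∀ v ∈ (⊥ : Submodule ℂ E), ∀ n : ℕ,
      1 * (2 : ℝ) ^ n * N x v ≤ N y (D v) := by
    intro x y D v hv n
    rw [(Submodule.mem_bot ℂ).1 hv, map_zero, mul_zero]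
    exact apply_nonneg _ _
  ⟨fun _ => ⊤, fun _ => ⊥, isSubbundle_top, fun _ _ _ _ => trivial, h,
    fun _ => isClosed_singleton (X := E) (x := 0), fun _ => isCompl_top_bot,
    fun _ => (Submodule.map_bot _).symm, 1, 2, one_pos, one_lt_two,
    fun f v hv n => hzero _ _ (tanD E L^[n] (f.pt 0)) v hv n⟩

end LyubichHyp

end

theorem theorem8p3
    {E : Type*} [NormedAddCommGroup E] [NormedSpace ℂ E] [CompleteSpace E]
    {U : Type*} [MetricSpace U] [ChartedSpace E U] [IsManifold 𝓘(ℂ, E) ω U]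
    (N : ∀ x : U, Seminorm ℂ (TangentSpace 𝓘(ℂ, E) x))
    (L : U → U) (V A : Set U)
    (hA : IsCompact A) (hV : IsOpen V) (hAV : A ⊆ V)
    (hdist : LyubichHyp.CompatibleDist E A)
    (hnorm : LyubichHyp.CompatibleNorm N A)
    (hL : ContMDiffOn 𝓘(ℂ, E) 𝓘(ℂ, E) ω L V)
    (hLA : MapsTo L A A)
    (htrans : LyubichHyp.IsTransitiveOn L A)
    (hspec : LyubichHyp.SpecificationOn L A)
    (Es : ∀ x : U, Submodule ℂ (TangentSpace 𝓘(ℂ, E) x))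
    (hEs : LyubichHyp.IsSubbundle A Es)
    (hcodim : ∀ x ∈ A, Module.finrank ℂ (TangentSpace 𝓘(ℂ, E) x ⧸ Es x) = 1)
    (hinv : LyubichHyp.IsInvariantFamily L A Es)
    (hcontr : LyubichHyp.UniformlyContracting N L A Es)
    (hnonsing : ∀ (x : U) (hx : x ∈ A), Function.Bijective
      ((Es x).mapQ (Es (L x)) (mfderiv 𝓘(ℂ, E) 𝓘(ℂ, E) L x).toLinearMap (hinv x hx)))
    (hshadow : ∃ ε : ℝ, 0 < ε ∧ LyubichHyp.NoSlowShadowing L V A ε) :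
    LyubichHyp.UniformlyHyperbolic N L A := by
  obtain ⟨F⟩ : Nonempty (LyubichHyp.FrameAtlas (E := E) N A Es) :=
    LyubichHyp.nonempty_frameAtlas hA fun x hx =>
      LyubichHyp.nonempty_localFrame hdist hnorm hEs hcodim hx
  have h : LyubichHyp.InvMap (E := E) A Es L :=
    ⟨hLA, fun x hx => hL.contMDiffAt (hV.mem_nhds (hAV hx)), fun x hx _ hv => hinv x hx hv⟩
  -- Tangent spaces are definitionally the model space, so `iterDeriv` and `tanD` of an iterate are
  -- the same `mfderiv`.
  have hc : LyubichHyp.FrameAtlas.Contracts E N A Es L := hcontr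
  have hinj : ∀ x ∈ A, ∀ v : E, LyubichHyp.tanD E L x v ∈ Es (L x) → v ∈ Es x := by
    intro x hx v hv
    refine (Submodule.Quotient.mk_eq_zero (Es x)).1 ((hnonsing x hx).1 ?_)
    rw [map_zero]
    exact (Submodule.Quotient.mk_eq_zero (Es (L x))).2 hv
  obtain ⟨B, hB⟩ := F.exists_bounds hA hV hAV hL h fun x hx => F.lam_one_ne_zero h hinj hx
  -- The split is on periodic multipliers: without an attracting one the given bundle serves as
  -- stable bundle, and otherwise the whole tangent bundle does.
  by_cases hper : ∀ y ∈ A, ∀ p : ℕ, 1 ≤ p → Function.IsPeriodicPt L p y → 1 ≤ ‖F.lam L p y‖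
  · have hlow := fun δ (hδ : (0 : ℝ) < δ) => F.exists_lam_lower hA h hB hspec hper hδ
    rcases F.uniform_expansion_or_bounded hA h hB with ⟨c, ρ, hc0, hρ, hexp⟩ | ⟨g, hg, hM⟩
    · obtain ⟨Eu, h1, h2, h3, h4⟩ :=
        LyubichHyp.FrameAtlas.exists_unstable_family h hB hc hc0 hρ hexp
      exact ⟨Es, Eu, hEs, hinv, hcontr, h1, h2, h3, h4⟩
    · obtain ⟨ε, hε, hno⟩ := hshadow
      exact absurd hno (F.not_noSlowShadowing hA hV hAV h hc hlow hg hM hε)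
  · push Not at hper
    obtain ⟨g, hg, p, hp, hgp, hlam⟩ := hper
    exact LyubichHyp.uniformlyHyperbolic_of_contracts_top
      (LyubichHyp.FrameAtlas.contracts_top_of_attracting h hc hB htrans hg hp hgp hlam)
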